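/- Let $\mathcal O$ be a complete discrete valuation ring of characteristic $0$ with finite residue field $k$ of cardinality $q=p^h$, $p$ prime, let $\pi$ be a uniformizing parameter of $\mathcal O$ and let $e$ be the absolute ramification index of $\mathcal O$, i.e. $p$ has valuation $e$. Put $\mathcal O_0=W(k)$, the ring of $p$-typical Witt vectors, with uniformizing parameter $p$, embedded canonically in $\mathcal O$. For an $\mathcal O$-algebra $B$ let $W_{\mathcal O}(B)$ be the $\mathcal O$-algebra of ramified Witt vectors: the set $B^{\mathbb N_0}$ with the functorial $\mathcal O$-algebra structure for which the maps $\Phi_n(b)=b_0^{q^n}+\pi b_1^{q^{n-1}}+\dots+\pi^n b_n$ are homomorphisms of $\mathcal O$-algebras; similarly $W_{\mathcal O_0}$, with $p$ in place of $\pi$. For an extension $\mathcal O'$ of $\mathcal O$ with residue extension of degree $f$, let $u_{(\mathcal O,\mathcal O')}\colon W_{\mathcal O}(B)\to W_{\mathcal O'}(B)$ be the Drinfeld map, i.e. the homomorphism, functorial in the $\mathcal O'$-algebra $B$, with $\Phi'_n(u(b))=\Phi_{fn}(b)$; recall that $W_{\mathbb Z_p}(B)=W(B)$. We regard $W$, $W_{\mathcal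 O_0}$ and $W_{\mathcal O}$ as $k$-ring schemes by restricting them to $k$-algebras $A$ (special fibres). Let $\mathbb R_{\mathcal O}$ be the Greenberg algebra of $\mathcal O$, the $k$-ring scheme with $\mathbb R_{\mathcal O}(A)=W(A)\otimes_{W(k)}\mathcal O$, and let $\boldsymbol r\colon \mathbb R_{\mathcal O}\to \mathbb W_{\mathcal O,k}$ be the morphism of $k$-ring schemes given on $A$-sections by the $\mathcal O$-linear extension of $u_{(\mathbb Z_p,\mathcal O)}\colon W(A)\to W_{\mathcal O}(A)$. Let $\boldsymbol u_k$ denote $u_{(\mathbb Z_p,\mathcal O_0)}$ on $k$-algebras, and let $\boldsymbol u^{\rm ra}_k$ be the morphism given by the $\mathcal O$-linear extension $W_{\mathcal O_0}(A)\otimes_{\mathcal O_0}\mathcal O\to W_{\mathcal O}(A)$ of $u_{(\mathcal O_0,\mathcal O)}$. Isomorphisms with a spectrum are isomorphisms of $k$-schemes. (a) If $\mathcal O\cong W(k)$, then $W(A)\to W(A)\otimes_{W(k)}\mathcal O$, $x\mapsto x\otimes 1$, is an isomorphism $\mathbb W_k\cong\mathbb R_{\mathcal O}$, under which $\boldsymbol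 r$ is $u_{(\mathbb Z_p,\mathcal O)}$ on $k$-algebras, and $$\ker \boldsymbol r\cong \mathrm{Spec}\bigl(k[X_0,X_1,\dots]/(X_0,\dots,X_i^{p^{i(h-1)}},\dots)\bigr).$$ (b) If $k\cong\mathbb F_p$, then, under the isomorphism $W(A)\otimes_{W(k)}\mathcal O\cong W_{\mathcal O_0}(A)\otimes_{\mathcal O_0}\mathcal O$ induced by the identity on Witt components, $\boldsymbol r=\boldsymbol u^{\rm ra}_k$, and $$\ker \boldsymbol r\cong \mathrm{Spec}\bigl(k[X_{n,i};\,n\in\mathbb N_0,\,0\le i<e]/(X_{n,i}^{p^{n(e-1)+i}})\bigr).$$ (c) In general, there is an exact sequence of commutative affine $k$-group schemes (for the fpqc topology) $$0\to \prod_{i=0}^{e-1}\ker \boldsymbol u_k\to \ker\boldsymbol r\to \ker \boldsymbol u^{\rm ra}_k\to 0,$$ where $\ker\boldsymbol u_k$ and $\ker\boldsymbol u^{\rm ra}_k$ are pro-infinitesimal (cofiltered limits of finite local $k$-group schemes) and, as $k$-schemes, $\ker \boldsymbol u_k\cong \mathrm{Spec}(k[X_0,X_1,\dots]/(X_i^{p^{i(h-1)}};\,i\ge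 0))$ and $\ker\boldsymbol u^{\rm ra}_k\cong\mathrm{Spec}(k[X_{n,i};\,n\in\mathbb N_0,\,0\le i<e]/(X_{n,i}^{q^{n(e-1)+i}}))$. -/

import Mathlib

open CategoryTheory

universe u

namespace RamifiedWitt

/-! ## Ramified Witt vectors -/

/-- Data over which ramified Witt vectors are formed: an element `ϖ` of `R` (the uniformizing
parameter) and `q = p ^ f` such that `ϖ` is not a zero divisor, `ϖ ∣ p`, and `x ^ q ≡ x mod ϖ`.
The cases used are a discrete valuation ring with residue field of cardinality `q`, the ring
`W(k)` with `ϖ = p`, and `ℤ` with `ϖ = q = p` (the `p`-typical case). -/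
structure WittDatum (R : Type*) [CommRing R] (p : ℕ) where
  ϖ : R
  f : ℕ
  f_pos : 0 < f
  regular : ∀ x : R, ϖ * x = 0 → x = 0
  dvd_p : ϖ ∣ (p : R)
  frob : ∀ x : R, ϖ ∣ x ^ (p ^ f) - x

/-- The cardinality `q`. -/
def WittDatum.q {R : Type*} [CommRing R] {p : ℕ} (D : WittDatum R p) : ℕ := p ^ D.f

/-- The Witt polynomial `Φ_n = x_0^{q^n} + a x_1^{q^{n-1}} + ⋯ + a^n x_n`, evaluated in a ring. -/
def wittPoly {B : Type*} [CommRing B] (q : ℕ) (a : B) (n : ℕ) (x : ℕ → B) : B :=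
  ∑ i ∈ Finset.range (n + 1), a ^ i * x i ^ q ^ (n - i)

theorem map_wittPoly {B B' : Type*} [CommRing B] [CommRing B'] (ψ : B →+* B') (q : ℕ) (a : B)
    (n : ℕ) (x : ℕ → B) :
    ψ (wittPoly q a n x) = wittPoly q (ψ a) n (fun i => ψ (x i)) := by
  simp [wittPoly]

theorem wittPoly_succ {B : Type*} [CommRing B] (q : ℕ) (a : B) (n : ℕ) (x : ℕ → B) :
    wittPoly q a (n + 1) x = wittPoly q a n (fun i => x i ^ q) + a ^ (n + 1) * x (n + 1) := by
  unfold wittPoly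
  rw [Finset.sum_range_succ]
  congr 1
  · refine Finset.sum_congr rfl fun i hi => ?_
    have : n + 1 - i = (n - i) + 1 := by
      have := Finset.mem_range.1 hi
      omega
    rw [this, ← pow_mul, pow_succ, mul_comm q]
  · simp

open Classical in
/-- Some `c` with `b = a * c`, if there is one. -/
noncomputable def quot {B : Type*} [CommRing B] (a b : B) : B :=
  if h : a ∣ b then h.choose else 0

theorem mul_quot {B : Type*} [CommRing B] {a b : B} (h : a ∣ b) : a * quot a b = b := by
  rw [quot, dif_pos h]
  exact h.choose_spec.symm

/-- The solution `x` of the equations `Φ_n(x) = g n`, computed recursively. -/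
noncomputable def solve {B : Type*} [CommRing B] (q : ℕ) (a : B) (g : ℕ → B) : ℕ → B
  | n => quot (a ^ n) (g n - ∑ i : Fin n, a ^ (i : ℕ) * solve q a g i ^ q ^ (n - (i : ℕ)))
termination_by n => n

theorem dvd_pow_sub_pow {B : Type*} [CommRing B] {q : ℕ} {a : B} (ha : a ∣ (q : B)) {x y : B}
    (h : a ∣ x - y) (n : ℕ) : a ^ (n + 1) ∣ x ^ q ^ n - y ^ q ^ n := by
  induction n with
  | zero => simpa using h
  | succ n ih =>
    rw [pow_succ q n, pow_mul, pow_mul, ← (Commute.all _ _).geom_sum₂_mul, mul_comm,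
      pow_succ a (n + 1)]
    refine mul_dvd_mul ih ?_
    exact (dvd_geom_sum₂_iff_of_dvd_sub ((dvd_pow_self a n.succ_ne_zero).trans ih)).2
      (ha.mul_right _)

/-- If `σ` lifts the `q`-Frobenius modulo `a` and fixes `a`, then `σ (g n) ≡ g (n + 1)` modulo
`a ^ (n + 1)` for all `n` suffices for `g` to be a sequence of values of Witt polynomials. -/
theorem wittPoly_solve {B : Type*} [CommRing B] {q : ℕ} {a : B} (ha : a ∣ (q : B))
    (σ : B →+* B) (hσa : σ a = a) (hσ : ∀ b, a ∣ σ b - b ^ q) (g : ℕ → B)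
    (hg : ∀ n, a ^ (n + 1) ∣ σ (g n) - g (n + 1)) (n : ℕ) :
    wittPoly q a n (solve q a g) = g n := by
  induction n using Nat.strong_induction_on with
  | _ n ih =>
    have key : a ^ n ∣ g n - ∑ i : Fin n, a ^ (i : ℕ) * solve q a g i ^ q ^ (n - (i : ℕ)) := by
      rw [Fin.sum_univ_eq_sum_range (fun i => a ^ i * solve q a g i ^ q ^ (n - i))]
      cases n with
      | zero => simp
      | succ m =>
        have h1 : g (m + 1) - ∑ i ∈ Finset.range (m + 1),
              a ^ i * solve q a g i ^ q ^ (m + 1 - i)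
            = -(σ (g m) - g (m + 1)) + ∑ i ∈ Finset.range (m + 1),
              a ^ i * (σ (solve q a g i) ^ q ^ (m - i) - (solve q a g i ^ q) ^ q ^ (m - i)) := by
          rw [← ih m (Nat.lt_succ_self m), map_wittPoly, wittPoly, hσa]
          simp only [mul_sub, Finset.sum_sub_distrib]
          have : ∑ i ∈ Finset.range (m + 1), a ^ i * solve q a g i ^ q ^ (m + 1 - i)
              = ∑ i ∈ Finset.range (m + 1), a ^ i * (solve q a g i ^ q) ^ q ^ (m - i) := by
            refine Finset.sum_congr rfl fun i hi => ?_
            have : m + 1 - i = (m - i) + 1 := by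
              have := Finset.mem_range.1 hi
              omega
            rw [this, ← pow_mul, pow_succ, mul_comm q]
          rw [this]
          ring
        rw [h1]
        refine dvd_add ((hg m).neg_right) (Finset.dvd_sum fun i hi => ?_)
        have hi' : m + 1 = i + (m - i + 1) := by
          have := Finset.mem_range.1 hi
          omega
        rw [hi', pow_add]
        refine mul_dvd_mul_left _ ?_
        exact dvd_pow_sub_pow ha (hσ (solve q a g i)) (m - i)
    rw [wittPoly, Finset.sum_range_succ, Nat.sub_self, pow_zero, pow_one]
    conv_lhs => rw [solve]
    rw [mul_quot key, Fin.sum_univ_eq_sum_range (fun i => a ^ i * solve q a g i ^ q ^ (n - i))]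
    ring

theorem wittPoly_injective {B : Type*} [CommRing B] {q : ℕ} {a : B}
    (ha : ∀ x, a * x = 0 → x = 0) {x y : ℕ → B}
    (h : ∀ n, wittPoly q a n x = wittPoly q a n y) : x = y := by
  have hreg : ∀ n x, a ^ n * x = 0 → x = 0 := by
    intro n
    induction n with
    | zero => simp
    | succ n ih =>
      intro x hx
      rw [pow_succ, mul_assoc] at hx
      exact ha _ (ih _ hx)
  funext n
  induction n using Nat.strong_induction_on with
  | _ n ih =>
    have := h n
    rw [wittPoly, wittPoly, Finset.sum_range_succ, Finset.sum_range_succ,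
      Finset.sum_congr rfl fun i hi => by rw [ih i (Finset.mem_range.1 hi)]] at this
    simp only [Nat.sub_self, pow_zero, pow_one, add_right_inj] at this
    exact sub_eq_zero.1 (hreg n _ (by rw [mul_sub, this, sub_self]))

variable {R : Type*} [CommRing R] {p : ℕ} (D : WittDatum R p)

namespace WittDatum

theorem dvd_q : D.ϖ ∣ (D.q : R) := by
  rw [q, Nat.cast_pow]
  exact D.dvd_p.trans (dvd_pow_self _ D.f_pos.ne')

section Polynomial

variable {σ : Type*}

theorem C_dvd_q : (MvPolynomial.C D.ϖ : MvPolynomial σ R) ∣ (D.q : MvPolynomial σ R) := by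
  have := map_dvd (MvPolynomial.C (σ := σ)) D.dvd_q
  rwa [map_natCast] at this

theorem C_regular (x : MvPolynomial σ R) (h : MvPolynomial.C D.ϖ * x = 0) : x = 0 := by
  ext m
  rw [MvPolynomial.coeff_zero]
  refine D.regular _ ?_
  rw [← MvPolynomial.coeff_C_mul, h, MvPolynomial.coeff_zero]

theorem C_dvd_expand [Fact p.Prime] (b : MvPolynomial σ R) :
    MvPolynomial.C D.ϖ ∣ MvPolynomial.expand D.q b - b ^ D.q := by
  induction b using MvPolynomial.induction_on with
  | C a =>
    rw [MvPolynomial.expand_C, ← map_pow, ← map_sub]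
    refine map_dvd _ ?_
    rw [← neg_sub]
    exact (D.frob a).neg_right
  | add x y hx hy =>
    obtain ⟨r, hr⟩ := exists_add_pow_prime_pow_eq (Fact.out : p.Prime) x y D.f
    have h : MvPolynomial.expand D.q (x + y) - (x + y) ^ D.q
        = (MvPolynomial.expand D.q x - x ^ D.q) + (MvPolynomial.expand D.q y - y ^ D.q)
          - p * (x * y * r) := by
      rw [map_add]
      simp only [q] at *
      rw [hr]
      ring
    rw [h]
    refine dvd_sub (dvd_add hx hy) (Dvd.dvd.mul_right ?_ _)
    have := map_dvd (MvPolynomial.C (σ := σ)) D.dvd_p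
    rwa [map_natCast] at this
  | mul_X x i hx =>
    rw [map_mul, MvPolynomial.expand_X, mul_pow, ← sub_mul]
    exact hx.mul_right _

/-- The sequences of polynomials that are values of the Witt polynomials. -/
def Good (g : ℕ → MvPolynomial σ R) : Prop :=
  ∀ n, MvPolynomial.C D.ϖ ^ (n + 1) ∣ MvPolynomial.expand D.q (g n) - g (n + 1)

/-- The polynomials `S_n` with `Φ_n(S_0, …, S_n) = g n`. -/
noncomputable def structurePoly (g : ℕ → MvPolynomial σ R) : ℕ → MvPolynomial σ R :=
  solve D.q (MvPolynomial.C D.ϖ) g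

theorem wittPoly_structurePoly [Fact p.Prime] {g : ℕ → MvPolynomial σ R} (hg : D.Good g) (n : ℕ) :
    wittPoly D.q (MvPolynomial.C D.ϖ) n (D.structurePoly g) = g n :=
  wittPoly_solve D.C_dvd_q (MvPolynomial.expand D.q : MvPolynomial σ R →ₐ[R] _).toRingHom
    (MvPolynomial.expand_C _ _) D.C_dvd_expand g hg n

theorem good_wittPoly [Fact p.Prime] (x : ℕ → MvPolynomial σ R)
    (hx : ∀ i, MvPolynomial.expand D.q (x i) = x i ^ D.q) :
    D.Good fun n => wittPoly D.q (MvPolynomial.C D.ϖ) n x := by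
  intro n
  have h : MvPolynomial.expand D.q (wittPoly D.q (MvPolynomial.C D.ϖ) n x)
      = wittPoly D.q (MvPolynomial.C D.ϖ) n fun i => x i ^ D.q := by
    have := map_wittPoly (MvPolynomial.expand D.q : MvPolynomial σ R →ₐ[R] _).toRingHom D.q
      (MvPolynomial.C D.ϖ) n x
    refine this.trans ?_
    congr 1
    · exact MvPolynomial.expand_C _ _
    · exact funext hx
  beta_reduce
  rw [wittPoly_succ, h, sub_add_cancel_left]
  exact (dvd_mul_right _ _).neg_right

variable {D}

theorem Good.add {g g' : ℕ → MvPolynomial σ R} (hg : D.Good g) (hg' : D.Good g') :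
    D.Good (g + g') := fun n => by
  rw [Pi.add_apply, Pi.add_apply, map_add, add_sub_add_comm]
  exact dvd_add (hg n) (hg' n)

theorem Good.neg {g : ℕ → MvPolynomial σ R} (hg : D.Good g) : D.Good (-g) := fun n => by
  rw [Pi.neg_apply, Pi.neg_apply, map_neg, neg_sub_neg, ← neg_sub]
  exact (hg n).neg_right

theorem Good.mul {g g' : ℕ → MvPolynomial σ R} (hg : D.Good g) (hg' : D.Good g') :
    D.Good (g * g') := fun n => by
  have h : MvPolynomial.expand D.q ((g * g') n) - (g * g') (n + 1)
      = (MvPolynomial.expand D.q (g n) - g (n + 1)) * MvPolynomial.expand D.q (g' n)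
        + g (n + 1) * (MvPolynomial.expand D.q (g' n) - g' (n + 1)) := by
    rw [Pi.mul_apply, Pi.mul_apply, map_mul]
    ring
  rw [h]
  exact dvd_add ((hg n).mul_right _) ((hg' n).mul_left _)

theorem good_C (r : R) : D.Good fun _ => (MvPolynomial.C r : MvPolynomial σ R) := fun n => by
  simp

end Polynomial

end WittDatum

/-- The set `B^{ℕ}` of ramified Witt vectors with coefficients in the `R`-algebra `φ : R → B`. -/
@[ext]
structure RamWitt {B : Type*} [CommRing B] (D : WittDatum R p) (φ : R →+* B) where
  coeff : ℕ → B

namespace RamWitt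

variable {D} {B B' : Type*} [CommRing B] [CommRing B'] {φ : R →+* B} {φ' : R →+* B'}

/-- `Φ_n(b) = b_0^{q^n} + ϖ b_1^{q^{n-1}} + ⋯ + ϖ^n b_n`. -/
def ghost (n : ℕ) (b : RamWitt D φ) : B := wittPoly D.q (φ D.ϖ) n b.coeff

/-- Coefficientwise application of a homomorphism of `R`-algebras. -/
def mapFun (ψ : B →+* B') (_h : ψ.comp φ = φ') (b : RamWitt D φ) : RamWitt D φ' :=
  ⟨fun n => ψ (b.coeff n)⟩

/-- The vector obtained from the structure polynomials for `g` by substituting `x`. -/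
noncomputable def eval {σ : Type*} (g : ℕ → MvPolynomial σ R) (x : σ → B) : RamWitt D φ :=
  ⟨fun n => MvPolynomial.eval₂ φ x (D.structurePoly g n)⟩

theorem ghost_eval [Fact p.Prime] {σ : Type*} {g : ℕ → MvPolynomial σ R} (hg : D.Good g)
    (x : σ → B) (n : ℕ) : ghost n (eval g x : RamWitt D φ) = MvPolynomial.eval₂ φ x (g n) := by
  rw [← D.wittPoly_structurePoly hg n]
  have := map_wittPoly (MvPolynomial.eval₂Hom φ x) D.q (MvPolynomial.C D.ϖ) n (D.structurePoly g)
  rw [MvPolynomial.eval₂Hom_C] at this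
  exact this.symm

theorem mapFun_eval {σ : Type*} (g : ℕ → MvPolynomial σ R) (x : σ → B) (ψ : B →+* B')
    (h : ψ.comp φ = φ') :
    mapFun ψ h (eval g x : RamWitt D φ) = eval g fun i => ψ (x i) := by
  ext n
  subst h
  exact MvPolynomial.hom_eval₂ _ _ _ _

theorem ghost_mapFun (ψ : B →+* B') (h : ψ.comp φ = φ') (b : RamWitt D φ) (n : ℕ) :
    ghost n (mapFun ψ h b) = ψ (ghost n b) := by
  subst h
  exact (map_wittPoly ψ _ _ _ _).symm

/-- The polynomials `Φ_n` in the variables `X_{i,0}, X_{i,1}, …`. -/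
noncomputable def wittX (D : WittDatum R p) {ι : Type*} (i : ι) (n : ℕ) : MvPolynomial (ι × ℕ) R :=
  wittPoly D.q (MvPolynomial.C D.ϖ) n fun m => MvPolynomial.X (i, m)

theorem good_wittX [Fact p.Prime] (D : WittDatum R p) {ι : Type*} (i : ι) : D.Good (wittX D i) :=
  D.good_wittPoly _ fun _ => MvPolynomial.expand_X _ _

theorem eval₂_wittX {ι : Type*} (x : ι → RamWitt D φ) (i : ι) (n : ℕ) :
    MvPolynomial.eval₂ φ (fun j : ι × ℕ => (x j.1).coeff j.2) (wittX D i n) = ghost n (x i) := by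
  have := map_wittPoly (MvPolynomial.eval₂Hom φ fun j : ι × ℕ => (x j.1).coeff j.2) D.q
    (MvPolynomial.C D.ϖ) n fun m => MvPolynomial.X (i, m)
  rw [MvPolynomial.eval₂Hom_C] at this
  refine this.trans ?_
  simp [ghost]

noncomputable instance : Zero (RamWitt D φ) := ⟨⟨fun _ => 0⟩⟩

noncomputable instance : One (RamWitt D φ) := ⟨⟨fun n => if n = 0 then 1 else 0⟩⟩

noncomputable instance : Add (RamWitt D φ) :=
  ⟨fun x y => eval (wittX D 0 + wittX D 1) fun j : Fin 2 × ℕ => (![x, y] j.1).coeff j.2⟩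

noncomputable instance : Mul (RamWitt D φ) :=
  ⟨fun x y => eval (wittX D 0 * wittX D 1) fun j : Fin 2 × ℕ => (![x, y] j.1).coeff j.2⟩

noncomputable instance : Neg (RamWitt D φ) :=
  ⟨fun x => eval (-wittX D 0) fun j : Fin 1 × ℕ => (![x] j.1).coeff j.2⟩

/-- The vector with all ghost components equal to `r`. -/
noncomputable def scalar (φ : R →+* B) (r : R) : RamWitt D φ :=
  eval (fun _ => MvPolynomial.C r) (PEmpty.elim : PEmpty.{1} → B)

theorem ghost_zero [Fact p.Prime] (n : ℕ) : ghost n (0 : RamWitt D φ) = 0 := by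
  have hq : D.q ≠ 0 := pow_ne_zero _ (Fact.out : p.Prime).ne_zero
  change wittPoly D.q _ n (fun _ => 0) = 0
  simp [wittPoly, hq]

theorem ghost_one [Fact p.Prime] (n : ℕ) : ghost n (1 : RamWitt D φ) = 1 := by
  have hq : D.q ≠ 0 := pow_ne_zero _ (Fact.out : p.Prime).ne_zero
  change wittPoly D.q _ n (fun n => if n = 0 then 1 else 0) = 1
  simp [wittPoly, ite_pow, hq]

theorem ghost_add [Fact p.Prime] (x y : RamWitt D φ) (n : ℕ) :
    ghost n (x + y) = ghost n x + ghost n y := by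
  refine (ghost_eval ((good_wittX D 0).add (good_wittX D 1)) _ n).trans ?_
  rw [Pi.add_apply, MvPolynomial.eval₂_add, eval₂_wittX, eval₂_wittX]
  rfl

theorem ghost_mul [Fact p.Prime] (x y : RamWitt D φ) (n : ℕ) :
    ghost n (x * y) = ghost n x * ghost n y := by
  refine (ghost_eval ((good_wittX D 0).mul (good_wittX D 1)) _ n).trans ?_
  rw [Pi.mul_apply, MvPolynomial.eval₂_mul, eval₂_wittX, eval₂_wittX]
  rfl

theorem ghost_neg [Fact p.Prime] (x : RamWitt D φ) (n : ℕ) : ghost n (-x) = -ghost n x := by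
  refine (ghost_eval (good_wittX D 0).neg _ n).trans ?_
  have := map_neg (MvPolynomial.eval₂Hom φ fun j : Fin 1 × ℕ => (![x] j.1).coeff j.2)
    (wittX D 0 n)
  refine this.trans ?_
  exact congrArg Neg.neg (eval₂_wittX ![x] 0 n)

theorem ghost_scalar [Fact p.Prime] (r : R) (n : ℕ) : ghost n (scalar φ r : RamWitt D φ) = φ r := by
  refine (ghost_eval (D.good_C r) _ n).trans ?_
  rw [MvPolynomial.eval₂_C]

theorem mapFun_zero (ψ : B →+* B') (h : ψ.comp φ = φ') :
    mapFun ψ h (0 : RamWitt D φ) = 0 := by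
  ext n
  exact map_zero ψ

theorem mapFun_one (ψ : B →+* B') (h : ψ.comp φ = φ') :
    mapFun ψ h (1 : RamWitt D φ) = 1 := by
  ext n
  change ψ (if n = 0 then 1 else 0) = if n = 0 then 1 else 0
  split_ifs <;> simp

theorem mapFun_add (ψ : B →+* B') (h : ψ.comp φ = φ') (x y : RamWitt D φ) :
    mapFun ψ h (x + y) = mapFun ψ h x + mapFun ψ h y := by
  refine (mapFun_eval _ _ _ h).trans ?_
  refine congrArg (eval _) (funext fun ⟨i, m⟩ => ?_)
  fin_cases i <;> rfl

theorem mapFun_mul (ψ : B →+* B') (h : ψ.comp φ = φ') (x y : RamWitt D φ) :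
    mapFun ψ h (x * y) = mapFun ψ h x * mapFun ψ h y := by
  refine (mapFun_eval _ _ _ h).trans ?_
  refine congrArg (eval _) (funext fun ⟨i, m⟩ => ?_)
  fin_cases i <;> rfl

theorem mapFun_neg (ψ : B →+* B') (h : ψ.comp φ = φ') (x : RamWitt D φ) :
    mapFun ψ h (-x) = -mapFun ψ h x := by
  refine (mapFun_eval _ _ _ h).trans ?_
  refine congrArg (eval _) (funext fun ⟨i, m⟩ => ?_)
  fin_cases i
  rfl

theorem mapFun_scalar (ψ : B →+* B') (h : ψ.comp φ = φ') (r : R) :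
    mapFun ψ h (scalar φ r : RamWitt D φ) = scalar φ' r := by
  refine (mapFun_eval _ _ _ h).trans ?_
  exact congrArg (eval _) (funext fun i => i.elim)

theorem ext_ghost (hφ : ∀ b, φ D.ϖ * b = 0 → b = 0) {x y : RamWitt D φ}
    (h : ∀ n, ghost n x = ghost n y) : x = y :=
  RamWitt.ext (wittPoly_injective hφ h)

/-- Every ramified Witt vector lifts along `ψ` if `ψ` is surjective. -/
theorem mapFun_surjective (ψ : B →+* B') (h : ψ.comp φ = φ') (hψ : Function.Surjective ψ) :
    Function.Surjective (mapFun ψ h : RamWitt D φ → RamWitt D φ') := fun x => by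
  choose y hy using fun n => hψ (x.coeff n)
  exact ⟨⟨y⟩, RamWitt.ext (funext hy)⟩

/-- `R[X_b : b ∈ B] → B`. -/
noncomputable def cover (φ : R →+* B) : MvPolynomial B R →+* B := MvPolynomial.eval₂Hom φ id

theorem cover_comp (φ : R →+* B) : (cover φ).comp MvPolynomial.C = φ :=
  MvPolynomial.eval₂Hom_comp_C _ _

theorem cover_surjective (φ : R →+* B) : Function.Surjective (cover φ) := fun b =>
  ⟨MvPolynomial.X b, MvPolynomial.eval₂Hom_X' _ _ _⟩

theorem exists_lift (x : RamWitt D φ) :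
    ∃ x' : RamWitt D (MvPolynomial.C : R →+* MvPolynomial B R),
      mapFun (cover φ) (cover_comp φ) x' = x :=
  mapFun_surjective _ _ (cover_surjective φ) x

noncomputable instance [Fact p.Prime] : CommRing (RamWitt D φ) :=
  CommRing.ofMinimalAxioms
    (fun x y z => by
      obtain ⟨x, rfl⟩ := exists_lift x
      obtain ⟨y, rfl⟩ := exists_lift y
      obtain ⟨z, rfl⟩ := exists_lift z
      simp only [← mapFun_add]
      refine congrArg _ (ext_ghost D.C_regular fun n => ?_)
      simp only [ghost_add]
      ring)
    (fun x => by
      obtain ⟨x, rfl⟩ := exists_lift x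
      rw [← mapFun_zero _ (cover_comp φ), ← mapFun_add]
      refine congrArg _ (ext_ghost D.C_regular fun n => ?_)
      simp only [ghost_add, ghost_zero]
      ring)
    (fun x => by
      obtain ⟨x, rfl⟩ := exists_lift x
      rw [← mapFun_zero _ (cover_comp φ), ← mapFun_neg, ← mapFun_add]
      refine congrArg _ (ext_ghost D.C_regular fun n => ?_)
      simp only [ghost_add, ghost_zero, ghost_neg]
      ring)
    (fun x y z => by
      obtain ⟨x, rfl⟩ := exists_lift x
      obtain ⟨y, rfl⟩ := exists_lift y
      obtain ⟨z, rfl⟩ := exists_lift z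
      simp only [← mapFun_mul]
      refine congrArg _ (ext_ghost D.C_regular fun n => ?_)
      simp only [ghost_mul]
      ring)
    (fun x y => by
      obtain ⟨x, rfl⟩ := exists_lift x
      obtain ⟨y, rfl⟩ := exists_lift y
      simp only [← mapFun_mul]
      refine congrArg _ (ext_ghost D.C_regular fun n => ?_)
      simp only [ghost_mul]
      ring)
    (fun x => by
      obtain ⟨x, rfl⟩ := exists_lift x
      rw [← mapFun_one _ (cover_comp φ), ← mapFun_mul]
      refine congrArg _ (ext_ghost D.C_regular fun n => ?_)
      simp only [ghost_mul, ghost_one]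
      ring)
    (fun x y z => by
      obtain ⟨x, rfl⟩ := exists_lift x
      obtain ⟨y, rfl⟩ := exists_lift y
      obtain ⟨z, rfl⟩ := exists_lift z
      simp only [← mapFun_add, ← mapFun_mul]
      refine congrArg _ (ext_ghost D.C_regular fun n => ?_)
      simp only [ghost_add, ghost_mul]
      ring)

/-- The ring structure is the one for which the ghost components are homomorphisms. -/
def ghostHom [Fact p.Prime] (φ : R →+* B) (n : ℕ) : RamWitt D φ →+* B where
  toFun := ghost n
  map_zero' := ghost_zero n
  map_one' := ghost_one n
  map_add' x y := ghost_add x y n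
  map_mul' x y := ghost_mul x y n

/-- Functoriality of ramified Witt vectors. -/
def map [Fact p.Prime] (ψ : B →+* B') (h : ψ.comp φ = φ') : RamWitt D φ →+* RamWitt D φ' where
  toFun := mapFun ψ h
  map_zero' := mapFun_zero ψ h
  map_one' := mapFun_one ψ h
  map_add' := mapFun_add ψ h
  map_mul' := mapFun_mul ψ h

/-- The `R`-algebra structure of the ring of ramified Witt vectors; the scalar `r` has all its ghost
components equal to `r`. -/
noncomputable def scalarHom [Fact p.Prime] (D : WittDatum R p) (φ : R →+* B) :
    R →+* RamWitt D φ :=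
  (map φ (φ.comp_id)).comp
    { toFun := scalar (RingHom.id R)
      map_zero' := ext_ghost D.regular fun n => by simp only [ghost_scalar, ghost_zero, map_zero]
      map_one' := ext_ghost D.regular fun n => by simp only [ghost_scalar, ghost_one, map_one]
      map_add' := fun x y => ext_ghost D.regular fun n => by
        simp only [ghost_scalar, ghost_add, map_add]
      map_mul' := fun x y => ext_ghost D.regular fun n => by
        simp only [ghost_scalar, ghost_mul, map_mul] }

theorem scalarHom_apply [Fact p.Prime] (r : R) : scalarHom D φ r = scalar φ r :=
  mapFun_scalar φ φ.comp_id r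

theorem map_scalarHom [Fact p.Prime] (ψ : B →+* B') (h : ψ.comp φ = φ') (r : R) :
    map ψ h (scalarHom D φ r) = scalarHom D φ' r := by
  rw [scalarHom_apply, scalarHom_apply]
  exact mapFun_scalar ψ h r

end RamWitt

/-! ## The Drinfeld map -/

theorem wittPoly_add {B : Type*} [CommRing B] (q : ℕ) (a : B) (n r : ℕ) (x : ℕ → B) :
    a ^ (n + 1) ∣ wittPoly q a n (fun i => x i ^ q ^ r) - wittPoly q a (n + r) x := by
  induction r generalizing x with
  | zero => simp
  | succ r ih =>
    rw [← add_assoc, wittPoly_succ]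
    have h := ih fun i => x i ^ q
    have h' : (fun i => (x i ^ q) ^ q ^ r) = fun i => x i ^ q ^ (r + 1) := by
      funext i
      rw [← pow_mul, pow_succ', mul_comm]
    rw [h'] at h
    rw [← sub_sub]
    exact dvd_sub h (Dvd.dvd.mul_right (pow_dvd_pow _ (by omega)) _)

/-- A homomorphism `R → R'` with `q' = q ^ r` and `ϖ'` dividing the image of `ϖ`. -/
structure WittDatum.Hom {R R' : Type*} [CommRing R] [CommRing R'] {p : ℕ} (D : WittDatum R p)
    (D' : WittDatum R' p) where
  α : R →+* R'
  r : ℕ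
  hf : D'.f = D.f * r
  hϖ : D'.ϖ ∣ α D.ϖ

namespace RamWitt

section Drinfeld

variable {R' : Type*} [CommRing R'] {D} {D' : WittDatum R' p} (T : D.Hom D')
  {B B' : Type*} [CommRing B] [CommRing B'] {φ : R →+* B} {φ' : R' →+* B}
  {χ : R →+* B'} {χ' : R' →+* B'}

/-- The polynomials `Φ_{rn}`, over `R'`. -/
noncomputable def drinfeldPoly (n : ℕ) : MvPolynomial ℕ R' :=
  wittPoly D.q (MvPolynomial.C (T.α D.ϖ)) (T.r * n) MvPolynomial.X

theorem q_eq : D'.q = D.q ^ T.r := by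
  rw [WittDatum.q, WittDatum.q, T.hf, pow_mul]

theorem good_drinfeldPoly [Fact p.Prime] : D'.Good (drinfeldPoly T) := by
  intro n
  have h : MvPolynomial.expand D'.q (drinfeldPoly T n)
      = wittPoly D.q (MvPolynomial.C (T.α D.ϖ)) (T.r * n)
        fun i => (MvPolynomial.X i : MvPolynomial ℕ R') ^ D.q ^ T.r := by
    have := map_wittPoly (MvPolynomial.expand D'.q : MvPolynomial ℕ R' →ₐ[R'] _).toRingHom D.q
      (MvPolynomial.C (T.α D.ϖ)) (T.r * n) MvPolynomial.X
    refine this.trans ?_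
    congr 1
    · exact MvPolynomial.expand_C _ _
    · funext i
      rw [← q_eq]
      exact MvPolynomial.expand_X _ _
  have hr : 0 < T.r := Nat.pos_of_ne_zero fun h0 => D'.f_pos.ne' (by rw [T.hf, h0, mul_zero])
  rw [h, drinfeldPoly, Nat.mul_succ]
  refine ((pow_dvd_pow_of_dvd (map_dvd MvPolynomial.C T.hϖ) _).trans (pow_dvd_pow _ ?_)).trans
    (wittPoly_add _ _ _ _ _)
  exact Nat.succ_le_succ (Nat.le_mul_of_pos_left n hr)

/-- The Drinfeld map on sets. -/
noncomputable def drinfeldFun (_hφ : φ'.comp T.α = φ) (x : RamWitt D φ) : RamWitt D' φ' :=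
  eval (drinfeldPoly T) x.coeff

theorem ghost_drinfeldFun [Fact p.Prime] (hφ : φ'.comp T.α = φ) (x : RamWitt D φ) (n : ℕ) :
    ghost n (drinfeldFun T hφ x) = ghost (T.r * n) x := by
  refine (ghost_eval (good_drinfeldPoly T) _ n).trans ?_
  have := map_wittPoly (MvPolynomial.eval₂Hom φ' x.coeff) D.q
    (MvPolynomial.C (T.α D.ϖ)) (T.r * n) MvPolynomial.X
  refine this.trans ?_
  subst hφ
  simp [ghost]

theorem mapFun_drinfeldFun (hφ : φ'.comp T.α = φ) (hχ : χ'.comp T.α = χ) (ψ : B →+* B')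
    (h : ψ.comp φ = χ) (h' : ψ.comp φ' = χ') (x : RamWitt D φ) :
    mapFun ψ h' (drinfeldFun T hφ x) = drinfeldFun T hχ (mapFun ψ h x) :=
  mapFun_eval _ _ _ _

/-- The Drinfeld map `u`, characterized functorially by `Φ'_n(u(b)) = Φ_{rn}(b)`. -/
noncomputable def drinfeld [Fact p.Prime] (hφ : φ'.comp T.α = φ) :
    RamWitt D φ →+* RamWitt D' φ' :=
  have hc : (cover φ').comp (MvPolynomial.C.comp T.α) = φ := by
    rw [← RingHom.comp_assoc, cover_comp, hφ]
  have hs : Function.Surjective (mapFun (cover φ') hc : RamWitt D _ → RamWitt D φ) :=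
    mapFun_surjective _ hc (cover_surjective φ')
  { toFun := drinfeldFun T hφ
    map_zero' := by
      rw [← mapFun_zero (cover φ') hc, ← mapFun_zero (cover φ') (cover_comp φ'),
        ← mapFun_drinfeldFun T rfl hφ (cover φ') hc (cover_comp φ')]
      refine congrArg _ (ext_ghost D'.C_regular fun n => ?_)
      simp only [ghost_drinfeldFun, ghost_zero]
    map_one' := by
      rw [← mapFun_one (cover φ') hc, ← mapFun_one (cover φ') (cover_comp φ'),
        ← mapFun_drinfeldFun T rfl hφ (cover φ') hc (cover_comp φ')]
      refine congrArg _ (ext_ghost D'.C_regular fun n => ?_)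
      simp only [ghost_drinfeldFun, ghost_one]
    map_add' := fun x y => by
      obtain ⟨x, rfl⟩ := hs x
      obtain ⟨y, rfl⟩ := hs y
      rw [← mapFun_add]
      simp only [← mapFun_drinfeldFun T rfl hφ (cover φ') hc (cover_comp φ')]
      rw [← mapFun_add]
      refine congrArg _ (ext_ghost D'.C_regular fun n => ?_)
      simp only [ghost_drinfeldFun, ghost_add]
    map_mul' := fun x y => by
      obtain ⟨x, rfl⟩ := hs x
      obtain ⟨y, rfl⟩ := hs y
      rw [← mapFun_mul]
      simp only [← mapFun_drinfeldFun T rfl hφ (cover φ') hc (cover_comp φ')]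
      rw [← mapFun_mul]
      refine congrArg _ (ext_ghost D'.C_regular fun n => ?_)
      simp only [ghost_drinfeldFun, ghost_mul] }

/-- The Drinfeld map is `R`-linear. -/
theorem drinfeld_scalarHom [Fact p.Prime] (hφ : φ'.comp T.α = φ) (r : R) :
    drinfeld T hφ (scalarHom D φ r) = scalarHom D' φ' (T.α r) := by
  have h : drinfeldFun T (φ := T.α) (φ' := RingHom.id R') rfl (scalar T.α r)
      = (scalar (RingHom.id R') (T.α r) : RamWitt D' _) :=
    ext_ghost D'.regular fun n => by
      simp only [ghost_drinfeldFun, ghost_scalar, RingHom.id_apply]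
  rw [scalarHom_apply, scalarHom_apply, ← mapFun_scalar φ' hφ r,
    ← mapFun_scalar φ' (φ'.comp_id) (T.α r), ← h]
  exact (mapFun_drinfeldFun T rfl hφ φ' hφ (φ'.comp_id) _).symm

end Drinfeld

end RamWitt

/-! ## `p`-typical Witt vectors as ramified Witt vectors -/

section Typical

variable (p) in
/-- The datum over `ℤ` with `ϖ = q = p`. -/
def intDatum [Fact p.Prime] : WittDatum ℤ p where
  ϖ := p
  f := 1
  f_pos := one_pos
  regular x hx := by
    have : (p : ℤ) ≠ 0 := by exact_mod_cast (Fact.out : p.Prime).ne_zero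
    exact (mul_eq_zero.1 hx).resolve_left this
  dvd_p := by simp
  frob x := by
    rw [← ZMod.intCast_zmod_eq_zero_iff_dvd]
    simp

variable [Fact p.Prime] {B B' : Type*} [CommRing B] [CommRing B'] {D}

/-- A `p`-typical Witt vector, viewed as a ramified Witt vector over `ℤ`, on sets. -/
def ofWittFun (φ : ℤ →+* B) (x : WittVector p B) : RamWitt (intDatum p) φ := ⟨x.coeff⟩

theorem ghost_ofWittFun (φ : ℤ →+* B) (x : WittVector p B) (n : ℕ) :
    RamWitt.ghost n (ofWittFun φ x) = WittVector.ghostComponent n x := by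
  rw [WittVector.ghostComponent_apply, aeval_wittPolynomial]
  simp [RamWitt.ghost, wittPoly, ofWittFun, intDatum, WittDatum.q]

theorem mapFun_ofWittFun (φ : ℤ →+* B) (φ' : ℤ →+* B') (ψ : B →+* B') (h : ψ.comp φ = φ')
    (x : WittVector p B) :
    RamWitt.mapFun ψ h (ofWittFun φ x) = ofWittFun φ' (WittVector.map ψ x) := by
  ext n
  exact (WittVector.map_coeff ψ x n).symm

/-- `p`-typical Witt vectors are the ramified Witt vectors over `ℤ` with `ϖ = q = p`. -/
def ofWitt (φ : ℤ →+* B) : WittVector p B →+* RamWitt (intDatum p) φ :=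
  have hs : Function.Surjective (WittVector.map (p := p) (RamWitt.cover φ)) :=
    WittVector.map_surjective _ (RamWitt.cover_surjective φ)
  have hc := RamWitt.cover_comp φ
  { toFun := ofWittFun φ
    map_zero' := by
      rw [← map_zero (WittVector.map (RamWitt.cover φ)), ← RamWitt.mapFun_zero (RamWitt.cover φ) hc,
        ← mapFun_ofWittFun MvPolynomial.C φ _ hc]
      refine congrArg _ (RamWitt.ext_ghost (intDatum p).C_regular fun n => ?_)
      simp only [ghost_ofWittFun, RamWitt.ghost_zero, map_zero]
    map_one' := by
      rw [← map_one (WittVector.map (RamWitt.cover φ)), ← RamWitt.mapFun_one (RamWitt.cover φ) hc,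
        ← mapFun_ofWittFun MvPolynomial.C φ _ hc]
      refine congrArg _ (RamWitt.ext_ghost (intDatum p).C_regular fun n => ?_)
      simp only [ghost_ofWittFun, RamWitt.ghost_one, map_one]
    map_add' := fun x y => by
      obtain ⟨x, rfl⟩ := hs x
      obtain ⟨y, rfl⟩ := hs y
      rw [← map_add]
      simp only [← mapFun_ofWittFun MvPolynomial.C φ _ hc]
      rw [← RamWitt.mapFun_add]
      refine congrArg _ (RamWitt.ext_ghost (intDatum p).C_regular fun n => ?_)
      simp only [ghost_ofWittFun, RamWitt.ghost_add, map_add]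
    map_mul' := fun x y => by
      obtain ⟨x, rfl⟩ := hs x
      obtain ⟨y, rfl⟩ := hs y
      rw [← map_mul]
      simp only [← mapFun_ofWittFun MvPolynomial.C φ _ hc]
      rw [← RamWitt.mapFun_mul]
      refine congrArg _ (RamWitt.ext_ghost (intDatum p).C_regular fun n => ?_)
      simp only [ghost_ofWittFun, RamWitt.ghost_mul, map_mul] }

/-- The morphism of data underlying the Drinfeld map from `p`-typical Witt vectors. -/
def typicalHom (D : WittDatum R p) : (intDatum p).Hom D where
  α := Int.castRingHom R
  r := D.f
  hf := (one_mul _).symm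
  hϖ := by simpa [intDatum] using D.dvd_p

/-- The Drinfeld map `u : W(B) → W_R(B)` for an `R`-algebra `B`. -/
noncomputable def typicalDrinfeld (D : WittDatum R p) (φ : R →+* B) :
    WittVector p B →+* RamWitt D φ :=
  (RamWitt.drinfeld (typicalHom D) rfl).comp (ofWitt (φ.comp (Int.castRingHom R)))

theorem ghost_typicalDrinfeld (φ : R →+* B) (x : WittVector p B) (n : ℕ) :
    RamWitt.ghost n (typicalDrinfeld D φ x) = WittVector.ghostComponent (D.f * n) x :=
  (RamWitt.ghost_drinfeldFun (typicalHom D) rfl _ n).trans (ghost_ofWittFun _ _ _)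

theorem map_typicalDrinfeld {φ : R →+* B} {φ' : R →+* B'} (ψ : B →+* B') (h : ψ.comp φ = φ')
    (x : WittVector p B) :
    RamWitt.map ψ h (typicalDrinfeld D φ x) = typicalDrinfeld D φ' (WittVector.map ψ x) := by
  subst h
  refine (RamWitt.mapFun_drinfeldFun _ rfl rfl ψ rfl rfl _).trans ?_
  exact congrArg _ (mapFun_ofWittFun _ _ _ _ _)

end Typical

/-! ## The canonical map `W(k) → R` -/

section Canonical

theorem one_lt_q [Fact p.Prime] : 1 < D.q := Nat.one_lt_pow D.f_pos.ne' (Fact.out : p.Prime).one_lt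

variable {D}

theorem pow_regular (n : ℕ) (x : R) (h : D.ϖ ^ (n + 1) ∣ D.ϖ ^ n * x) : D.ϖ ∣ x := by
  obtain ⟨c, hc⟩ := h
  refine ⟨c, ?_⟩
  rw [pow_succ, mul_assoc] at hc
  have h0 : D.ϖ ^ n * (x - D.ϖ * c) = 0 := by rw [mul_sub, hc, sub_self]
  have : ∀ n y, D.ϖ ^ n * y = 0 → y = 0 := by
    intro n
    induction n with
    | zero => simp
    | succ n ih =>
      intro y hy
      rw [pow_succ, mul_assoc] at hy
      exact D.regular _ (ih _ hy)
  exact sub_eq_zero.1 (this n _ h0)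

theorem dvd_coeff_sub {x y : ℕ → R}
    (h : ∀ n, D.ϖ ^ (n + 1) ∣ wittPoly D.q D.ϖ n x - wittPoly D.q D.ϖ n y) (n : ℕ) :
    D.ϖ ∣ x n - y n := by
  induction n using Nat.strong_induction_on with
  | _ n ih =>
    refine pow_regular n _ ?_
    have hn := h n
    rw [wittPoly, wittPoly, Finset.sum_range_succ, Finset.sum_range_succ, add_sub_add_comm,
      ← Finset.sum_sub_distrib, Nat.sub_self, pow_zero, pow_one, pow_one, ← mul_sub] at hn
    refine (dvd_add_right (Finset.dvd_sum fun i hi => ?_)).1 hn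
    have hi' := Finset.mem_range.1 hi
    rw [← mul_sub, show n + 1 = i + (n - i + 1) by omega, pow_add]
    exact mul_dvd_mul_left _ (dvd_pow_sub_pow D.dvd_q (ih i hi') _)

variable [Fact p.Prime] {k : Type*} [CommRing k] {ρ : R →+* k}

/-- If `R` is `ϖ`-adically complete with residue ring `k`, then `R → W_R(k)` is bijective. -/
theorem scalarHom_bijective [IsAdicComplete (Ideal.span {D.ϖ}) R]
    (hs : Function.Surjective ρ) (hρ : ∀ x, ρ x = 0 ↔ D.ϖ ∣ x) :
    Function.Bijective (RamWitt.scalarHom D ρ) := by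
  have hmod : ∀ n (x y : R), x ≡ y [SMOD (Ideal.span {D.ϖ} ^ n • ⊤ : Ideal R)] ↔
      D.ϖ ^ n ∣ x - y := fun n x y => by
    rw [SModEq.sub_mem, smul_eq_mul, Ideal.mul_top, Ideal.span_singleton_pow,
      Ideal.mem_span_singleton]
  have hcoeff : ∀ r n, (RamWitt.scalarHom D ρ r).coeff n
      = ρ ((RamWitt.scalar (RingHom.id R) r : RamWitt D _).coeff n) := fun r n => rfl
  have hgh : ∀ r n, wittPoly D.q D.ϖ n (RamWitt.scalar (RingHom.id R) r : RamWitt D _).coeff = r :=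
    fun r n => RamWitt.ghost_scalar (φ := RingHom.id R) r n
  constructor
  · refine (injective_iff_map_eq_zero _).2 fun r hr => ?_
    refine IsHausdorff.haus (I := Ideal.span {D.ϖ}) inferInstance r fun n => ?_
    rw [hmod, sub_zero]
    refine (pow_dvd_pow _ n.le_succ).trans ?_
    rw [← hgh r n]
    refine Finset.dvd_sum fun i hi => ?_
    have hi' := Finset.mem_range.1 hi
    have h1 : D.ϖ ∣ (RamWitt.scalar (RingHom.id R) r : RamWitt D _).coeff i := by
      rw [← hρ, ← hcoeff, hr]
      rfl
    rw [Nat.succ_eq_add_one, show n + 1 = i + (n - i + 1) by omega, pow_add]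
    refine mul_dvd_mul_left _ ((pow_dvd_pow _ ?_).trans (pow_dvd_pow_of_dvd h1 _))
    exact Nat.lt_pow_self (one_lt_q D)
  · intro a
    choose b hb using fun n => hs (a.coeff n)
    have hstep : ∀ n, D.ϖ ^ (n + 1) ∣ wittPoly D.q D.ϖ n b - wittPoly D.q D.ϖ (n + 1) b := by
      intro n
      rw [wittPoly_succ, ← sub_sub]
      refine dvd_sub ?_ (dvd_mul_right _ _)
      rw [wittPoly, wittPoly, ← Finset.sum_sub_distrib]
      refine Finset.dvd_sum fun i hi => ?_
      have hi' := Finset.mem_range.1 hi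
      rw [← mul_sub, show n + 1 = i + (n - i + 1) by omega, pow_add]
      refine mul_dvd_mul_left _ ?_
      refine dvd_pow_sub_pow D.dvd_q ?_ _
      rw [← neg_sub]
      exact (D.frob _).neg_right
    obtain ⟨L, hL⟩ := IsPrecomplete.prec (I := Ideal.span {D.ϖ}) inferInstance
      (f := fun n => wittPoly D.q D.ϖ n b) (fun {m n} hmn => by
        rw [hmod]
        induction n, hmn using Nat.le_induction with
        | base => simp
        | succ n hmn ih =>
          have := dvd_add ih ((pow_dvd_pow _ (by omega)).trans (hstep n))
          simpa using this)
    refine ⟨L, RamWitt.ext (funext fun n => ?_)⟩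
    rw [hcoeff, ← hb, ← sub_eq_zero, ← map_sub, hρ]
    refine dvd_coeff_sub (fun m => ?_) n
    rw [hgh, ← neg_sub]
    refine Dvd.dvd.neg_right ?_
    have := dvd_add (hstep m) ((hmod _ _ _).1 (hL (m + 1)))
    simpa using this

/-- The canonical map `W(k) → R` for `R` complete with residue ring `k`: the Drinfeld map
`W(k) → W_R(k)` followed by the inverse of the isomorphism `R ≃ W_R(k)`. -/
noncomputable def canonicalMap [IsAdicComplete (Ideal.span {D.ϖ}) R]
    (hs : Function.Surjective ρ) (hρ : ∀ x, ρ x = 0 ↔ D.ϖ ∣ x) : WittVector p k →+* R :=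
  ((RingEquiv.ofBijective _ (scalarHom_bijective (D := D) hs hρ)).symm : _ →+* R).comp
    (typicalDrinfeld D ρ)

theorem scalarHom_canonicalMap [IsAdicComplete (Ideal.span {D.ϖ}) R]
    (hs : Function.Surjective ρ) (hρ : ∀ x, ρ x = 0 ↔ D.ϖ ∣ x) (x : WittVector p k) :
    RamWitt.scalarHom D ρ (canonicalMap hs hρ x) = typicalDrinfeld D ρ x :=
  (RingEquiv.ofBijective _ (scalarHom_bijective (D := D) hs hρ)).apply_symm_apply _

/-- `canonicalMap` induces the identity on `k`. -/
theorem residue_canonicalMap [IsAdicComplete (Ideal.span {D.ϖ}) R]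
    (hs : Function.Surjective ρ) (hρ : ∀ x, ρ x = 0 ↔ D.ϖ ∣ x) (x : WittVector p k) :
    ρ (canonicalMap hs hρ x) = x.coeff 0 := by
  have h := congrArg (RamWitt.ghost 0) (scalarHom_canonicalMap hs hρ x)
  rw [RamWitt.scalarHom_apply, RamWitt.ghost_scalar, ghost_typicalDrinfeld, mul_zero,
    WittVector.ghostComponent_apply, aeval_wittPolynomial] at h
  simpa using h

end Canonical

/-! ## The data attached to `O` and to `W(k)` -/

section Data

open IsLocalRing

/-- The datum of a discrete valuation ring with uniformizing parameter `π` and residue field of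
cardinality `p ^ h`. -/
def dvrDatum {O : Type*} [CommRing O] [IsDomain O] [IsDiscreteValuationRing O] {p h : ℕ}
    [Fact p.Prime] {π : O} (hπ : Irreducible π) (hk : Nat.card (ResidueField O) = p ^ h) :
    WittDatum O p :=
  have hp : p.Prime := Fact.out
  have hdvd : ∀ x : O, residue O x = 0 → π ∣ x := fun x hx => by
    rwa [residue_eq_zero_iff, hπ.maximalIdeal_eq, Ideal.mem_span_singleton] at hx
  have hfin : Finite (ResidueField O) :=
    Nat.finite_of_card_ne_zero (by rw [hk]; exact pow_ne_zero _ hp.ne_zero)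
  { ϖ := π
    f := h
    f_pos := Nat.pos_of_ne_zero fun h0 => by
      have := Finite.one_lt_card (α := ResidueField O)
      rw [hk, h0, pow_zero] at this
      exact lt_irrefl _ this
    regular := fun x hx => (mul_eq_zero.1 hx).resolve_left hπ.ne_zero
    dvd_p := hdvd _ <| by
      have : Fintype (ResidueField O) := Fintype.ofFinite _
      have h1 := Nat.cast_card_eq_zero (ResidueField O)
      rw [← Nat.card_eq_fintype_card, hk, Nat.cast_pow] at h1
      rw [map_natCast]
      exact eq_zero_of_pow_eq_zero h1
    frob := fun x => hdvd _ <| by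
      have : Fintype (ResidueField O) := Fintype.ofFinite _
      rw [map_sub, map_pow, ← hk, Nat.card_eq_fintype_card, FiniteField.pow_card, sub_self] }

theorem dvrDatum_residue {O : Type*} [CommRing O] [IsDomain O] [IsDiscreteValuationRing O]
    {p h : ℕ} [Fact p.Prime] {π : O} (hπ : Irreducible π)
    (hk : Nat.card (ResidueField O) = p ^ h) (x : O) :
    residue O x = 0 ↔ (dvrDatum hπ hk).ϖ ∣ x := by
  rw [residue_eq_zero_iff, hπ.maximalIdeal_eq, Ideal.mem_span_singleton]
  rfl

theorem charP_of_card {k : Type*} [Field k] {p h : ℕ} [Fact p.Prime] (hk : Nat.card k = p ^ h) :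
    CharP k p := by
  have hp : p.Prime := Fact.out
  have hfin : Finite k := Nat.finite_of_card_ne_zero (by rw [hk]; exact pow_ne_zero _ hp.ne_zero)
  have : Fintype k := Fintype.ofFinite _
  have h1 := Nat.cast_card_eq_zero k
  rw [← Nat.card_eq_fintype_card, hk, Nat.cast_pow] at h1
  exact (CharP.charP_iff_prime_eq_zero hp).2 (eq_zero_of_pow_eq_zero h1)

/-- The datum of `O₀ = W(k)` with uniformizing parameter `p`, for a field `k` with `p ^ h`
elements. -/
noncomputable def wittDatum {k : Type*} [Field k] {p h : ℕ} [Fact p.Prime] (hk : Nat.card k = p ^ h) :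
    WittDatum (WittVector p k) p :=
  have hp : p.Prime := Fact.out
  have hfin : Finite k := Nat.finite_of_card_ne_zero (by rw [hk]; exact pow_ne_zero _ hp.ne_zero)
  have : CharP k p := charP_of_card hk
  { ϖ := p
    f := h
    f_pos := Nat.pos_of_ne_zero fun h0 => by
      have := Finite.one_lt_card (α := k)
      rw [hk, h0, pow_zero] at this
      exact lt_irrefl _ this
    regular := fun x hx => WittVector.eq_zero_of_p_mul_eq_zero x (by rwa [mul_comm])
    dvd_p := dvd_rfl
    frob := fun x => by
      have : Fintype k := Fintype.ofFinite _
      rw [← Ideal.mem_span_singleton, ← WittVector.ker_constantCoeff, RingHom.mem_ker, map_sub,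
        map_pow, ← hk, Nat.card_eq_fintype_card, FiniteField.pow_card, sub_self] }

end Data

/-! ## Tensor products over explicit ring homomorphisms -/

section TensorRing

variable {S B C B' E : Type*} [CommRing S] [CommRing B] [CommRing C] [CommRing B'] [CommRing E]

/-- The ring `B ⊗_S C` for ring homomorphisms `f : S → B` and `g : S → C`. -/
def TensorRing (f : S →+* B) (g : S →+* C) : Type _ :=
  letI := f.toAlgebra
  letI := g.toAlgebra
  TensorProduct S B C

namespace TensorRing

noncomputable instance (f : S →+* B) (g : S →+* C) : CommRing (TensorRing f g) :=
  @Algebra.TensorProduct.instCommRing S B C _ _ f.toAlgebra _ g.toAlgebra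

/-- The element `b ⊗ c`. -/
def tmul (f : S →+* B) (g : S →+* C) (b : B) (c : C) : TensorRing f g :=
  letI := f.toAlgebra
  letI := g.toAlgebra
  TensorProduct.tmul S b c

/-- `b ↦ b ⊗ 1`. -/
noncomputable def inl (f : S →+* B) (g : S →+* C) : B →+* TensorRing f g :=
  letI := f.toAlgebra
  letI := g.toAlgebra
  (Algebra.TensorProduct.includeLeft : B →ₐ[S] TensorProduct S B C).toRingHom

/-- `c ↦ 1 ⊗ c`. -/
noncomputable def inr (f : S →+* B) (g : S →+* C) : C →+* TensorRing f g :=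
  letI := f.toAlgebra
  letI := g.toAlgebra
  (Algebra.TensorProduct.includeRight : C →ₐ[S] TensorProduct S B C).toRingHom

variable {f : S →+* B} {g : S →+* C}

theorem inl_comp (s : S) : inl f g (f s) = inr f g (g s) := by
  let := f.toAlgebra
  let := g.toAlgebra
  exact (Algebra.TensorProduct.includeLeft : B →ₐ[S] TensorProduct S B C).commutes s |>.trans
    ((Algebra.TensorProduct.includeRight : C →ₐ[S] TensorProduct S B C).commutes s).symm

/-- The homomorphism `b ⊗ c ↦ u b * v c`. -/
noncomputable def lift (u : B →+* E) (v : C →+* E) (h : ∀ s, u (f s) = v (g s)) :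
    TensorRing f g →+* E :=
  letI := f.toAlgebra
  letI := g.toAlgebra
  letI := (u.comp f).toAlgebra
  (Algebra.TensorProduct.productMap (R := S) (A := B) (B := C) (S := E)
    { u with commutes' := fun _ => rfl }
    { v with commutes' := fun s => (h s).symm }).toRingHom

theorem lift_tmul (u : B →+* E) (v : C →+* E) (h : ∀ s, u (f s) = v (g s)) (b : B) (c : C) :
    lift u v h (tmul f g b c) = u b * v c :=
  letI := f.toAlgebra
  letI := g.toAlgebra
  letI := (u.comp f).toAlgebra
  Algebra.TensorProduct.productMap_apply_tmul (R := S) (A := B) (B := C) (S := E)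
    { u with commutes' := fun _ => rfl }
    { v with commutes' := fun s => (h s).symm } b c

theorem inl_apply (b : B) : inl f g b = tmul f g b 1 := rfl

theorem inr_apply (c : C) : inr f g c = tmul f g 1 c := rfl

theorem hom_ext {u v : TensorRing f g →+* E} (h : ∀ b c, u (tmul f g b c) = v (tmul f g b c)) :
    u = v := by
  let := f.toAlgebra
  let := g.toAlgebra
  ext x
  refine TensorProduct.induction_on (motive := fun x : TensorProduct S B C => u x = v x) x
    ((map_zero u).trans (map_zero v).symm) h fun x y hx hy => ?_
  exact ((map_add u x y).trans (congrArg₂ _ hx hy)).trans (map_add v x y).symm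

/-- Functoriality in the first factor: `b ⊗ c ↦ w b ⊗ c`. -/
noncomputable def map {f' : S →+* B'} (w : B →+* B') (h : ∀ s, w (f s) = f' s) :
    TensorRing f g →+* TensorRing f' g :=
  lift ((inl f' g).comp w) (inr f' g) fun s => by
    rw [RingHom.comp_apply, h, inl_comp]

theorem map_tmul {f' : S →+* B'} (w : B →+* B') (h : ∀ s, w (f s) = f' s) (b : B) (c : C) :
    map w h (tmul f g b c) = tmul f' g (w b) c := by
  refine (lift_tmul _ _ _ _ _).trans ?_
  let := f'.toAlgebra
  let := g.toAlgebra
  refine (Algebra.TensorProduct.tmul_mul_tmul (R := S) (w b) (1 : B') (1 : C) c).trans ?_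
  rw [mul_one, one_mul]
  rfl

end TensorRing

end TensorRing

/-! ## Ring functors and group functors on `k`-algebras -/

section Functors

variable (k : Type u) [Field k]

/-- The functor of points, on affine `k`-schemes, of a `k`-scheme: `A ↦ Hom_k(Spec A, X)`. -/
noncomputable def points (X : Over (AlgebraicGeometry.Spec (CommRingCat.of k))) :
    CommAlgCat.{u} k ⥤ Type u :=
  (AlgebraicGeometry.algSpec (CommRingCat.of k)).rightOp ⋙ yoneda.obj X

/-- `Spec C` as a `k`-scheme. -/
noncomputable def specOver (C : Type u) [CommRing C] [Algebra k C] :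
    Over (AlgebraicGeometry.Spec (CommRingCat.of k)) :=
  (AlgebraicGeometry.algSpec (CommRingCat.of k)).obj (Opposite.op (CommAlgCat.of k C))

variable {k}

/-- The commutative group functor `G` is, as a functor of sets, the functor of points of the affine
`k`-scheme `Spec C`; that is, the underlying `k`-scheme of `G` is isomorphic to `Spec C`. -/
def IsSpec (G : CommAlgCat.{u} k ⥤ AddCommGrpCat.{u}) (C : Type u) [CommRing C] [Algebra k C] :
    Prop :=
  Nonempty (G ⋙ forget AddCommGrpCat.{u} ≅ points k (specOver k C))

/-- Commutative affine `k`-group schemes, as functors. -/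
def IsAffineGroup (G : CommAlgCat.{u} k ⥤ AddCommGrpCat.{u}) : Prop :=
  ∃ C : CommAlgCat.{u} k, IsSpec G C

/-- Infinitesimal `k`-group schemes: finite and local. -/
def IsInfinitesimal (G : CommAlgCat.{u} k ⥤ AddCommGrpCat.{u}) : Prop :=
  ∃ C : CommAlgCat.{u} k, Module.Finite k C ∧ IsLocalRing C ∧ IsSpec G C

/-- Pro-infinitesimal `k`-group schemes: cofiltered limits of infinitesimal ones. -/
def IsProInfinitesimal (G : CommAlgCat.{u} k ⥤ AddCommGrpCat.{u}) : Prop :=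
  ∃ (J : Type u) (_ : SmallCategory J) (_ : IsCofiltered J)
    (F : J ⥤ CommAlgCat.{u} k ⥤ AddCommGrpCat.{u}) (c : Limits.Cone F),
    (∀ j, IsInfinitesimal (F.obj j)) ∧ Nonempty (Limits.IsLimit c) ∧ Nonempty (c.pt ≅ G)

/-- `0 → N → G → Q → 0` is an exact sequence of commutative affine `k`-group schemes (for the
fpqc topology): `G` is an extension of `Q` by `N`. -/
structure IsExtension {N G Q : CommAlgCat.{u} k ⥤ AddCommGrpCat.{u}} (i : N ⟶ G) (j : G ⟶ Q) :
    Prop where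
  affine_left : IsAffineGroup N
  affine_middle : IsAffineGroup G
  affine_right : IsAffineGroup Q
  injective : ∀ A, Function.Injective (i.app A)
  exact : ∀ A (g : G.obj A), j.app A g = 0 ↔ ∃ n, i.app A n = g
  surjective : ∀ A (x : Q.obj A), ∃ (A' : CommAlgCat.{u} k) (f : A ⟶ A'),
    (f.hom : A →+* A').FaithfullyFlat ∧ ∃ g : G.obj A', j.app A' g = Q.map f x

/-- The kernel of a morphism of ring schemes, as an additive group scheme. -/
noncomputable def ker {F G : CommAlgCat.{u} k ⥤ CommRingCat.{u}} (τ : F ⟶ G) :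
    CommAlgCat.{u} k ⥤ AddCommGrpCat.{u} where
  obj A := AddCommGrpCat.of (RingHom.ker (τ.app A).hom)
  map {A A'} f := AddCommGrpCat.ofHom
    { toFun := fun x => ⟨F.map f x.1, by
        have h := ConcreteCategory.congr_hom (τ.naturality f) x.1
        have hx : τ.app A x.1 = 0 := x.2
        refine h.trans ?_
        change G.map f (τ.app A x.1) = 0
        rw [hx, map_zero]⟩
      map_zero' := Subtype.ext (map_zero (F.map f).hom)
      map_add' := fun x y => Subtype.ext (map_add (F.map f).hom x.1 y.1) }
  map_id A := by
    refine AddCommGrpCat.hom_ext (AddMonoidHom.ext fun x => Subtype.ext ?_)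
    exact ConcreteCategory.congr_hom (F.map_id A) x.1
  map_comp f g := by
    refine AddCommGrpCat.hom_ext (AddMonoidHom.ext fun x => Subtype.ext ?_)
    exact ConcreteCategory.congr_hom (F.map_comp f g) x.1

/-- The product of `e` copies of a commutative group scheme. -/
noncomputable def power (e : ℕ) (G : CommAlgCat.{u} k ⥤ AddCommGrpCat.{u}) :
    CommAlgCat.{u} k ⥤ AddCommGrpCat.{u} where
  obj A := AddCommGrpCat.of (Fin e → G.obj A)
  map f := AddCommGrpCat.ofHom
    { toFun := fun x i => G.map f (x i)
      map_zero' := funext fun _ => map_zero (G.map f).hom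
      map_add' := fun x y => funext fun i => map_add (G.map f).hom (x i) (y i) }
  map_id A := by
    refine AddCommGrpCat.hom_ext (AddMonoidHom.ext fun x => funext fun i => ?_)
    exact ConcreteCategory.congr_hom (G.map_id A) (x i)
  map_comp f g := by
    refine AddCommGrpCat.hom_ext (AddMonoidHom.ext fun x => funext fun i => ?_)
    exact ConcreteCategory.congr_hom (G.map_comp f g) (x i)

/-- The `k`-ring scheme `A ↦ W(A)` of `p`-typical Witt vectors. -/
noncomputable def wittFunctor (p : ℕ) [Fact p.Prime] (k : Type u) [Field k] :
    CommAlgCat.{u} k ⥤ CommRingCat.{u} where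
  obj A := CommRingCat.of (WittVector p A)
  map f := CommRingCat.ofHom (WittVector.map (f.hom : _ →+* _))
  map_id A := by
    ext
    rfl
  map_comp f g := by
    ext
    rfl

theorem comp_scalars {R : Type*} [CommRing R] (ρ : R →+* k) {A A' : CommAlgCat.{u} k}
    (f : A ⟶ A') : (f.hom : A →+* A').comp ((algebraMap k A).comp ρ) = (algebraMap k A').comp ρ := by
  rw [← RingHom.comp_assoc, AlgHom.comp_algebraMap]

/-- The `k`-ring scheme `A ↦ W_R(A)` of ramified Witt vectors, where the `k`-algebra `A` is an
`R`-algebra through `ρ : R → k`. -/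
noncomputable def ramWittFunctor {R : Type u} [CommRing R] {p : ℕ} [Fact p.Prime] (D : WittDatum R p)
    (ρ : R →+* k) : CommAlgCat.{u} k ⥤ CommRingCat.{u} where
  obj A := CommRingCat.of (RamWitt D ((algebraMap k A).comp ρ))
  map f := CommRingCat.ofHom (RamWitt.map (f.hom : _ →+* _) (comp_scalars ρ f))
  map_id A := by
    ext x
    rfl
  map_comp f g := by
    ext x
    rfl

/-- A structure of `S`-algebra scheme on a ring functor: its values are `S`-algebras,
functorially. -/
structure Scalars (S : Type u) [CommRing S] (F : CommAlgCat.{u} k ⥤ CommRingCat.{u}) where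
  hom (A : CommAlgCat.{u} k) : S →+* F.obj A
  naturality {A A' : CommAlgCat.{u} k} (f : A ⟶ A') (x : S) :
    (F.map f).hom (hom A x) = hom A' x

variable {S O : Type u} [CommRing S] [CommRing O] {F G : CommAlgCat.{u} k ⥤ CommRingCat.{u}}

/-- For `F` with values in `S`-algebras and `ι : S → O`, the ring functor `A ↦ F(A) ⊗_S O`. -/
noncomputable def tensorFunctor (s : Scalars S F) (ι : S →+* O) :
    CommAlgCat.{u} k ⥤ CommRingCat.{u} where
  obj A := CommRingCat.of (TensorRing (s.hom A) ι)
  map f := CommRingCat.ofHom (TensorRing.map (F.map f).hom (s.naturality f))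
  map_id A := by
    refine CommRingCat.hom_ext (TensorRing.hom_ext fun b c => ?_)
    refine (TensorRing.map_tmul _ (s.naturality (𝟙 A)) _ _).trans ?_
    rw [F.map_id]
    rfl
  map_comp {A A' A''} f g := by
    refine CommRingCat.hom_ext (TensorRing.hom_ext fun b c => ?_)
    refine (TensorRing.map_tmul _ (s.naturality (f ≫ g)) _ _).trans ?_
    change _ = TensorRing.map _ (s.naturality g) (TensorRing.map _ (s.naturality f) _)
    rw [TensorRing.map_tmul, TensorRing.map_tmul, F.map_comp]
    rfl

/-- The morphism `F(A) ⊗_S O → G(A)` extending `τ : F → G` by `O`-linearity, where `G` has values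
in `O`-algebras. -/
noncomputable def tensorLift (s : Scalars S F) (ι : S →+* O) (t : Scalars O G)
    (τ : F ⟶ G) (hτ : ∀ A x, (τ.app A).hom (s.hom A x) = t.hom A (ι x)) :
    tensorFunctor s ι ⟶ G where
  app A := CommRingCat.ofHom (TensorRing.lift (τ.app A).hom (t.hom A) (hτ A))
  naturality A A' f := by
    refine CommRingCat.hom_ext (TensorRing.hom_ext fun b c => ?_)
    change TensorRing.lift _ _ (hτ A') (TensorRing.map _ (s.naturality f) _)
      = (G.map f).hom (TensorRing.lift _ _ (hτ A) _)
    rw [TensorRing.map_tmul, TensorRing.lift_tmul, TensorRing.lift_tmul, map_mul, t.naturality]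
    congr 1
    exact ConcreteCategory.congr_hom (τ.naturality f) b

/-- `W_R` is an `R`-algebra scheme. -/
noncomputable def ramWittScalars {p : ℕ} [Fact p.Prime] {R : Type u} [CommRing R]
    (D : WittDatum R p) (ρ : R →+* k) : Scalars R (ramWittFunctor D ρ) where
  hom A := RamWitt.scalarHom D ((algebraMap k A).comp ρ)
  naturality f x := RamWitt.map_scalarHom _ (comp_scalars ρ f) x

/-- `W` on `k`-algebras has values in `W(k)`-algebras. -/
noncomputable def wittScalars (p : ℕ) [Fact p.Prime] (k : Type u) [Field k] :
    Scalars (WittVector p k) (wittFunctor p k) where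
  hom A := WittVector.map (algebraMap k A)
  naturality f x := WittVector.ext fun n => f.hom.commutes (x.coeff n)

end Functors

/-! ## Greenberg algebra and the comparison morphism -/

section Main

open IsLocalRing

variable {O : Type u} [CommRing O] [IsDomain O] [IsDiscreteValuationRing O] {p h : ℕ}
  [Fact p.Prime] {π : O} (hπ : Irreducible π) (hk : Nat.card (ResidueField O) = p ^ h)

/-- The special fibre of the ring scheme of ramified Witt vectors over `O`. -/
noncomputable abbrev ramWittO : CommAlgCat.{u} (ResidueField O) ⥤ CommRingCat.{u} :=
  ramWittFunctor (dvrDatum hπ hk) (residue O)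

/-- The special fibre of the ring scheme of ramified Witt vectors over `O₀ = W(k)`. -/
noncomputable abbrev ramWittO₀ : CommAlgCat.{u} (ResidueField O) ⥤ CommRingCat.{u} :=
  ramWittFunctor (wittDatum hk) WittVector.constantCoeff

/-- The special fibre of the Drinfeld morphism from `ℤ_p` to `O`. -/
noncomputable def drinfeldO : wittFunctor p (ResidueField O) ⟶ ramWittO hπ hk where
  app A := CommRingCat.ofHom
    (typicalDrinfeld (dvrDatum hπ hk) ((algebraMap (ResidueField O) A).comp (residue O)))
  naturality A A' f := by
    ext x
    exact (map_typicalDrinfeld _ (comp_scalars _ f) x).symm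

/-- The special fibre of the Drinfeld morphism from `ℤ_p` to `O₀ = W(k)`. -/
noncomputable def drinfeldO₀ : wittFunctor p (ResidueField O) ⟶ ramWittO₀ hk where
  app A := CommRingCat.ofHom
    (typicalDrinfeld (wittDatum hk)
      ((algebraMap (ResidueField O) A).comp WittVector.constantCoeff))
  naturality A A' f := by
    ext x
    exact (map_typicalDrinfeld _ (comp_scalars _ f) x).symm

variable [IsAdicComplete (maximalIdeal O) O]

theorem isAdicComplete_dvrDatum : IsAdicComplete (Ideal.span {(dvrDatum hπ hk).ϖ}) O := by
  have : IsAdicComplete (maximalIdeal O) O := inferInstance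
  rwa [hπ.maximalIdeal_eq] at this

/-- The canonical embedding `O₀ = W(k) → O`. -/
noncomputable def embO₀ : WittVector p (ResidueField O) →+* O :=
  have := isAdicComplete_dvrDatum hπ hk
  canonicalMap (D := dvrDatum hπ hk) residue_surjective (dvrDatum_residue hπ hk)

theorem residue_embO₀ (x : WittVector p (ResidueField O)) :
    residue O (embO₀ hπ hk x) = x.coeff 0 :=
  have := isAdicComplete_dvrDatum hπ hk
  residue_canonicalMap (D := dvrDatum hπ hk) residue_surjective (dvrDatum_residue hπ hk) x

/-- The data for the Drinfeld morphism from `O₀` to `O`. -/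
noncomputable def homO₀ : (wittDatum hk).Hom (dvrDatum hπ hk) where
  α := embO₀ hπ hk
  r := 1
  hf := (mul_one _).symm
  hϖ := by
    have : embO₀ hπ hk (wittDatum hk).ϖ = (p : O) := map_natCast _ p
    rw [this]
    exact (dvrDatum hπ hk).dvd_p

theorem comp_homO₀ (A : CommAlgCat.{u} (ResidueField O)) :
    ((algebraMap (ResidueField O) A).comp (residue O)).comp (homO₀ hπ hk).α
      = (algebraMap (ResidueField O) A).comp WittVector.constantCoeff :=
  RingHom.ext fun x => congrArg (algebraMap (ResidueField O) A) (residue_embO₀ hπ hk x)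

/-- The special fibre of the Drinfeld morphism from `O₀ = W(k)` to `O`. -/
noncomputable def drinfeldRam : ramWittO₀ hk ⟶ ramWittO hπ hk where
  app A := CommRingCat.ofHom (RamWitt.drinfeld (homO₀ hπ hk) (comp_homO₀ hπ hk A))
  naturality A A' f := by
    ext x
    exact (RamWitt.mapFun_drinfeldFun (homO₀ hπ hk) (comp_homO₀ hπ hk A) (comp_homO₀ hπ hk A')
      _ (comp_scalars _ f) (comp_scalars _ f) x).symm

/-- The Greenberg algebra of `O`: the `k`-ring scheme `A ↦ W(A) ⊗_{W(k)} O`. -/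
noncomputable def greenberg : CommAlgCat.{u} (ResidueField O) ⥤ CommRingCat.{u} :=
  tensorFunctor (wittScalars p (ResidueField O)) (embO₀ hπ hk)

/-- The morphism `r`: the `O`-linear extension `W(A) ⊗_{W(k)} O → W_O(A)` of the Drinfeld map. -/
noncomputable def r : greenberg hπ hk ⟶ ramWittO hπ hk :=
  tensorLift _ _ (ramWittScalars (dvrDatum hπ hk) (residue O)) (drinfeldO hπ hk) fun A x => by
    have := isAdicComplete_dvrDatum hπ hk
    have h1 := scalarHom_canonicalMap (D := dvrDatum hπ hk) residue_surjective
      (dvrDatum_residue hπ hk) x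
    have h2 := congrArg (RamWitt.map (φ' := (algebraMap (ResidueField O) A).comp (residue O))
      (algebraMap (ResidueField O) A) rfl) h1
    rw [RamWitt.map_scalarHom, map_typicalDrinfeld] at h2
    exact h2.symm

/-- The morphism `W(A) → W(A) ⊗_{W(k)} O`, `x ↦ x ⊗ 1`. -/
noncomputable def toGreenberg : wittFunctor p (ResidueField O) ⟶ greenberg hπ hk where
  app A := CommRingCat.ofHom (TensorRing.inl ((wittScalars p (ResidueField O)).hom A) (embO₀ hπ hk))
  naturality A A' f := by
    ext x
    exact (TensorRing.map_tmul _ ((wittScalars p (ResidueField O)).naturality f) _ _).symm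

/-- The `k`-ring scheme `A ↦ W_{O₀}(A) ⊗_{O₀} O`. -/
noncomputable def ramTensor : CommAlgCat.{u} (ResidueField O) ⥤ CommRingCat.{u} :=
  tensorFunctor (ramWittScalars (wittDatum hk) WittVector.constantCoeff) (embO₀ hπ hk)

/-- The morphism `u^ra` on special fibres, for the totally ramified extension `O` of `O₀`: the
`O`-linear extension `W_{O₀}(A) ⊗_{O₀} O → W_O(A)` of the Drinfeld map. -/
noncomputable def uRam : ramTensor hπ hk ⟶ ramWittO hπ hk :=
  tensorLift _ _ (ramWittScalars (dvrDatum hπ hk) (residue O)) (drinfeldRam hπ hk) fun A x =>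
    RamWitt.drinfeld_scalarHom (homO₀ hπ hk) (comp_homO₀ hπ hk A) x

/-- `k[X_0, X_1, …] / (X_0, …, X_i^{p^{i(h-1)}}, …)`. -/
abbrev UnramRing (k : Type u) [Field k] (p h : ℕ) : Type u :=
  MvPolynomial ℕ k ⧸ Ideal.span (Set.range fun i : ℕ =>
    (MvPolynomial.X i : MvPolynomial ℕ k) ^ p ^ (i * (h - 1)))

/-- `k[X_{n,i}; n ≥ 0, 0 ≤ i < e] / (X_{n,i}^{q^{n(e-1)+i}})`. -/
abbrev RamRing (k : Type u) [Field k] (q e : ℕ) : Type u :=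
  MvPolynomial (ℕ × Fin e) k ⧸ Ideal.span (Set.range fun j : ℕ × Fin e =>
    (MvPolynomial.X j : MvPolynomial (ℕ × Fin e) k) ^ q ^ (j.1 * (e - 1) + (j.2 : ℕ)))

end Main

end RamifiedWitt

namespace RamifiedWitt

/-! ## Congruences between Witt vectors -/

/-! Everything is computed in Witt components. Over a ring where `ϖ = 0`, a component of a ramified
Witt vector can be found by lifting to a polynomial ring over the base, where `ϖ` is regular, and
there it suffices to know the ghost component `Φ_n` modulo `ϖ^(n+1)` for each `n`
(`coeff_eq_of_lift`).

For `u = u_(ℤ_p, O₀)` the component `Φ_{hn}` modulo `p^(n+1)` keeps only the terms `i ≤ n`, which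
gives `u(x)_n = x_n^(p^(n(h-1)))` (`coeff_typicalDrinfeld`).

For `u^ra`, write `p = ε π^e` with a unit `ε`. Since `1, π, …, π^(e-1)` is a basis of `O` over
`W(k)` (`sum_embO₀_bijective`), an element of `W_{O₀}(A) ⊗ O` is a family of components `x_{n,i}`
with `0 ≤ i < e`. With `j = en + i`, the ghost components of its image are, modulo `π^(n'+1)` at
index `n'`, those of `∑ ε^n V^j [x_{n,i}^(q^(j-n))]`. As the `ε^n` are units, the leading nonzero
term cannot cancel, so the image vanishes exactly when every `x_{n,i}^(q^(n(e-1)+i))` does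
(`sum_drinfeld_eq_zero_iff`).

Drinfeld maps compose, hence `r = u^ra ∘ (u ⊗ O)` (`toRamTensor_comp_uRam`), and the exponents
defining `ker r` are the products of the two. The kernel of `u ⊗ O` is the product of `e` copies of
`ker u`. The map `ker r → ker u^ra` is surjective after extracting roots of all components, which a
faithfully flat extension provides (`exists_faithfullyFlat_roots`). All the kernels are thus given
by equations `X_j^(m_j) = 0`, recorded by `NilCoords`; truncating Witt vectors at length `N`
presents `ker u` and `ker u^ra` as limits of finite local groups (`NilCoords.isProInfinitesimal`).
Cases (a) and (b) are `e = 1` and `h = 1`. -/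

theorem pow_mul_regular {B : Type*} [CommRing B] {a : B} (ha : ∀ x, a * x = 0 → x = 0) (n : ℕ)
    {x y : B} (h : a ^ n * x = a ^ n * y) : x = y := by
  induction n with
  | zero => simpa using h
  | succ n ih =>
    refine ih (sub_eq_zero.1 (ha _ ?_))
    rw [mul_sub, ← mul_assoc, ← mul_assoc, ← pow_succ', h, sub_self]

/-- By induction, congruent components of index `i < n` have `q^(n-i)`-th powers congruent modulo
`a^(n-i+1)`, so their terms in `Φ_n` agree modulo `a^(n+1)`. What is left is `a^n (x_n - y_n)`, from
which `a^n` cancels by regularity. -/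
theorem dvd_coeff_sub_of_lt {B : Type*} [CommRing B] {q : ℕ} {a : B}
    (ha : ∀ x, a * x = 0 → x = 0) (haq : a ∣ (q : B)) {x y : ℕ → B} {N : ℕ}
    (h : ∀ n < N, a ^ (n + 1) ∣ wittPoly q a n x - wittPoly q a n y) :
    ∀ n < N, a ∣ x n - y n := by
  intro n
  induction n using Nat.strong_induction_on with
  | _ n ih =>
    intro hnN
    have hn := h n hnN
    rw [wittPoly, wittPoly, Finset.sum_range_succ, Finset.sum_range_succ, add_sub_add_comm,
      ← Finset.sum_sub_distrib, Nat.sub_self, pow_zero, pow_one, pow_one, ← mul_sub] at hn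
    have hn' := (dvd_add_right (Finset.dvd_sum fun i hi => ?_)).1 hn
    · obtain ⟨c, hc⟩ := hn'
      exact ⟨c, pow_mul_regular ha n (by rw [hc, pow_succ, mul_assoc])⟩
    · have hi' := Finset.mem_range.1 hi
      rw [← mul_sub, show n + 1 = i + (n - i + 1) by omega, pow_add]
      exact mul_dvd_mul_left _ (dvd_pow_sub_pow haq (ih i hi' (hi'.trans hnN)) _)

namespace RamWitt

variable {R : Type*} [CommRing R] {p : ℕ} {D : WittDatum R p}
  {B : Type*} [CommRing B] {φ : R →+* B}

/-- Witt vectors over a ring in which `ϖ = 0` are determined by the ghost components of lifts,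
modulo powers of `ϖ`. -/
theorem coeff_eq_of_lift (hϖ : φ D.ϖ = 0)
    {x y : RamWitt D (MvPolynomial.C : R →+* MvPolynomial B R)} {N : ℕ}
    (h : ∀ n < N, MvPolynomial.C D.ϖ ^ (n + 1) ∣ ghost n x - ghost n y) :
    ∀ n < N, (mapFun (cover φ) (cover_comp φ) x).coeff n
      = (mapFun (cover φ) (cover_comp φ) y).coeff n := by
  intro n hn
  have h1 := map_dvd (cover φ) (dvd_coeff_sub_of_lt D.C_regular D.C_dvd_q h n hn)
  have h2 : cover φ (MvPolynomial.C D.ϖ) = 0 := by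
    rw [← hϖ, ← RingHom.comp_apply, cover_comp]
  rw [h2, zero_dvd_iff, map_sub, sub_eq_zero] at h1
  exact h1

theorem eq_of_lift (hϖ : φ D.ϖ = 0)
    {x y : RamWitt D (MvPolynomial.C : R →+* MvPolynomial B R)}
    (h : ∀ n, MvPolynomial.C D.ϖ ^ (n + 1) ∣ ghost n x - ghost n y) :
    mapFun (cover φ) (cover_comp φ) x = mapFun (cover φ) (cover_comp φ) y :=
  RamWitt.ext (funext fun n => coeff_eq_of_lift hϖ (N := n + 1) (fun n _ => h n) n n.lt_succ_self)

/-- The Witt vector whose only nonzero component is `b`, at the index `j`. -/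
def single (j : ℕ) (b : B) : RamWitt D φ := ⟨Pi.single j b⟩

theorem ghost_single [Fact p.Prime] (j : ℕ) (b : B) (n : ℕ) :
    ghost n (single j b : RamWitt D φ)
      = if j ≤ n then φ D.ϖ ^ j * b ^ D.q ^ (n - j) else 0 := by
  have hq : ∀ m, D.q ^ m ≠ 0 := fun m =>
    pow_ne_zero _ (pow_ne_zero _ (Fact.out : p.Prime).ne_zero)
  rw [ghost, wittPoly]
  split_ifs with h
  · rw [Finset.sum_eq_single j]
    · simp [single]
    · intro i _ hij
      simp only [single, Pi.single_eq_of_ne hij, zero_pow (hq _), mul_zero]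
    · intro hj
      exact absurd (Finset.mem_range.2 (Nat.lt_succ_of_le h)) hj
  · refine Finset.sum_eq_zero fun i hi => ?_
    have : i ≠ j := by
      have := Finset.mem_range.1 hi
      omega
    simp only [single, Pi.single_eq_of_ne this, zero_pow (hq _), mul_zero]

theorem mapFun_single {B' : Type*} [CommRing B'] {φ' : R →+* B'} (ψ : B →+* B')
    (h : ψ.comp φ = φ') (j : ℕ) (b : B) :
    mapFun ψ h (single j b : RamWitt D φ) = single j (ψ b) := by
  ext n
  by_cases hn : n = j
  · subst hn
    simp [mapFun, single]
  · simp [mapFun, single, hn]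

theorem single_zero (j : ℕ) : (single j 0 : RamWitt D φ) = 0 := by
  ext n
  change (Pi.single j 0 : ℕ → B) n = 0
  simp

variable [Fact p.Prime]

/-- The vector `V^j [y]` contributes nothing to `Φ_m` for `m < j`, so the finite sum over `j < N`
has the prescribed ghost components at every index below `N`. Fixing `N` replaces the infinite sum
`∑ ε_j V^j [y_j]` by finite ones. -/
theorem coeff_sum_scalar_mul_single (hϖ : φ D.ϖ = 0)
    {w : RamWitt D (MvPolynomial.C : R →+* MvPolynomial B R)} {y : ℕ → MvPolynomial B R}
    {ε : ℕ → R}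
    (hg : ∀ n, MvPolynomial.C D.ϖ ^ (n + 1) ∣ ghost n w - ∑ j ∈ Finset.range (n + 1),
      MvPolynomial.C (ε j) * (MvPolynomial.C D.ϖ ^ j * y j ^ D.q ^ (n - j))) (N : ℕ) :
    ∀ n < N, (mapFun (cover φ) (cover_comp φ) w).coeff n
      = (∑ j ∈ Finset.range N, scalarHom D φ (ε j) * single j (cover φ (y j))).coeff n := by
  intro n hn
  have h := coeff_eq_of_lift hϖ (x := w) (N := N)
    (y := ∑ j ∈ Finset.range N, scalarHom D MvPolynomial.C (ε j) * single j (y j))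
    (fun m hm => by
      have h1 : ghost m (∑ j ∈ Finset.range N, scalarHom D MvPolynomial.C (ε j) * single j (y j))
          = ∑ j ∈ Finset.range (m + 1),
            MvPolynomial.C (ε j) * (MvPolynomial.C D.ϖ ^ j * y j ^ D.q ^ (m - j)) := by
        refine (map_sum (ghostHom (D := D) (MvPolynomial.C : R →+* MvPolynomial B R) m) _ _).trans ?_
        have h2 : ∀ j, ghostHom (D := D) (MvPolynomial.C : R →+* MvPolynomial B R) m
            (scalarHom D MvPolynomial.C (ε j) * single j (y j))
            = if j ≤ m then
              MvPolynomial.C (ε j) * (MvPolynomial.C D.ϖ ^ j * y j ^ D.q ^ (m - j)) else 0 := by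
          intro j
          refine (ghost_mul _ _ m).trans ?_
          rw [scalarHom_apply, ghost_scalar, ghost_single, mul_ite, mul_zero]
        simp only [h2]
        rw [← Finset.sum_filter]
        refine Finset.sum_congr (Finset.ext fun j => ?_) fun _ _ => rfl
        simp only [Finset.mem_filter, Finset.mem_range]
        omega
      rw [h1]
      exact hg m) n hn
  rw [h]
  have h3 : map (cover φ) (cover_comp φ)
      (∑ j ∈ Finset.range N, scalarHom D MvPolynomial.C (ε j) * single j (y j))
      = ∑ j ∈ Finset.range N, scalarHom D φ (ε j) * single j (cover φ (y j)) := by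
    rw [map_sum]
    refine Finset.sum_congr rfl fun j _ => ?_
    rw [map_mul, map_scalarHom]
    exact congrArg _ (mapFun_single _ (cover_comp φ) _ _)
  exact congrArg (fun z => z.coeff n) h3

/-- On lifts, `r · V^N [b]` and `V^N [r b]` have the same ghost components up to index `N`: zero
below `N`, and `ϖ^N r b` at `N`. Beyond `N` they differ in general. -/
theorem coeff_scalar_mul_single (hϖ : φ D.ϖ = 0) (r : R) (N : ℕ) (b : B) {n : ℕ} (hn : n ≤ N) :
    (scalarHom D φ r * single N b).coeff n = if n = N then φ r * b else 0 := by
  obtain ⟨b, rfl⟩ := cover_surjective φ b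
  have h := coeff_eq_of_lift hϖ (x := scalarHom D MvPolynomial.C r * single N b) (N := N + 1)
    (y := single N (MvPolynomial.C r * b)) (fun m hm => by
      rw [ghost_mul, scalarHom_apply, ghost_scalar, ghost_single, ghost_single]
      split_ifs with h
      · obtain rfl : N = m := by omega
        rw [Nat.sub_self, pow_zero, pow_one, pow_one, mul_left_comm, sub_self]
        exact dvd_zero _
      · simp) n (Nat.lt_succ_of_le hn)
  have h3 : map (cover φ) (cover_comp φ) (scalarHom D MvPolynomial.C r * single N b)
      = scalarHom D φ r * single N (cover φ b) := by
    rw [map_mul, map_scalarHom]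
    exact congrArg _ (mapFun_single _ (cover_comp φ) _ _)
  rw [← h3]
  refine h.trans ?_
  rw [mapFun_single, map_mul, ← RingHom.comp_apply (cover φ), cover_comp]
  by_cases hN : n = N
  · subst hN
    simp [single]
  · simp [single, hN]

/-- A vector which is congruent to `∑ ε_j V^j [y_j]` with units `ε_j` vanishes if and only if all
`y_j` do. -/
theorem eq_zero_iff_of_lift (hϖ : φ D.ϖ = 0)
    {w : RamWitt D (MvPolynomial.C : R →+* MvPolynomial B R)} {y : ℕ → MvPolynomial B R}
    {ε : ℕ → R} (hε : ∀ j, IsUnit (ε j))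
    (hg : ∀ n, MvPolynomial.C D.ϖ ^ (n + 1) ∣ ghost n w - ∑ j ∈ Finset.range (n + 1),
      MvPolynomial.C (ε j) * (MvPolynomial.C D.ϖ ^ j * y j ^ D.q ^ (n - j))) :
    mapFun (cover φ) (cover_comp φ) w = 0 ↔ ∀ j, cover φ (y j) = 0 := by
  -- Leading-term argument: once the terms before `N` vanish, the component of index `N` comes from
  -- the term `j = N` alone.
  have key : ∀ N, (∀ j < N, cover φ (y j) = 0) →
      (mapFun (cover φ) (cover_comp φ) w).coeff N = φ (ε N) * cover φ (y N) := by
    intro N hN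
    rw [coeff_sum_scalar_mul_single hϖ hg (N + 1) N N.lt_succ_self, Finset.sum_range_succ,
      Finset.sum_eq_zero, zero_add, coeff_scalar_mul_single hϖ _ _ _ le_rfl, if_pos rfl]
    intro j hj
    rw [hN j (Finset.mem_range.1 hj), single_zero, mul_zero]
  constructor
  · intro hw j
    induction j using Nat.strong_induction_on with
    | _ N ih =>
      have h := key N ih
      rw [hw] at h
      exact ((hε N).map φ).mul_right_eq_zero.1 h.symm
  · intro hy
    refine RamWitt.ext (funext fun N => ?_)
    rw [key N fun j _ => hy j, hy N, mul_zero]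
    rfl

/-- Lift `z` with its first `N` components exactly zero; the lift then has zero ghost components
below `N`, so adding it does not change those of `y`. -/
theorem coeff_add_of_coeff_eq_zero (hϖ : φ D.ϖ = 0) {z y : RamWitt D φ} {N : ℕ}
    (hz : ∀ n < N, z.coeff n = 0) : ∀ n < N, (z + y).coeff n = y.coeff n := by
  obtain ⟨y, rfl⟩ := exists_lift y
  have hz' : mapFun (cover φ) (cover_comp φ)
      (⟨fun n => if n < N then 0 else MvPolynomial.X (z.coeff n)⟩ : RamWitt D MvPolynomial.C)
      = z := by
    refine RamWitt.ext (funext fun n => ?_)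
    by_cases hn : n < N
    · simp [mapFun, hn, hz]
    · simp [mapFun, hn, cover]
  rw [← hz', ← mapFun_add]
  refine coeff_eq_of_lift hϖ fun n hn => ?_
  rw [ghost_add, add_sub_cancel_right, ghost, wittPoly]
  have hq : ∀ m, D.q ^ m ≠ 0 := fun m =>
    pow_ne_zero _ (pow_ne_zero _ (Fact.out : p.Prime).ne_zero)
  rw [Finset.sum_eq_zero]
  · exact dvd_zero _
  · intro i hi
    have := Finset.mem_range.1 hi
    dsimp only
    rw [if_pos (by omega), zero_pow (hq _), mul_zero]

/-- The vectors beginning with `N` zeros form a subgroup whose cosets are read off from the first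
`N` components. This is what makes truncation compatible with addition, and it underlies the
pro-infinitesimal structure. -/
theorem coeff_sub_eq_zero_iff (hϖ : φ D.ϖ = 0) (x y : RamWitt D φ) (N : ℕ) :
    (∀ n < N, (x - y).coeff n = 0) ↔ ∀ n < N, x.coeff n = y.coeff n := by
  have h1 : ∀ {x y : RamWitt D φ}, (∀ n < N, (x - y).coeff n = 0) →
      ∀ n < N, x.coeff n = y.coeff n := fun {x y} h n hn => by
    rw [← coeff_add_of_coeff_eq_zero (y := y) hϖ h n hn, sub_add_cancel]
  refine ⟨h1, fun h => ?_⟩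
  -- With the lift `b ↦ X_b` of each component, equal components have equal lifts, so the ghost
  -- components below `N` coincide and not merely modulo powers of `ϖ`.
  have hadd : ∀ {z x y : RamWitt D φ}, (∀ n < N, x.coeff n = y.coeff n) →
      ∀ n < N, (x + z).coeff n = (y + z).coeff n := fun {z x y} h n hn => by
    obtain ⟨z, rfl⟩ := exists_lift z
    have hl : ∀ x : RamWitt D φ, mapFun (cover φ) (cover_comp φ)
        (⟨fun n => MvPolynomial.X (x.coeff n)⟩ : RamWitt D MvPolynomial.C) = x := fun x =>
      RamWitt.ext (funext fun n => by simp [mapFun, cover])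
    rw [← hl x, ← hl y, ← mapFun_add, ← mapFun_add]
    refine coeff_eq_of_lift hϖ (fun m hm => ?_) n hn
    rw [ghost_add, ghost_add, add_sub_add_right_eq_sub]
    have : ∀ i < m + 1, x.coeff i = y.coeff i := fun i hi => h i (by omega)
    refine (dvd_zero _).trans (dvd_of_eq (sub_eq_zero.2 ?_).symm)
    rw [ghost, ghost, wittPoly, wittPoly]
    refine Finset.sum_congr rfl fun i hi => ?_
    dsimp only
    rw [this i (Finset.mem_range.1 hi)]
  intro n hn
  rw [sub_eq_add_neg, hadd h n hn, add_neg_cancel]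
  rfl

end RamWitt

theorem wittVector_coeff_sub_eq_zero_iff {p : ℕ} [Fact p.Prime] {B : Type*} [CommRing B]
    (hp : (p : B) = 0) (x y : WittVector p B) (N : ℕ) :
    (∀ n < N, (x - y).coeff n = 0) ↔ ∀ n < N, x.coeff n = y.coeff n := by
  have h := RamWitt.coeff_sub_eq_zero_iff (D := intDatum p) (φ := Int.castRingHom B)
    (by simp [intDatum, hp]) (ofWitt _ x) (ofWitt _ y) N
  rw [← map_sub] at h
  exact h

/-! ## Formulas for Drinfeld maps -/

section Formulas

variable {R : Type*} [CommRing R] {p : ℕ} [Fact p.Prime] {D : WittDatum R p}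
  {B : Type*} [CommRing B] {φ : R →+* B}

theorem ghostComponent_eq_sum (x : WittVector p B) (n : ℕ) :
    WittVector.ghostComponent n x
      = ∑ i ∈ Finset.range (n + 1), (p : B) ^ i * x.coeff i ^ p ^ (n - i) := by
  rw [WittVector.ghostComponent_apply, aeval_wittPolynomial]

theorem map_cover_mk (x : WittVector p B) :
    WittVector.map (RamWitt.cover φ) (WittVector.mk p fun n => MvPolynomial.X (x.coeff n)) = x := by
  ext n
  simp [RamWitt.cover, WittVector.map_coeff]

/-- If `ϖ = p`, the special fibre of the Drinfeld map raises the component of index `n` to the power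
`p ^ (n (f - 1))`. -/
theorem coeff_typicalDrinfeld (hp : D.ϖ = p) (hϖ : φ D.ϖ = 0) (x : WittVector p B) (n : ℕ) :
    (typicalDrinfeld D φ x).coeff n = x.coeff n ^ p ^ (n * (D.f - 1)) := by
  have h1 := map_typicalDrinfeld (D := D) (RamWitt.cover φ) (RamWitt.cover_comp φ)
    (WittVector.mk p fun n => MvPolynomial.X (x.coeff n))
  rw [map_cover_mk] at h1
  have h2 := RamWitt.eq_of_lift (φ := φ) hϖ
    (x := typicalDrinfeld D MvPolynomial.C (WittVector.mk p fun n => MvPolynomial.X (x.coeff n)))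
    (y := ⟨fun n => MvPolynomial.X (x.coeff n) ^ p ^ (n * (D.f - 1))⟩) (fun n => by
      have hC : (MvPolynomial.C D.ϖ : MvPolynomial B R) = p := by rw [hp, map_natCast]
      have hf := D.f_pos
      -- The ghost component of index `fn` is split after `i = n`. The later terms are divisible by
      -- `p^(n+1)`; for `i ≤ n` the identity `fn - i = i(f-1) + f(n-i)` turns the `i`-th term into
      -- that of `Φ_n` at the vector `(x_i^(p^(i(f-1))))`.
      obtain ⟨d, hd⟩ : ∃ d, D.f * n + 1 = n + 1 + d :=
        ⟨D.f * n - n, by have := Nat.le_mul_of_pos_left n hf; omega⟩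
      rw [ghost_typicalDrinfeld, ghostComponent_eq_sum, RamWitt.ghost, wittPoly, hd,
        Finset.sum_range_add, hC, add_sub_right_comm]
      refine dvd_add ?_ (Finset.dvd_sum fun i _ => Dvd.dvd.mul_right (pow_dvd_pow _ (by omega)) _)
      refine (dvd_zero _).trans (dvd_of_eq (sub_eq_zero.2 ?_).symm)
      refine Finset.sum_congr rfl fun i hi => ?_
      have hi' := Finset.mem_range.1 hi
      dsimp only
      rw [WittVector.coeff_mk, WittDatum.q, ← pow_mul, ← pow_mul, ← pow_add]
      congr 3
      obtain ⟨f, hf'⟩ : ∃ f, D.f = f + 1 := ⟨D.f - 1, by omega⟩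
      obtain ⟨m, rfl⟩ : ∃ m, n = i + m := ⟨n - i, by omega⟩
      rw [hf', Nat.add_sub_cancel, Nat.add_sub_cancel_left, Nat.sub_eq_iff_eq_add (by nlinarith)]
      ring)
  have h3 := congrArg (fun z => z.coeff n) (h1.symm.trans h2)
  refine h3.trans ?_
  simp [RamWitt.mapFun, RamWitt.cover]

/-- Drinfeld maps are compatible with composition. -/
theorem drinfeld_typicalDrinfeld {R' : Type*} [CommRing R'] {D' : WittDatum R' p} (T : D.Hom D')
    {φ' : R' →+* B} (hφ : φ'.comp T.α = φ) (x : WittVector p B) :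
    RamWitt.drinfeld T hφ (typicalDrinfeld D φ x) = typicalDrinfeld D' φ' x := by
  have hc : (RamWitt.cover φ').comp (MvPolynomial.C.comp T.α) = φ := by
    rw [← RingHom.comp_assoc, RamWitt.cover_comp, hφ]
  rw [← map_cover_mk (φ := φ') x,
    ← map_typicalDrinfeld (φ := MvPolynomial.C.comp T.α) (RamWitt.cover φ') hc,
    ← map_typicalDrinfeld (φ := MvPolynomial.C) (RamWitt.cover φ') (RamWitt.cover_comp φ')]
  refine (RamWitt.mapFun_drinfeldFun T rfl hφ (RamWitt.cover φ') hc
    (RamWitt.cover_comp φ') _).symm.trans ?_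
  refine congrArg _ (RamWitt.ext_ghost D'.C_regular fun n => ?_)
  rw [RamWitt.ghost_drinfeldFun, ghost_typicalDrinfeld, ghost_typicalDrinfeld, T.hf, mul_assoc]

/-- The Drinfeld map `W(k) → W_{W(k)}(k)` is the structure map of the `W(k)`-algebra
`W_{W(k)}(k)`. -/
theorem typicalDrinfeld_eq_scalarHom {k : Type*} [Field k] {h : ℕ} (hk : Nat.card k = p ^ h)
    (s : WittVector p k) :
    typicalDrinfeld (wittDatum hk) WittVector.constantCoeff s
      = RamWitt.scalarHom (wittDatum hk) WittVector.constantCoeff s := by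
  have hfin : Finite k := Nat.finite_of_card_ne_zero
    (by rw [hk]; exact pow_ne_zero _ (Fact.out : p.Prime).ne_zero)
  have : Fintype k := Fintype.ofFinite _
  have : CharP k p := charP_of_card hk
  have hh : (wittDatum hk).f = h := rfl
  have hpos : 0 < h := (wittDatum hk).f_pos
  have hϖ : (wittDatum hk).ϖ = p := rfl
  have hϖ0 : WittVector.constantCoeff (wittDatum hk).ϖ = (0 : k) := by
    rw [hϖ, map_natCast, CharP.cast_eq_zero]
  have h2 := RamWitt.eq_of_lift (D := wittDatum hk) (φ := WittVector.constantCoeff) hϖ0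
    -- The Teichmüller representatives lift the known components of `u(s)`. Their ghost components
    -- are to be compared with those of the scalar `s`, which are constantly `s`.
    (x := ⟨fun n => MvPolynomial.C (WittVector.teichmuller p (s.coeff n ^ p ^ (n * (h - 1))))⟩)
    (y := RamWitt.scalar MvPolynomial.C s) (fun n => by
      rw [RamWitt.ghost_scalar, hϖ, RamWitt.ghost, wittPoly, ← neg_sub, hϖ]
      refine Dvd.dvd.neg_right ?_
      -- The Teichmüller expansion `s ≡ ∑_{i ≤ n} p^i [F^(-i) s_i]` modulo `p^(n+1)` has exactly the
      -- shape of `Φ_n`. It remains to identify `F^(-i)` with a power map, which is possible because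
      -- `F^(hn)` is the identity on `k`.
      have h1 := WittVector.dvd_sub_sum_teichmuller_iterateFrobeniusEquiv_coeff s n
      have h3 := map_dvd (MvPolynomial.C : WittVector p k →+* MvPolynomial k (WittVector p k)) h1
      rw [map_pow, map_sub, map_sum] at h3
      convert h3 using 2
      refine Finset.sum_congr (Finset.ext fun i => by simp) fun i hi => ?_
      have hi' := Finset.mem_Iic.1 hi
      dsimp only
      suffices hA : (s.coeff i ^ p ^ (i * (h - 1))) ^ (wittDatum hk).q ^ (n - i)
          = ((frobeniusEquiv k p).symm ^ i) (s.coeff i) by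
        rw [← hA, mul_comm, map_mul]
        simp only [map_pow]
      have hinj : Function.Injective ((frobeniusEquiv k p) ^ i) := RingEquiv.injective _
      refine hinj ?_
      have hF : ∀ a : k, ((frobeniusEquiv k p) ^ i) a = a ^ p ^ i := fun a => by
        rw [← iterateFrobeniusEquiv_eq_pow, iterateFrobeniusEquiv_def]
      have hF' : ((frobeniusEquiv k p) ^ i)
          (((frobeniusEquiv k p).symm ^ i) (s.coeff i)) = s.coeff i := by
        have : (frobeniusEquiv k p).symm ^ i = ((frobeniusEquiv k p) ^ i)⁻¹ := inv_pow _ i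
        rw [this]
        exact RingEquiv.apply_symm_apply ((frobeniusEquiv k p) ^ i) _
      rw [hF', hF, WittDatum.q, hh, ← pow_mul, ← pow_mul, ← pow_mul, ← pow_add, ← pow_add]
      have : i * (h - 1) + (h * (n - i) + i) = h * n := by
        obtain ⟨f, rfl⟩ : ∃ f, h = f + 1 := ⟨h - 1, by omega⟩
        obtain ⟨m, rfl⟩ : ∃ m, n = i + m := ⟨n - i, by omega⟩
        rw [Nat.add_sub_cancel, Nat.add_sub_cancel_left]
        ring
      rw [this, pow_mul, ← hk, Nat.card_eq_fintype_card, FiniteField.pow_card_pow])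
  rw [RamWitt.mapFun_scalar] at h2
  rw [RamWitt.scalarHom_apply, ← h2]
  refine RamWitt.ext (funext fun n => ?_)
  rw [coeff_typicalDrinfeld hϖ hϖ0, hh]
  change _ = RamWitt.cover _ (MvPolynomial.C _)
  rw [← RingHom.comp_apply (RamWitt.cover _), RamWitt.cover_comp]
  exact (WittVector.teichmuller_coeff_zero p _).symm

end Formulas

/-! ## Coordinates on tensor products -/

namespace TensorRing

variable {S B C B' : Type*} [CommRing S] [CommRing B] [CommRing C] [CommRing B']
  {f : S →+* B} {g : S →+* C}

theorem tmul_eq_mul (b : B) (c : C) : tmul f g b c = inl f g b * inr f g c := by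
  let := f.toAlgebra
  let := g.toAlgebra
  refine Eq.trans ?_ (Algebra.TensorProduct.tmul_mul_tmul (R := S) b (1 : B) (1 : C) c).symm
  rw [mul_one, one_mul]
  rfl

/-- If `b` is a basis of `C` over `S`, then `1 ⊗ b` is a basis of `B ⊗_S C` over `B`. -/
theorem sum_tmul_bijective {ι : Type*} [Fintype ι] (b : ι → C)
    (hb : Function.Bijective fun a : ι → S => ∑ i, g (a i) * b i) :
    Function.Bijective fun x : ι → B => ∑ i, tmul f g (x i) (b i) := by
  let := f.toAlgebra
  let := g.toAlgebra
  let e : (ι → S) ≃ₗ[S] C := LinearEquiv.ofBijective (Fintype.linearCombination S b) hb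
  let bas : Module.Basis ι S C := Module.Basis.ofEquivFun e.symm
  have hbas : ∀ i, bas i = b i := fun i => by
    classical
    rw [Module.Basis.coe_ofEquivFun]
    refine (Fintype.linearCombination_apply S b _).trans ?_
    simp [Pi.single_apply]
  have h : Function.Bijective
      fun x : ι → B => ∑ i, (TensorProduct.tmul S (x i) (b i) : TensorProduct S B C) := by
    convert (Algebra.TensorProduct.basis B bas).equivFun.symm.bijective using 1
    funext x
    rw [Module.Basis.equivFun_symm_apply]
    refine Finset.sum_congr rfl fun i _ => ?_
    rw [Algebra.TensorProduct.basis_apply, hbas, TensorProduct.smul_tmul', smul_eq_mul, mul_one]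
  exact h

end TensorRing

/-! ## The structure of `O` over `W(k)` -/

section Structure

open IsLocalRing

theorem exists_unit_mul_pow {O : Type*} [CommRing O] [IsDomain O] [IsDiscreteValuationRing O]
    {π : O} (hπ : Irreducible π) {x : O} {e : ℕ} (hx : IsDiscreteValuationRing.addVal O x = e) :
    ∃ ε : Oˣ, x = ε * π ^ e := by
  rw [← hπ.addVal_pow, IsDiscreteValuationRing.addVal_eq_iff_associated] at hx
  obtain ⟨ε, hε⟩ := hx.symm
  exact ⟨ε, by rw [← hε, mul_comm]⟩

variable {O : Type u} [CommRing O] [IsDomain O] [IsDiscreteValuationRing O] {p h : ℕ}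
  [Fact p.Prime] {π : O} (hπ : Irreducible π) (hk : Nat.card (ResidueField O) = p ^ h)
  [IsAdicComplete (maximalIdeal O) O]

/-- The embedding induces the identity on residue fields, and each divisibility says that the
residue `x_0` is zero; for `p` this uses that the finite field `k` is perfect. -/
theorem dvd_embO₀_iff (x : WittVector p (ResidueField O)) :
    π ∣ embO₀ hπ hk x ↔ (p : WittVector p (ResidueField O)) ∣ x := by
  have : CharP (ResidueField O) p := charP_of_card hk
  have hfin : Finite (ResidueField O) := Nat.finite_of_card_ne_zero
    (by rw [hk]; exact pow_ne_zero _ (Fact.out : p.Prime).ne_zero)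
  have h1 := dvrDatum_residue hπ hk (embO₀ hπ hk x)
  rw [residue_embO₀] at h1
  refine h1.symm.trans ?_
  rw [← WittVector.mem_span_p_iff_coeff_zero_eq_zero, Ideal.mem_span_singleton]

/-- Induction on `i`, working modulo `π^(i+1)`: terms with `j < i` vanish because `p ∣ a_j` brings a
factor `π^e`, terms with `j > i` vanish because of `π^j`. Hence `π^(i+1) ∣ a_i π^i`, so `π`, and
therefore `p`, divides `a_i`. -/
theorem p_dvd_of_pow_dvd_sum {e : ℕ} (he : IsDiscreteValuationRing.addVal O (p : O) = e)
    (a : Fin e → WittVector p (ResidueField O))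
    (ha : π ^ e ∣ ∑ i, embO₀ hπ hk (a i) * π ^ (i : ℕ)) (i : Fin e) :
    (p : WittVector p (ResidueField O)) ∣ a i := by
  obtain ⟨ε, hε⟩ := exists_unit_mul_pow hπ he
  induction i using WellFoundedLT.induction with
  | _ i ih =>
    rw [← dvd_embO₀_iff hπ hk]
    have h1 : π ^ ((i : ℕ) + 1) ∣ ∑ j, embO₀ hπ hk (a j) * π ^ (j : ℕ) :=
      (pow_dvd_pow _ i.2).trans ha
    rw [← Finset.add_sum_erase _ _ (Finset.mem_univ i)] at h1
    have h2 := (dvd_add_left (Finset.dvd_sum fun j hj => ?_)).1 h1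
    · rw [pow_succ', mul_dvd_mul_iff_right (pow_ne_zero _ hπ.ne_zero)] at h2
      exact h2
    · rcases lt_or_gt_of_ne (Finset.ne_of_mem_erase hj) with hji | hij
      · obtain ⟨c, hc⟩ := ih j hji
        rw [hc, map_mul, map_natCast, hε]
        exact (((pow_dvd_pow _ i.2).mul_left _).mul_right _).mul_right _
      · exact (pow_dvd_pow _ (Nat.succ_le_of_lt hij)).mul_left _

/-- The coefficients of a linear relation are divisible by `p`, and dividing the relation by `p`
(nonzero in `O`) gives another one. So they are divisible by all powers of `p`, and `W(k)` is
`p`-adically separated. -/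
theorem sum_embO₀_injective [CharZero O] {e : ℕ}
    (he : IsDiscreteValuationRing.addVal O (p : O) = e) :
    Function.Injective fun a : Fin e → WittVector p (ResidueField O) =>
      ∑ i, embO₀ hπ hk (a i) * π ^ (i : ℕ) := by
  have : CharP (ResidueField O) p := charP_of_card hk
  have hfin : Finite (ResidueField O) := Nat.finite_of_card_ne_zero
    (by rw [hk]; exact pow_ne_zero _ (Fact.out : p.Prime).ne_zero)
  have hp0 : (p : O) ≠ 0 := Nat.cast_ne_zero.2 (Fact.out : p.Prime).ne_zero
  have key : ∀ (n : ℕ) (a : Fin e → WittVector p (ResidueField O)),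
      ∑ i, embO₀ hπ hk (a i) * π ^ (i : ℕ) = 0 →
      ∀ i, (p : WittVector p (ResidueField O)) ^ n ∣ a i := by
    intro n
    induction n with
    | zero => simp
    | succ n ih =>
      intro a ha
      choose c hc using p_dvd_of_pow_dvd_sum hπ hk he a (by rw [ha]; exact dvd_zero _)
      have h1 := ih c (by
        refine (mul_eq_zero.1 ?_).resolve_left hp0
        rw [← ha, Finset.mul_sum]
        refine Finset.sum_congr rfl fun i _ => ?_
        rw [hc, map_mul, map_natCast, mul_assoc])
      intro i
      rw [hc, pow_succ']
      exact mul_dvd_mul_left _ (h1 i)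
  intro a a' h
  funext i
  refine sub_eq_zero.1 (IsHausdorff.haus (I := Ideal.span {(p : WittVector p (ResidueField O))})
    inferInstance _ fun n => ?_)
  rw [SModEq.zero, smul_eq_mul, Ideal.mul_top, Ideal.span_singleton_pow,
    Ideal.mem_span_singleton]
  refine key n (fun i => a i - a' i) ?_ i
  simp only [map_sub, sub_mul, Finset.sum_sub_distrib]
  exact sub_eq_zero.2 h

/-- Subtracting the Teichmüller lift of the residue and dividing by `π`, `e` times, leaves a
remainder in `π^e O = p O`. -/
theorem exists_sum_embO₀ {e : ℕ} (he : IsDiscreteValuationRing.addVal O (p : O) = e) (c : O) :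
    ∃ (a : Fin e → WittVector p (ResidueField O)) (c' : O),
      c = ∑ i, embO₀ hπ hk (a i) * π ^ (i : ℕ) + p * c' := by
  obtain ⟨ε, hε⟩ := exists_unit_mul_pow hπ he
  have key : ∀ (m : ℕ) (c : O), ∃ (a : ℕ → WittVector p (ResidueField O)) (c' : O),
      c = ∑ i ∈ Finset.range m, embO₀ hπ hk (a i) * π ^ i + π ^ m * c' := by
    intro m
    induction m with
    | zero => exact fun c => ⟨0, c, by simp⟩
    | succ m ih =>
      intro c
      obtain ⟨a, c', rfl⟩ := ih c
      have h1 : π ∣ c' - embO₀ hπ hk (WittVector.teichmuller p (residue O c')) := by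
        refine (dvrDatum_residue hπ hk _).1 ?_
        rw [map_sub, residue_embO₀, WittVector.teichmuller_coeff_zero, sub_self]
      obtain ⟨d, hd⟩ := h1
      refine ⟨fun i => if i = m then WittVector.teichmuller p (residue O c') else a i, d, ?_⟩
      have hs : ∑ i ∈ Finset.range m, embO₀ hπ hk
          (if i = m then WittVector.teichmuller p (residue O c') else a i) * π ^ i
          = ∑ i ∈ Finset.range m, embO₀ hπ hk (a i) * π ^ i :=
        Finset.sum_congr rfl fun i hi => by rw [if_neg (Finset.mem_range.1 hi).ne]
      beta_reduce
      rw [Finset.sum_range_succ, if_pos rfl, hs]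
      linear_combination π ^ m * hd
  obtain ⟨a, c', h⟩ := key e c
  refine ⟨fun i => a i, ↑ε⁻¹ * c', ?_⟩
  rw [h, Fin.sum_univ_eq_sum_range (fun i => embO₀ hπ hk (a i) * π ^ i), hε]
  congr 1
  calc π ^ e * c' = (ε * ↑ε⁻¹) * (π ^ e * c') := by rw [Units.mul_inv, one_mul]
    _ = _ := by ring

theorem sum_embO₀_surjective {e : ℕ}
    (he : IsDiscreteValuationRing.addVal O (p : O) = e) :
    Function.Surjective fun a : Fin e → WittVector p (ResidueField O) =>
      ∑ i, embO₀ hπ hk (a i) * π ^ (i : ℕ) := by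
  have : CharP (ResidueField O) p := charP_of_card hk
  have hfin : Finite (ResidueField O) := Nat.finite_of_card_ne_zero
    (by rw [hk]; exact pow_ne_zero _ (Fact.out : p.Prime).ne_zero)
  intro c
  choose a r hr using exists_sum_embO₀ hπ hk he
  -- Here `r` is the remainder map of the expansion modulo `p`. Iterating it yields a `p`-adic
  -- expansion of each coordinate, whose partial sums converge in `W(k)`; their limits `L` are the
  -- coordinates of `c`.
  have hN : ∀ N, c = ∑ i, embO₀ hπ hk (∑ n ∈ Finset.range N, p ^ n * a (r^[n] c) i) * π ^ (i : ℕ)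
      + p ^ N * r^[N] c := by
    intro N
    induction N with
    | zero => simp
    | succ N ih =>
      conv_lhs => rw [ih, hr (r^[N] c)]
      simp only [Finset.sum_range_succ, map_add, add_mul, Finset.sum_add_distrib, map_mul, map_pow,
        map_natCast, Function.iterate_succ_apply', mul_add, Finset.mul_sum]
      rw [add_assoc]
      congr 1
      rw [pow_succ]
      simp only [mul_assoc]
  have hmod : ∀ n (x y : WittVector p (ResidueField O)),
      x ≡ y [SMOD (Ideal.span {(p : WittVector p (ResidueField O))} ^ n • ⊤ :
        Ideal (WittVector p (ResidueField O)))] ↔ (p : WittVector p (ResidueField O)) ^ n ∣ x - y :=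
    fun n x y => by
      rw [SModEq.sub_mem, smul_eq_mul, Ideal.mul_top, Ideal.span_singleton_pow,
        Ideal.mem_span_singleton]
  have hlim : ∀ i, ∃ L : WittVector p (ResidueField O), ∀ N,
      (p : WittVector p (ResidueField O)) ^ N ∣
        ∑ n ∈ Finset.range N, p ^ n * a (r^[n] c) i - L := fun i => by
    obtain ⟨L, hL⟩ := IsPrecomplete.prec (I := Ideal.span {(p : WittVector p (ResidueField O))})
      inferInstance (f := fun N => ∑ n ∈ Finset.range N, p ^ n * a (r^[n] c) i)
      (fun {m n} hmn => by
        rw [hmod, ← neg_sub, ← Finset.sum_Ico_eq_sub _ hmn]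
        exact (Finset.dvd_sum fun j hj =>
          (pow_dvd_pow _ (Finset.mem_Ico.1 hj).1).mul_right _).neg_right)
    exact ⟨L, fun N => (hmod _ _ _).1 (hL N)⟩
  choose L hL using hlim
  refine ⟨L, ?_⟩
  refine (sub_eq_zero.1 (IsHausdorff.haus (I := maximalIdeal O) inferInstance _ fun N => ?_)).symm
  rw [SModEq.zero, smul_eq_mul, Ideal.mul_top]
  have hpm : (p : O) ^ N ∈ maximalIdeal O ^ N := Ideal.pow_mem_pow (by
    have : CharP (ResidueField O) p := charP_of_card hk
    rw [← residue_eq_zero_iff, map_natCast, CharP.cast_eq_zero]) N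
  refine Ideal.mem_of_dvd _ (?_ : (p : O) ^ N ∣ _) hpm
  conv_rhs => rw [hN N]
  rw [add_sub_right_comm, ← Finset.sum_sub_distrib]
  refine dvd_add (Finset.dvd_sum fun i _ => ?_) (dvd_mul_right _ _)
  rw [← sub_mul, ← map_sub]
  have := map_dvd (embO₀ hπ hk) (hL i N)
  rw [map_pow, map_natCast] at this
  exact this.mul_right _

/-- `1, π, …, π^{e-1}` is a basis of `O` over `W(k)`. -/
theorem sum_embO₀_bijective [CharZero O] {e : ℕ}
    (he : IsDiscreteValuationRing.addVal O (p : O) = e) :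
    Function.Bijective fun a : Fin e → WittVector p (ResidueField O) =>
      ∑ i, embO₀ hπ hk (a i) * π ^ (i : ℕ) :=
  ⟨sum_embO₀_injective hπ hk he, sum_embO₀_surjective hπ hk he⟩

end Structure

/-! ### Coordinates in the basis `1, π, …, π^(e-1)`, and the vanishing criterion for `u^ra` -/

section Coordinates

open IsLocalRing

variable {O : Type u} [CommRing O] [IsDomain O] [IsDiscreteValuationRing O] {p h : ℕ}
  [Fact p.Prime] {π : O} (hπ : Irreducible π) (hk : Nat.card (ResidueField O) = p ^ h)

section PowTensor

variable [IsAdicComplete (maximalIdeal O) O] [CharZero O] {e : ℕ} (he : IsDiscreteValuationRing.addVal O (p : O) = e)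
  {B B' : Type*} [CommRing B] [CommRing B']

/-- The coordinates on `B ⊗_{W(k)} O` with respect to `1, π, …, π^{e-1}`. -/
noncomputable def powTensor (f : WittVector p (ResidueField O) →+* B) :
    (Fin e → B) ≃+ TensorRing f (embO₀ hπ hk) :=
  AddEquiv.ofBijective
    ({ toFun := fun x => ∑ i, TensorRing.tmul f (embO₀ hπ hk) (x i) (π ^ (i : ℕ))
       map_zero' := by simp [TensorRing.tmul_eq_mul]
       map_add' := fun x y => by
        simp [TensorRing.tmul_eq_mul, add_mul, Finset.sum_add_distrib] } :
      (Fin e → B) →+ TensorRing f (embO₀ hπ hk))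
    (TensorRing.sum_tmul_bijective _ (sum_embO₀_bijective hπ hk he))

theorem powTensor_apply (f : WittVector p (ResidueField O) →+* B) (x : Fin e → B) :
    powTensor hπ hk he f x = ∑ i, TensorRing.tmul f (embO₀ hπ hk) (x i) (π ^ (i : ℕ)) := rfl

theorem map_powTensor {f : WittVector p (ResidueField O) →+* B}
    {f' : WittVector p (ResidueField O) →+* B'} (w : B →+* B') (hw : ∀ s, w (f s) = f' s)
    (x : Fin e → B) :
    TensorRing.map w hw (powTensor hπ hk he f x) = powTensor hπ hk he f' fun i => w (x i) := by
  rw [powTensor_apply, powTensor_apply, map_sum]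
  exact Finset.sum_congr rfl fun i _ => TensorRing.map_tmul _ _ _ _

end PowTensor

theorem ramificationIndex_pos {e : ℕ} (he : IsDiscreteValuationRing.addVal O (p : O) = e)
    (hπ : Irreducible π) (hk : Nat.card (ResidueField O) = p ^ h) : 0 < e := by
  rw [Nat.pos_iff_ne_zero]
  rintro rfl
  have h1 : IsUnit (p : O) := IsDiscreteValuationRing.addVal_eq_zero_iff.1 (by simpa using he)
  exact hπ.not_isUnit (isUnit_of_dvd_unit (dvrDatum hπ hk).dvd_p h1)

/-- Division by `e` with remainder merges the Witt index `m` and the exponent `i` of `π` into the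
single exponent `j = em + i`, matching `p^m π^i = ε^m π^j`. -/
theorem sum_range_sum_fin {M : Type*} [AddCommMonoid M] (e N : ℕ) (F : ℕ → M) :
    ∑ m ∈ Finset.range N, ∑ i : Fin e, F (e * m + i) = ∑ j ∈ Finset.range (e * N), F j := by
  induction N with
  | zero => simp
  | succ N ih =>
    rw [Finset.sum_range_succ, ih, Nat.mul_succ, Finset.sum_range_add,
      Fin.sum_univ_eq_sum_range (fun i => F (e * N + i))]

variable {A : Type u} [CommRing A] [Algebra (ResidueField O) A]

theorem algebraMap_residue_uniformizer :
    ((algebraMap (ResidueField O) A).comp (residue O)) (dvrDatum hπ hk).ϖ = 0 := by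
  rw [RingHom.comp_apply, (dvrDatum_residue hπ hk _).2 dvd_rfl, map_zero]

/-- On lifts, `Φ_n` of the sum is `∑ p^m x_{m,i}^(q^(n-m)) π^i`. Substituting `p = ε π^e` gives a
sum over `j = em + i` of `ε^m π^j x_{m,i}^(q^(n-m))`, and since `n - m = (j - m) + (n - j)` for `j ≤
n`, it is congruent modulo `π^(n+1)` to the ghost component of `∑ ε^m V^j [y_j]` with `y_j =
x_{m,i}^(q^(j-m))`. Such a vector vanishes only if every `y_j` does, and `j - m = m(e-1) + i`. -/
theorem sum_drinfeld_eq_zero_iff [IsAdicComplete (maximalIdeal O) O] {e : ℕ} (he : IsDiscreteValuationRing.addVal O (p : O) = e)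
    {φ : WittVector p (ResidueField O) →+* A}
    (hφ : ((algebraMap (ResidueField O) A).comp (residue O)).comp (homO₀ hπ hk).α = φ)
    (x : Fin e → RamWitt (wittDatum hk) φ) :
    ∑ i, RamWitt.drinfeld (homO₀ hπ hk) hφ (x i)
        * RamWitt.scalarHom (dvrDatum hπ hk) _ (π ^ (i : ℕ)) = 0 ↔
      ∀ (n : ℕ) (i : Fin e), (x i).coeff n ^ (p ^ h) ^ (n * (e - 1) + (i : ℕ)) = 0 := by
  obtain ⟨ε, hε⟩ := exists_unit_mul_pow hπ he
  have hepos := ramificationIndex_pos he hπ hk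
  obtain ⟨d, rfl⟩ : ∃ d, e = d + 1 := ⟨e - 1, by omega⟩
  let ψ := (algebraMap (ResidueField O) A).comp (residue O)
  let C : O →+* MvPolynomial A O := MvPolynomial.C
  have hc : (RamWitt.cover ψ).comp (C.comp (homO₀ hπ hk).α) = φ := by
    rw [← RingHom.comp_assoc, RamWitt.cover_comp, hφ]
  let x' : Fin (d + 1) → RamWitt (wittDatum hk) (C.comp (homO₀ hπ hk).α) := fun i =>
    ⟨fun n => MvPolynomial.X ((x i).coeff n)⟩
  let w : RamWitt (dvrDatum hπ hk) C := ∑ i, RamWitt.drinfeld (homO₀ hπ hk) rfl (x' i)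
    * RamWitt.scalarHom (dvrDatum hπ hk) _ (π ^ (i : ℕ))
  have hxj : ∀ i n, RamWitt.cover ψ ((x' i).coeff n) = (x i).coeff n := fun i n => by
    simp [x', RamWitt.cover]
  have hx' : ∀ i, RamWitt.mapFun (RamWitt.cover ψ) hc (x' i) = x i := fun i =>
    RamWitt.ext (funext (hxj i))
  have hw : RamWitt.map (RamWitt.cover ψ) (RamWitt.cover_comp ψ) w
      = ∑ i, RamWitt.drinfeld (homO₀ hπ hk) hφ (x i)
        * RamWitt.scalarHom (dvrDatum hπ hk) _ (π ^ (i : ℕ)) := by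
    rw [map_sum]
    refine Finset.sum_congr rfl fun i _ => ?_
    rw [map_mul, RamWitt.map_scalarHom]
    congr 1
    refine (RamWitt.mapFun_drinfeldFun _ rfl hφ _ hc (RamWitt.cover_comp ψ) _).trans ?_
    rw [hx']
    rfl
  let ix : ℕ → Fin (d + 1) := fun j => ⟨j % (d + 1), Nat.mod_lt _ hepos⟩
  have hix : ∀ m (i : Fin (d + 1)), ix ((d + 1) * m + i) = i := fun m i =>
    Fin.ext (by simp [ix, Nat.mod_eq_of_lt i.2])
  have hdiv : ∀ m (i : Fin (d + 1)), ((d + 1) * m + i) / (d + 1) = m := fun m i => by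
    rw [Nat.mul_add_div hepos, Nat.div_eq_of_lt i.2, add_zero]
  let y : ℕ → MvPolynomial A O := fun j =>
    (x' (ix j)).coeff (j / (d + 1)) ^ (p ^ h) ^ (j - j / (d + 1))
  have hg : ∀ n, C π ^ (n + 1) ∣ RamWitt.ghost n w - ∑ j ∈ Finset.range (n + 1),
      C ((ε : O) ^ (j / (d + 1))) * (C π ^ j * y j ^ (p ^ h) ^ (n - j)) := by
    intro n
    have h1 : RamWitt.ghost n w = ∑ j ∈ Finset.range ((d + 1) * (n + 1)),
        C ((ε : O) ^ (j / (d + 1))) * (C π ^ j *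
          (x' (ix j)).coeff (j / (d + 1)) ^ (p ^ h) ^ (n - j / (d + 1))) := by
      rw [← sum_range_sum_fin, Finset.sum_comm]
      refine (map_sum (RamWitt.ghostHom (D := dvrDatum hπ hk) C n) _ _).trans ?_
      refine Finset.sum_congr rfl fun i _ => ?_
      refine (RamWitt.ghost_mul _ _ n).trans ?_
      have h2 := RamWitt.ghost_drinfeldFun (homO₀ hπ hk) (φ' := C) rfl (x' i) n
      rw [show (homO₀ hπ hk).r = 1 from rfl, one_mul] at h2
      refine (congrArg (· * _) h2).trans ?_
      rw [RamWitt.scalarHom_apply, RamWitt.ghost_scalar, RamWitt.ghost, wittPoly, Finset.sum_mul]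
      refine Finset.sum_congr rfl fun m _ => ?_
      have h3 : (C.comp (homO₀ hπ hk).α) (wittDatum hk).ϖ = C ε * C π ^ (d + 1) := by
        have : (wittDatum hk).ϖ = (p : WittVector p (ResidueField O)) := rfl
        rw [this, map_natCast, ← map_pow, ← map_mul, ← hε, map_natCast]
      rw [h3, hix, hdiv, pow_add (C π) _ (i : ℕ), pow_mul (C π) (d + 1), map_pow, map_pow, mul_pow]
      change C ↑ε ^ m * (C π ^ (d + 1)) ^ m * (x' i).coeff m ^ (p ^ h) ^ (n - m) * _ = _
      ring
    -- Only `j ≤ n` matters: the later terms of the merged sum carry `π^j` with `j ≥ n + 1`.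
    obtain ⟨c, hc⟩ : ∃ c, (d + 1) * (n + 1) = n + 1 + c := ⟨d * (n + 1), by ring⟩
    rw [h1, hc, Finset.sum_range_add, add_sub_right_comm]
    refine dvd_add ?_ (Finset.dvd_sum fun j _ => Dvd.dvd.mul_left
      (Dvd.dvd.mul_right (pow_dvd_pow _ (by omega)) _) _)
    refine (dvd_zero _).trans (dvd_of_eq (sub_eq_zero.2 ?_).symm)
    refine Finset.sum_congr rfl fun j hj => ?_
    have hj' := Finset.mem_range.1 hj
    have hj2 : j / (d + 1) ≤ j := Nat.div_le_self _ _
    simp only [y]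
    rw [← pow_mul ((x' (ix j)).coeff _), ← pow_add, show j - j / (d + 1) + (n - j) = n - j / (d + 1) by omega]
  rw [← hw]
  refine (RamWitt.eq_zero_iff_of_lift (D := dvrDatum hπ hk) (φ := ψ)
    (algebraMap_residue_uniformizer hπ hk) (fun j => (ε.isUnit.pow (j / (d + 1)))) hg).trans ?_
  have hy : ∀ j, RamWitt.cover ψ (y j)
      = (x (ix j)).coeff (j / (d + 1)) ^ (p ^ h) ^ (j - j / (d + 1)) := fun j => by
    rw [map_pow, hxj]
  simp only [hy, Nat.add_sub_cancel]
  constructor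
  · intro H n i
    have := H ((d + 1) * n + i)
    rwa [hix, hdiv, show (d + 1) * n + (i : ℕ) - n = n * d + i by
      rw [Nat.sub_eq_iff_eq_add (by nlinarith)]; ring] at this
  · intro H j
    have := H (j / (d + 1)) (ix j)
    have h4 : j - j / (d + 1) = j / (d + 1) * d + (ix j : ℕ) := by
      have h5 := Nat.div_add_mod j (d + 1)
      have h6 : (ix j : ℕ) = j % (d + 1) := rfl
      rw [h6, Nat.sub_eq_iff_eq_add (Nat.div_le_self _ _)]
      linarith
    rwa [h4]

end Coordinates

/-! ## Base change of the Drinfeld morphism -/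

section BaseChange

variable {k : Type u} [Field k] {S O : Type u} [CommRing S] [CommRing O]
  {F G : CommAlgCat.{u} k ⥤ CommRingCat.{u}}

/-- The morphism `F(A) ⊗_S O → G(A) ⊗_S O` induced by an `S`-linear morphism `F → G`. -/
noncomputable def tensorMap (s : Scalars S F) (t : Scalars S G) (ι : S →+* O) (τ : F ⟶ G)
    (hτ : ∀ A x, (τ.app A).hom (s.hom A x) = t.hom A x) :
    tensorFunctor s ι ⟶ tensorFunctor t ι where
  app A := CommRingCat.ofHom (TensorRing.map (τ.app A).hom (hτ A))
  naturality A A' f := by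
    refine CommRingCat.hom_ext (TensorRing.hom_ext fun b c => ?_)
    change TensorRing.map _ (hτ A') (TensorRing.map _ (s.naturality f) _)
      = TensorRing.map _ (t.naturality f) (TensorRing.map _ (hτ A) _)
    rw [TensorRing.map_tmul, TensorRing.map_tmul, TensorRing.map_tmul, TensorRing.map_tmul]
    congr 1
    exact ConcreteCategory.congr_hom (τ.naturality f) b

theorem tensorLift_app (s : Scalars S F) (ι : S →+* O) (t : Scalars O G) (τ : F ⟶ G)
    (hτ : ∀ A x, (τ.app A).hom (s.hom A x) = t.hom A (ι x)) (A : CommAlgCat.{u} k) :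
    ∃ H, ((tensorLift s ι t τ hτ).app A).hom = TensorRing.lift (τ.app A).hom (t.hom A) H :=
  ⟨hτ A, rfl⟩

end BaseChange

/-! ### The factorization `r = u^ra ∘ (u ⊗ O)` and its form in coordinates -/

section Comparison

open IsLocalRing

variable {O : Type u} [CommRing O] [IsDomain O] [IsDiscreteValuationRing O] {p h : ℕ}
  [Fact p.Prime] {π : O} (hπ : Irreducible π) (hk : Nat.card (ResidueField O) = p ^ h)

/-- `W(k)`-linearity of the Drinfeld morphism, which is what allows the base change `u ⊗ O`. It
follows by functoriality along `k → A` from the case `A = k`. -/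
theorem drinfeldO₀_scalar (A : CommAlgCat.{u} (ResidueField O)) (s : WittVector p (ResidueField O)) :
    ((drinfeldO₀ hk).app A).hom ((wittScalars p (ResidueField O)).hom A s)
      = (ramWittScalars (wittDatum hk) WittVector.constantCoeff).hom A s := by
  have h1 := congrArg (RamWitt.map
    (φ' := (algebraMap (ResidueField O) A).comp WittVector.constantCoeff)
    (algebraMap (ResidueField O) A) rfl) (typicalDrinfeld_eq_scalarHom hk s)
  rw [RamWitt.map_scalarHom, map_typicalDrinfeld] at h1
  exact h1

theorem coeff_drinfeldO₀ (A : CommAlgCat.{u} (ResidueField O)) (x : WittVector p A) (n : ℕ) :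
    RamWitt.coeff (((drinfeldO₀ hk).app A).hom x) n = x.coeff n ^ p ^ (n * (h - 1)) := by
  have : CharP (ResidueField O) p := charP_of_card hk
  refine coeff_typicalDrinfeld (D := wittDatum hk) rfl ?_ x n
  have : (wittDatum hk).ϖ = (p : WittVector p (ResidueField O)) := rfl
  rw [this, map_natCast, ← map_natCast (algebraMap (ResidueField O) A), CharP.cast_eq_zero,
    map_zero]

variable [IsAdicComplete (maximalIdeal O) O]

/-- The base change `u ⊗ O : W(A) ⊗_{W(k)} O → W_{O₀}(A) ⊗_{O₀} O` of the Drinfeld morphism. -/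
noncomputable def toRamTensor : greenberg hπ hk ⟶ ramTensor hπ hk :=
  tensorMap _ _ _ (drinfeldO₀ hk) (drinfeldO₀_scalar hk)

theorem r_app (A : CommAlgCat.{u} (ResidueField O)) :
    ∃ H, ((r hπ hk).app A).hom = TensorRing.lift ((drinfeldO hπ hk).app A).hom
      ((ramWittScalars (dvrDatum hπ hk) (residue O)).hom A) H := tensorLift_app _ _ _ _ _ A

theorem r_tmul (A : CommAlgCat.{u} (ResidueField O)) (b : WittVector p A) (c : O) :
    ((r hπ hk).app A).hom (TensorRing.tmul ((wittScalars p (ResidueField O)).hom A)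
      (embO₀ hπ hk) b c) = ((drinfeldO hπ hk).app A).hom b
        * (ramWittScalars (dvrDatum hπ hk) (residue O)).hom A c := by
  obtain ⟨H, h⟩ := r_app hπ hk A
  exact (RingHom.congr_fun h _).trans (TensorRing.lift_tmul _ _ H b c)

theorem uRam_app (A : CommAlgCat.{u} (ResidueField O)) :
    ∃ H, ((uRam hπ hk).app A).hom = TensorRing.lift ((drinfeldRam hπ hk).app A).hom
      ((ramWittScalars (dvrDatum hπ hk) (residue O)).hom A) H := tensorLift_app _ _ _ _ _ A

theorem uRam_tmul (A : CommAlgCat.{u} (ResidueField O)) (b : (ramWittO₀ hk).obj A) (c : O) :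
    ((uRam hπ hk).app A).hom (TensorRing.tmul
      ((ramWittScalars (wittDatum hk) WittVector.constantCoeff).hom A) (embO₀ hπ hk) b c)
      = ((drinfeldRam hπ hk).app A).hom b
        * (ramWittScalars (dvrDatum hπ hk) (residue O)).hom A c := by
  obtain ⟨H, h⟩ := uRam_app hπ hk A
  exact (RingHom.congr_fun h _).trans (TensorRing.lift_tmul _ _ H b c)

/-- Both sides are `O`-linear extensions from `W(A)`, where the claim is transitivity of Drinfeld
maps along `ℤ_p → O₀ → O`. -/
theorem toRamTensor_comp_uRam : toRamTensor hπ hk ≫ uRam hπ hk = r hπ hk := by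
  ext A : 2
  refine CommRingCat.hom_ext (TensorRing.hom_ext fun b c => ?_)
  refine (congrArg ((uRam hπ hk).app A).hom
    (TensorRing.map_tmul _ (drinfeldO₀_scalar hk A) b c)).trans ?_
  refine (uRam_tmul hπ hk A _ c).trans (Eq.trans ?_ (r_tmul hπ hk A b c).symm)
  congr 1
  exact drinfeld_typicalDrinfeld (homO₀ hπ hk) (comp_homO₀ hπ hk A) b

theorem toGreenberg_comp_r : toGreenberg hπ hk ≫ r hπ hk = drinfeldO hπ hk := by
  ext A : 2
  refine CommRingCat.hom_ext (RingHom.ext fun b => ?_)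
  refine (r_tmul hπ hk A b 1).trans ?_
  rw [map_one, mul_one]

variable [CharZero O] {e : ℕ} (he : IsDiscreteValuationRing.addVal O (p : O) = e)

/-- Coordinates on `W(A) ⊗_{W(k)} O`. -/
noncomputable def greenbergCoord (A : CommAlgCat.{u} (ResidueField O)) :
    (Fin e → WittVector p A) ≃+ (greenberg hπ hk).obj A :=
  powTensor hπ hk he ((wittScalars p (ResidueField O)).hom A)

/-- Coordinates on `W_{O₀}(A) ⊗_{O₀} O`. -/
noncomputable def ramTensorCoord (A : CommAlgCat.{u} (ResidueField O)) :
    (Fin e → (ramWittO₀ hk).obj A) ≃+ (ramTensor hπ hk).obj A :=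
  powTensor hπ hk he ((ramWittScalars (wittDatum hk) WittVector.constantCoeff).hom A)

theorem map_greenbergCoord {A A' : CommAlgCat.{u} (ResidueField O)} (f : A ⟶ A')
    (x : Fin e → WittVector p A) :
    ((greenberg hπ hk).map f).hom (greenbergCoord hπ hk he A x)
      = greenbergCoord hπ hk he A' fun i => WittVector.map (f.hom : A →+* A') (x i) :=
  map_powTensor hπ hk he _ ((wittScalars p (ResidueField O)).naturality f) x

theorem map_ramTensorCoord {A A' : CommAlgCat.{u} (ResidueField O)} (f : A ⟶ A')
    (x : Fin e → (ramWittO₀ hk).obj A) :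
    ((ramTensor hπ hk).map f).hom (ramTensorCoord hπ hk he A x)
      = ramTensorCoord hπ hk he A' fun i => ((ramWittO₀ hk).map f).hom (x i) :=
  map_powTensor hπ hk he _ ((ramWittScalars (wittDatum hk) _).naturality f) x

theorem toRamTensor_greenbergCoord (A : CommAlgCat.{u} (ResidueField O))
    (x : Fin e → WittVector p A) :
    ((toRamTensor hπ hk).app A).hom (greenbergCoord hπ hk he A x)
      = ramTensorCoord hπ hk he A fun i => ((drinfeldO₀ hk).app A).hom (x i) :=
  map_powTensor hπ hk he _ (drinfeldO₀_scalar hk A) x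

theorem uRam_ramTensorCoord_eq_zero_iff (A : CommAlgCat.{u} (ResidueField O))
    (x : Fin e → (ramWittO₀ hk).obj A) :
    ((uRam hπ hk).app A).hom (ramTensorCoord hπ hk he A x) = 0 ↔
      ∀ (n : ℕ) (i : Fin e),
        RamWitt.coeff (x i) n ^ (p ^ h) ^ (n * (e - 1) + (i : ℕ)) = 0 := by
  refine Eq.congr_left ?_ |>.trans
    (sum_drinfeld_eq_zero_iff hπ hk he (comp_homO₀ hπ hk A) x)
  refine (map_sum ((uRam hπ hk).app A).hom (fun i => TensorRing.tmul
    ((ramWittScalars (wittDatum hk) WittVector.constantCoeff).hom A) (embO₀ hπ hk) (x i)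
    (π ^ (i : ℕ))) Finset.univ).trans ?_
  exact Finset.sum_congr rfl fun i _ => uRam_tmul hπ hk A (x i) (π ^ (i : ℕ))

/-- Through the factorization, `u` first raises the component of index `n` to the power
`p^(n(h-1))`, and the criterion for `u^ra` is then applied to the result; the exponents multiply. -/
theorem r_greenbergCoord_eq_zero_iff (A : CommAlgCat.{u} (ResidueField O))
    (x : Fin e → WittVector p A) :
    ((r hπ hk).app A).hom (greenbergCoord hπ hk he A x) = 0 ↔
      ∀ (n : ℕ) (i : Fin e),
        (x i).coeff n ^ (p ^ (n * (h - 1)) * (p ^ h) ^ (n * (e - 1) + (i : ℕ))) = 0 := by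
  have h1 : ((r hπ hk).app A).hom (greenbergCoord hπ hk he A x)
      = ((uRam hπ hk).app A).hom (((toRamTensor hπ hk).app A).hom
        (greenbergCoord hπ hk he A x)) := by
    rw [← toRamTensor_comp_uRam]
    rfl
  rw [h1, toRamTensor_greenbergCoord, uRam_ramTensorCoord_eq_zero_iff]
  simp only [coeff_drinfeldO₀, pow_mul]

end Comparison

/-! ## Group functors with nilpotent coordinates -/

section NilCoords

variable {k : Type u} [Field k]

/-- `k[X_j : j ∈ J] / (X_j ^ {m_j})`. -/
abbrev NilRing (k : Type u) [Field k] {J : Type} (m : J → ℕ) : Type u :=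
  MvPolynomial J k ⧸ Ideal.span (Set.range fun j : J => (MvPolynomial.X j : MvPolynomial J k) ^ m j)

theorem nilRing_mk_pow {J : Type} (m : J → ℕ) (j : J) : Ideal.Quotient.mk
    (Ideal.span (Set.range fun j : J => (MvPolynomial.X j : MvPolynomial J k) ^ m j))
    (MvPolynomial.X j ^ m j) = 0 :=
  Ideal.Quotient.eq_zero_iff_mem.2 (Ideal.subset_span ⟨j, rfl⟩)

/-- Full faithfulness of `Spec` turns morphisms `Spec A → Spec C` over `k` into homomorphisms `C →
A`, so representability may be checked on algebras. -/
theorem isSpec_of_equiv {G : CommAlgCat.{u} k ⥤ AddCommGrpCat.{u}} {C : Type u} [CommRing C]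
    [Algebra k C] (ε : ∀ A : CommAlgCat.{u} k, G.obj A ≃ (C →ₐ[k] A))
    (hε : ∀ {A A' : CommAlgCat.{u} k} (f : A ⟶ A') (x : G.obj A),
      ε A' (G.map f x) = f.hom.comp (ε A x)) : IsSpec G C := by
  let a : ∀ A : CommAlgCat.{u} k, (C →ₐ[k] A) ≃ (points k (specOver k C)).obj A := fun A =>
    ((⟨fun g => (CommAlgCat.ofHom g : CommAlgCat.of k C ⟶ A), fun g => g.hom,
      fun _ => rfl, fun _ => rfl⟩ : (C →ₐ[k] A) ≃ (CommAlgCat.of k C ⟶ A)).trans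
      (opEquiv (Opposite.op A) (Opposite.op (CommAlgCat.of k C))).symm).trans
      (AlgebraicGeometry.algSpec.fullyFaithful (R := CommRingCat.of k)).homEquiv
  refine ⟨NatIso.ofComponents (fun A => ((ε A).trans (a A)).toIso) fun {A A'} f => ?_⟩
  ext x
  change a A' (ε A' (G.map f x)) = (points k (specOver k C)).map f (a A (ε A x))
  rw [hε]
  exact (AlgebraicGeometry.algSpec (CommRingCat.of k)).map_comp f.op
    (CommAlgCat.ofHom (ε A x) : CommAlgCat.of k C ⟶ A).op

/-- Coordinates identifying a group functor, as a functor of sets, with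
`A ↦ {y ∈ A^J | ∀ j, y_j ^ {m_j} = 0}`. -/
structure NilCoords (G : CommAlgCat.{u} k ⥤ AddCommGrpCat.{u}) {J : Type} (m : J → ℕ) where
  coord (A : CommAlgCat.{u} k) (x : G.obj A) (j : J) : A
  coord_map {A A' : CommAlgCat.{u} k} (f : A ⟶ A') (x : G.obj A) (j : J) :
    coord A' (G.map f x) j = f.hom (coord A x j)
  injective (A : CommAlgCat.{u} k) : Function.Injective (coord A)
  exists_iff (A : CommAlgCat.{u} k) (y : J → A) : (∃ x, coord A x = y) ↔ ∀ j, y j ^ m j = 0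

namespace NilCoords

variable {G : CommAlgCat.{u} k ⥤ AddCommGrpCat.{u}} {J : Type} {m : J → ℕ} (c : NilCoords G m)

theorem coord_pow (A : CommAlgCat.{u} k) (x : G.obj A) (j : J) : c.coord A x j ^ m j = 0 :=
  (c.exists_iff A _).1 ⟨x, rfl⟩ j

/-- The homomorphism `k[X_j] / (X_j ^ {m_j}) → A` corresponding to a point. -/
noncomputable def toAlgHom (A : CommAlgCat.{u} k) (x : G.obj A) : NilRing k m →ₐ[k] A :=
  Ideal.Quotient.liftₐ _ (MvPolynomial.aeval (c.coord A x)) fun a ha => by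
    have : Ideal.span (Set.range fun j : J => (MvPolynomial.X j : MvPolynomial J k) ^ m j)
        ≤ RingHom.ker (MvPolynomial.aeval (c.coord A x) : MvPolynomial J k →ₐ[k] A) := by
      rw [Ideal.span_le]
      rintro _ ⟨j, rfl⟩
      simp [c.coord_pow]
    exact this ha

theorem toAlgHom_mk_X (A : CommAlgCat.{u} k) (x : G.obj A) (j : J) :
    c.toAlgHom A x (Ideal.Quotient.mk _ (MvPolynomial.X j)) = c.coord A x j :=
  MvPolynomial.aeval_X _ _

theorem nilRing_algHom_ext {A : Type*} [CommRing A] [Algebra k A] {g g' : NilRing k m →ₐ[k] A}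
    (h : ∀ j, g (Ideal.Quotient.mk _ (MvPolynomial.X j))
      = g' (Ideal.Quotient.mk _ (MvPolynomial.X j))) : g = g' :=
  Ideal.Quotient.algHom_ext _ (MvPolynomial.algHom_ext h)

theorem isSpec (c : NilCoords G m) : IsSpec G (NilRing k m) := by
  refine isSpec_of_equiv (fun A => Equiv.ofBijective (c.toAlgHom A) ⟨fun x x' h => ?_, fun g => ?_⟩)
    fun {A A'} f x => ?_
  · refine c.injective A (funext fun j => ?_)
    rw [← c.toAlgHom_mk_X, ← c.toAlgHom_mk_X, h]
  · obtain ⟨x, hx⟩ := (c.exists_iff A fun j => g (Ideal.Quotient.mk _ (MvPolynomial.X j))).2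
      fun j => by
        rw [← map_pow, ← map_pow, nilRing_mk_pow,
          map_zero]
    refine ⟨x, nilRing_algHom_ext fun j => ?_⟩
    rw [c.toAlgHom_mk_X, hx]
  · refine nilRing_algHom_ext fun j => ?_
    refine (c.toAlgHom_mk_X _ _ j).trans ((c.coord_map f x j).trans ?_)
    exact congrArg f.hom (c.toAlgHom_mk_X _ _ j).symm

theorem isAffineGroup (c : NilCoords G m) : IsAffineGroup G := ⟨CommAlgCat.of k (NilRing k m), c.isSpec⟩

/-- Renaming of the coordinates. -/
def reindex {J' : Type} {m' : J' → ℕ} (σ : J' ≃ J) (hm : ∀ j, m' j = m (σ j)) :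
    NilCoords G m' where
  coord A x j := c.coord A x (σ j)
  coord_map f x j := c.coord_map f x (σ j)
  injective A x x' h := c.injective A (funext fun j => by
    have := congrFun h (σ.symm j)
    simpa using this)
  exists_iff A y := by
    have h := c.exists_iff A (y ∘ σ.symm)
    have h1 : (∀ j, (y ∘ σ.symm) j ^ m j = 0) ↔ ∀ j, y j ^ m' j = 0 := by
      rw [σ.forall_congr_left]
      simp [hm]
    rw [← h1, ← h]
    refine exists_congr fun x => ⟨fun h2 => ?_, fun h2 => ?_⟩
    · subst h2
      funext j
      simp
    · rw [h2]
      funext j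
      simp

/-- Coordinates on a power. -/
noncomputable def power (e : ℕ) :
    NilCoords (RamifiedWitt.power e G) fun j : Fin e × J => m j.2 where
  coord A x j := c.coord A (x j.1) j.2
  coord_map f x j := c.coord_map f (x j.1) j.2
  injective A x x' h := funext fun i => c.injective A (funext fun j => congrFun h (i, j))
  exists_iff A y := by
    constructor
    · rintro ⟨x, rfl⟩ j
      exact c.coord_pow A _ _
    · intro h
      choose x hx using fun i => (c.exists_iff A fun j => y (i, j)).2 fun j => h (i, j)
      exact ⟨x, funext fun j => congrFun (hx j.1) j.2⟩

/-- The generators are nilpotent, hence integral over `k`, and a finitely generated integral algebra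
is finite. -/
theorem nilRing_finite [Finite J] (hm : ∀ j, 0 < m j) : Module.Finite k (NilRing k m) := by
  have : Algebra.IsIntegral k (NilRing k m) := ⟨fun x => by
    obtain ⟨x, rfl⟩ := Ideal.Quotient.mk_surjective x
    induction x using MvPolynomial.induction_on with
    | C a => exact isIntegral_algebraMap (A := NilRing k m) (x := a)
    | add x y hx hy =>
      rw [map_add]
      exact hx.add hy
    | mul_X x j hx =>
      rw [map_mul]
      refine hx.mul (IsIntegral.of_pow (hm j) ?_)
      rw [← map_pow, nilRing_mk_pow]
      exact isIntegral_zero⟩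
  have : Algebra.FiniteType k (NilRing k m) :=
    Algebra.FiniteType.of_surjective (Ideal.Quotient.mkₐ k _) Ideal.Quotient.mk_surjective
  exact Algebra.IsIntegral.finite

/-- The augmentation `X_j ↦ 0` onto `k` differs from the identity by nilpotents, so it reflects
units, and a ring with a local homomorphism to a field is local. -/
theorem nilRing_isLocalRing (hm : ∀ j, 0 < m j) : IsLocalRing (NilRing k m) := by
  let φ : NilRing k m →ₐ[k] k := Ideal.Quotient.liftₐ _ (MvPolynomial.aeval fun _ => 0)
    fun a ha => by
      have : Ideal.span (Set.range fun j : J => (MvPolynomial.X j : MvPolynomial J k) ^ m j)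
          ≤ RingHom.ker (MvPolynomial.aeval fun _ => 0 : MvPolynomial J k →ₐ[k] k) := by
        rw [Ideal.span_le]
        rintro _ ⟨j, rfl⟩
        simp [(hm j).ne']
      exact this ha
  have hφ : ∀ x, IsNilpotent (x - algebraMap k (NilRing k m) (φ x)) := fun x => by
    obtain ⟨x, rfl⟩ := Ideal.Quotient.mk_surjective x
    induction x using MvPolynomial.induction_on with
    | C a =>
      have h1 : φ (Ideal.Quotient.mk _ (MvPolynomial.C a)) = a := φ.commutes a
      rw [h1]
      exact ⟨1, by rw [pow_one]; exact sub_self _⟩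
    | add x y hx hy =>
      rw [map_add, map_add, map_add, add_sub_add_comm]
      exact (Commute.all _ _).isNilpotent_add hx hy
    | mul_X x j hx =>
      have h1 : φ (Ideal.Quotient.mk _ (MvPolynomial.X j)) = 0 := MvPolynomial.aeval_X _ _
      rw [map_mul, map_mul, h1, mul_zero, map_zero, sub_zero]
      refine (Commute.all _ _).isNilpotent_mul_left ⟨m j, ?_⟩
      rw [← map_pow, nilRing_mk_pow]
  have : IsLocalHom (φ : NilRing k m →+* k) := ⟨fun x hx => by
    have h1 : IsUnit (algebraMap k (NilRing k m) (φ x)) := hx.map (algebraMap k (NilRing k m))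
    have h2 := (hφ x).isUnit_add_left_of_commute h1 (Commute.all _ _)
    rwa [add_sub_cancel] at h2⟩
  exact RingHom.domain_isLocalRing (φ : NilRing k m →+* k)

theorem isInfinitesimal (c : NilCoords G m) [Finite J] (hm : ∀ j, 0 < m j) : IsInfinitesimal G :=
  ⟨CommAlgCat.of k (NilRing k m), nilRing_finite hm, nilRing_isLocalRing hm, c.isSpec⟩

end NilCoords

end NilCoords

/-! ## Truncations and pro-infinitesimal groups -/

section Truncation

variable {k : Type u} [Field k]

namespace NilCoords

variable {G : CommAlgCat.{u} k ⥤ AddCommGrpCat.{u}} {J : Type} {m : J → ℕ} (c : NilCoords G m)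

/-- The level function `ℓ` on the coordinates is compatible with the group law: the points whose
coordinates of level `< N` vanish form a subgroup, whose cosets are given by the coordinates of
level `< N`. -/
def IsLevel (ℓ : J → ℕ) : Prop :=
  ∀ (A : CommAlgCat.{u} k) (N : ℕ) (x y : G.obj A),
    (∀ j, ℓ j < N → c.coord A (x - y) j = 0) ↔ ∀ j, ℓ j < N → c.coord A x j = c.coord A y j

variable {c} {ℓ : J → ℕ} (hℓ : c.IsLevel ℓ)

/-- The points whose coordinates of level `< N` vanish. -/
def levelSubgroup (N : ℕ) (A : CommAlgCat.{u} k) : AddSubgroup (G.obj A) :=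
  AddSubgroup.ofSub {x | ∀ j, ℓ j < N → c.coord A x j = 0}
    ⟨0, by
      have := (hℓ A N 0 0).2 fun _ _ => rfl
      rwa [sub_zero] at this⟩
    fun x hx y hy => by
      rw [← sub_eq_add_neg]
      exact (hℓ A N x y).2 fun j hj => (hx j hj).trans (hy j hj).symm

theorem mem_levelSubgroup {N : ℕ} {A : CommAlgCat.{u} k} {x : G.obj A} :
    x ∈ levelSubgroup hℓ N A ↔ ∀ j, ℓ j < N → c.coord A x j = 0 := Iff.rfl

theorem mk_eq_mk_iff {N : ℕ} {A : CommAlgCat.{u} k} {x y : G.obj A} :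
    (QuotientAddGroup.mk x : G.obj A ⧸ levelSubgroup hℓ N A) = QuotientAddGroup.mk y ↔
      ∀ j, ℓ j < N → c.coord A x j = c.coord A y j := by
  rw [QuotientAddGroup.eq_iff_sub_mem, mem_levelSubgroup, hℓ]

theorem levelSubgroup_le_comap {N M : ℕ} (hMN : M ≤ N) {A A' : CommAlgCat.{u} k} (f : A ⟶ A') :
    levelSubgroup hℓ N A ≤ (levelSubgroup hℓ M A').comap (G.map f).hom := fun x hx => by
  intro j hj
  refine (c.coord_map f x j).trans ?_
  rw [hx j (hj.trans_le hMN), map_zero]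

/-- The quotient of `G` by the points whose coordinates of level `< N` vanish. -/
noncomputable def trunc (N : ℕ) : CommAlgCat.{u} k ⥤ AddCommGrpCat.{u} where
  obj A := AddCommGrpCat.of (G.obj A ⧸ levelSubgroup hℓ N A)
  map f := AddCommGrpCat.ofHom
    (QuotientAddGroup.map _ _ (G.map f).hom (levelSubgroup_le_comap hℓ le_rfl f))
  map_id A := by
    refine AddCommGrpCat.hom_ext (QuotientAddGroup.addMonoidHom_ext _ (AddMonoidHom.ext fun x => ?_))
    exact congrArg QuotientAddGroup.mk (ConcreteCategory.congr_hom (G.map_id A) x)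
  map_comp f g := by
    refine AddCommGrpCat.hom_ext (QuotientAddGroup.addMonoidHom_ext _ (AddMonoidHom.ext fun x => ?_))
    exact congrArg QuotientAddGroup.mk (ConcreteCategory.congr_hom (G.map_comp f g) x)

/-- The projection to a truncation. -/
noncomputable def truncProj (N : ℕ) : G ⟶ trunc hℓ N where
  app _ := AddCommGrpCat.ofHom (QuotientAddGroup.mk' _)
  naturality _ _ _ := rfl

/-- The projection between truncations. -/
noncomputable def truncMap {N M : ℕ} (hMN : M ≤ N) : trunc hℓ N ⟶ trunc hℓ M where
  app _ := AddCommGrpCat.ofHom (QuotientAddGroup.map _ _ (AddMonoidHom.id _) fun _ hx j hj =>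
    hx j (hj.trans_le hMN))
  naturality _ _ _ :=
    AddCommGrpCat.hom_ext (QuotientAddGroup.addMonoidHom_ext _ (AddMonoidHom.ext fun _ => rfl))

/-- Coordinates on a truncation. -/
noncomputable def truncCoords (N : ℕ) :
    NilCoords (trunc hℓ N) fun j : {j : J // ℓ j < N} => m j.1 :=
  -- Coordinates of level `< N` do not depend on the representative of a coset, so any choice of
  -- representatives serves.
  have hout : ∀ {A : CommAlgCat.{u} k} (x : G.obj A) (j : {j : J // ℓ j < N}),
      c.coord A (Quotient.out (QuotientAddGroup.mk x : G.obj A ⧸ levelSubgroup hℓ N A)) j.1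
        = c.coord A x j.1 := fun x j =>
    (mk_eq_mk_iff hℓ).1 (QuotientAddGroup.out_eq' _) j.1 j.2
  { coord := fun A x j => c.coord A (Quotient.out (s := QuotientAddGroup.leftRel _) x) j.1
    coord_map := fun {A A'} f x j => by
      obtain ⟨x, rfl⟩ := QuotientAddGroup.mk_surjective x
      exact (hout (G.map f x) j).trans ((c.coord_map f x j.1).trans (congrArg f.hom (hout x j)).symm)
    injective := fun A x y h => by
      obtain ⟨x, rfl⟩ := QuotientAddGroup.mk_surjective x
      obtain ⟨y, rfl⟩ := QuotientAddGroup.mk_surjective y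
      exact (mk_eq_mk_iff hℓ).2 fun j hj =>
        (hout x ⟨j, hj⟩).symm.trans ((congrFun h ⟨j, hj⟩).trans (hout y ⟨j, hj⟩))
    exists_iff := fun A y => by
      constructor
      · rintro ⟨x, rfl⟩ j
        exact c.coord_pow A _ _
      · intro h
        classical
        -- A truncated point is extended by zeros. That `0 ^ m j = 0` is read off from the zero
        -- point of the group, so positivity of `m j` is not needed here.
        have h0 : c.coord A 0 = 0 := funext fun j => by
          have := (hℓ A (ℓ j + 1) 0 0).2 (fun _ _ => rfl) j (Nat.lt_succ_self _)
          rwa [sub_zero] at this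
        obtain ⟨x, hx⟩ := (c.exists_iff A fun j => if hj : ℓ j < N then y ⟨j, hj⟩ else 0).2
          fun j => by
            by_cases hj : ℓ j < N
            · rw [dif_pos hj]
              exact h ⟨j, hj⟩
            · rw [dif_neg hj]
              have := c.coord_pow A 0 j
              rwa [h0] at this
        refine ⟨QuotientAddGroup.mk x, funext fun j => (hout x j).trans ?_⟩
        rw [hx]
        exact dif_pos j.2 }

/-- The tower of truncations. -/
noncomputable def tower : (ULift.{u} ℕ)ᵒᵖ ⥤ CommAlgCat.{u} k ⥤ AddCommGrpCat.{u} where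
  obj N := trunc hℓ N.unop.down
  map {N M} f := truncMap hℓ (N := N.unop.down) (M := M.unop.down) (leOfHom f.unop :)
  map_id N := by
    ext A : 2
    exact AddCommGrpCat.hom_ext
      (QuotientAddGroup.addMonoidHom_ext _ (AddMonoidHom.ext fun _ => rfl))
  map_comp f g := by
    ext A : 2
    exact AddCommGrpCat.hom_ext
      (QuotientAddGroup.addMonoidHom_ext _ (AddMonoidHom.ext fun _ => rfl))

/-- `G` as a cone over its truncations. -/
noncomputable def towerCone : Limits.Cone (tower hℓ) where
  pt := G
  π :=
    { app := fun N => truncProj hℓ N.unop.down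
      naturality := fun _ _ _ => rfl }

/-- Limits are computed on points and on underlying sets. A compatible family of cosets determines
each coordinate, since the one at `j` is visible in every truncation beyond level `ℓ j`; no relation
links different coordinates, so these values form a point of `G`. -/
theorem towerCone_isLimit : Nonempty (Limits.IsLimit (towerCone hℓ)) := by
  refine ⟨Limits.evaluationJointlyReflectsLimits _ fun A => ?_⟩
  refine Limits.isLimitOfReflects (forget AddCommGrpCat.{u}) ?_
  refine Classical.choice ((Limits.Types.isLimit_iff _).2 fun s hs => ?_)
  choose g hg using fun N : (ULift.{u} ℕ)ᵒᵖ => QuotientAddGroup.mk_surjective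
    (s := levelSubgroup hℓ N.unop.down A) (s N)
  let lev : ℕ → (ULift.{u} ℕ)ᵒᵖ := fun N => Opposite.op ⟨N⟩
  have hcompat : ∀ N M : ℕ, M ≤ N → ∀ j, ℓ j < M →
      c.coord A (g (lev N)) j = c.coord A (g (lev M)) j := fun N M hMN => by
    have h1 := hs (homOfLE (show (⟨M⟩ : ULift.{u} ℕ) ≤ ⟨N⟩ from hMN)).op
    refine (mk_eq_mk_iff hℓ).1 ?_
    refine Eq.trans ?_ (h1.trans (hg (lev M)).symm)
    rw [← hg (lev N)]
    rfl
  -- The truncation at `ℓ j + 1` is the first that sees the coordinate `j`, as it keeps levels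
  -- strictly below its index.
  obtain ⟨x, hx⟩ := (c.exists_iff A fun j => c.coord A (g (lev (ℓ j + 1))) j).2
    fun j => c.coord_pow A _ _
  refine ⟨x, fun N => ?_, fun x' hx' => ?_⟩
  · refine Eq.trans ?_ (hg N)
    refine (mk_eq_mk_iff hℓ).2 fun j hj => ?_
    rw [hx]
    exact (hcompat N.unop.down (ℓ j + 1) hj j (Nat.lt_succ_self _)).symm
  · refine c.injective A (funext fun j => ?_)
    rw [hx]
    exact (mk_eq_mk_iff hℓ).1 ((hx' (lev (ℓ j + 1))).trans (hg _).symm) j (Nat.lt_succ_self _)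

theorem isProInfinitesimal (hℓ : c.IsLevel ℓ) (hm : ∀ j, 0 < m j) (hfin : ∀ N, Finite {j : J // ℓ j < N}) :
    IsProInfinitesimal G :=
  ⟨(ULift.{u} ℕ)ᵒᵖ, inferInstance, inferInstance, tower hℓ, towerCone hℓ,
    fun N => have := hfin N.unop.down
      (truncCoords hℓ N.unop.down).isInfinitesimal fun j => hm j.1,
    towerCone_isLimit hℓ, ⟨Iso.refl _⟩⟩

end NilCoords

end Truncation

/-! ## Adjoining roots by faithfully flat extensions -/

section Roots

open scoped TensorProduct

/-- The exponent `j ↦ N j * d j`. -/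
noncomputable def scaleExponent {J : Type*} (N : J → ℕ) (d : J →₀ ℕ) : J →₀ ℕ :=
  Finsupp.onFinset d.support (fun j => N j * d j) fun j hj =>
    Finsupp.mem_support_iff.2 fun h => hj (by rw [h, mul_zero])

/-- The ring `k[X_j]`, regarded as an algebra over `k[X_j]` through `X_j ↦ X_j ^ {N_j}`. -/
def RootRing (k : Type*) [Field k] {J : Type*} (_N : J → ℕ) := MvPolynomial J k

variable {k : Type*} [Field k] {J : Type*} {N : J → ℕ}

noncomputable instance : CommRing (RootRing k N) := inferInstanceAs (CommRing (MvPolynomial J k))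

instance : Nontrivial (RootRing k N) := inferInstanceAs (Nontrivial (MvPolynomial J k))

/-- `X_j ↦ X_j ^ {N_j}`. -/
noncomputable def powHom (k : Type*) [Field k] {J : Type*} (N : J → ℕ) :
    MvPolynomial J k →ₐ[k] MvPolynomial J k :=
  MvPolynomial.aeval fun j => MvPolynomial.X j ^ N j

noncomputable instance : Algebra (MvPolynomial J k) (RootRing k N) :=
  ((powHom k N : MvPolynomial J k →+* MvPolynomial J k) :
    MvPolynomial J k →+* RootRing k N).toAlgebra

theorem powHom_monomial (d : J →₀ ℕ) (a : k) :
    powHom k N (MvPolynomial.monomial d a) = MvPolynomial.monomial (scaleExponent N d) a := by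
  rw [powHom, MvPolynomial.aeval_monomial, MvPolynomial.monomial_eq, scaleExponent,
    Finsupp.onFinset_prod _ fun _ => pow_zero _, MvPolynomial.algebraMap_eq, Finsupp.prod]
  simp only [pow_mul]

open Classical in
-- Uniqueness of division with remainder on exponents: `N c + e' = N d + e` with `e, e' < N` forces
-- `e' = e` and `c = d`. It extracts the coefficients in the basis of `rootRing_free`.
theorem coeff_powHom_mul_monomial (hN : ∀ j, 0 < N j) (f : MvPolynomial J k) (d e e' : J →₀ ℕ)
    (he : ∀ j, e j < N j) (he' : ∀ j, e' j < N j) :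
    MvPolynomial.coeff (scaleExponent N d + e) (powHom k N f * MvPolynomial.monomial e' 1)
      = if e' = e then MvPolynomial.coeff d f else 0 := by
  induction f using MvPolynomial.induction_on' with
  | monomial c a =>
    rw [powHom_monomial, MvPolynomial.monomial_mul, mul_one, MvPolynomial.coeff_monomial,
      MvPolynomial.coeff_monomial]
    have key : scaleExponent N c + e' = scaleExponent N d + e ↔ e' = e ∧ c = d := by
      constructor
      · intro h
        have hj : ∀ j, N j * c j + e' j = N j * d j + e j := fun j => DFunLike.congr_fun h j
        constructor
        · ext j
          have h1 := congrArg (· % N j) (hj j)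
          simpa [Nat.mul_add_mod, Nat.mod_eq_of_lt (he j), Nat.mod_eq_of_lt (he' j)] using h1
        · ext j
          have h1 := congrArg (· / N j) (hj j)
          simpa [Nat.mul_add_div (hN j), Nat.div_eq_of_lt (he j),
            Nat.div_eq_of_lt (he' j)] using h1
      · rintro ⟨rfl, rfl⟩
        rfl
    rw [if_congr key rfl rfl]
    by_cases h1 : e' = e <;> simp [h1]
  | add f g hf hg =>
    rw [map_add, add_mul, MvPolynomial.coeff_add, hf, hg]
    split_ifs <;> simp

/-- The monomials with all exponents `e_j < N_j` form a basis: dividing each exponent by `N_j` shows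
that they span, and uniqueness of the division gives independence. The set `J` may be infinite. -/
theorem rootRing_free (hN : ∀ j, 0 < N j) : Module.Free (MvPolynomial J k) (RootRing k N) := by
  let v : {e : J →₀ ℕ // ∀ j, e j < N j} → RootRing k N := fun e =>
    (MvPolynomial.monomial e.1 1 : MvPolynomial J k)
  have hsmul : ∀ (f : MvPolynomial J k) e, f • v e
      = (powHom k N f * MvPolynomial.monomial e.1 1 : MvPolynomial J k) := fun f e => rfl
  refine Module.Free.of_basis (Module.Basis.mk (v := v) ?_ ?_)
  · rw [linearIndependent_iff']
    intro s g hg e he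
    ext d
    have h1 := congrArg (MvPolynomial.lcoeff k (scaleExponent N d + e.1))
      (show (∑ i ∈ s, (powHom k N (g i) * MvPolynomial.monomial i.1 1 : MvPolynomial J k)) = 0
        from hg)
    rw [map_sum, map_zero] at h1
    simp only [MvPolynomial.lcoeff_apply] at h1
    rw [Finset.sum_congr rfl fun i _ =>
      coeff_powHom_mul_monomial hN (g i) d e.1 i.1 e.2 i.2] at h1
    rw [Finset.sum_eq_single e (fun i _ hi => if_neg fun h => hi (Subtype.ext h))
      (fun h => absurd he h), if_pos rfl] at h1
    rw [h1, MvPolynomial.coeff_zero]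
  · intro f _
    let W : Submodule (MvPolynomial J k) (RootRing k N) := Submodule.span _ (Set.range v)
    have h : ∀ f : MvPolynomial J k, (f : RootRing k N) ∈ W := by
      intro f
      induction f using MvPolynomial.induction_on' with
      | monomial d a =>
        let q : J →₀ ℕ := Finsupp.onFinset d.support (fun j => d j / N j) fun j hj =>
          Finsupp.mem_support_iff.2 fun h => hj (by rw [h, Nat.zero_div])
        let r : J →₀ ℕ := Finsupp.onFinset d.support (fun j => d j % N j) fun j hj =>
          Finsupp.mem_support_iff.2 fun h => hj (by rw [h, Nat.zero_mod])
        have hr : ∀ j, r j < N j := fun j => Nat.mod_lt _ (hN j)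
        have hd : scaleExponent N q + r = d := by
          ext j
          exact Nat.div_add_mod (d j) (N j)
        have h1 : @Eq (RootRing k N) (MvPolynomial.monomial d a : MvPolynomial J k)
            ((MvPolynomial.monomial q a : MvPolynomial J k) • v ⟨r, hr⟩) := by
          rw [hsmul, powHom_monomial, MvPolynomial.monomial_mul, mul_one, hd]
        rw [h1]
        exact W.smul_mem _ (Submodule.subset_span ⟨_, rfl⟩)
      | add f g hf hg => exact W.add_mem hf hg
    exact h f

/-- Roots of arbitrary families of elements exist in a faithfully flat extension. -/
theorem exists_faithfullyFlat_roots {k : Type u} [Field k] {J : Type} {N : J → ℕ}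
    (hN : ∀ j, 0 < N j) (A : CommAlgCat.{u} k) (a : J → A) :
    ∃ (A' : CommAlgCat.{u} k) (f : A ⟶ A'), (f.hom : A →+* A').FaithfullyFlat ∧
      ∃ b : J → A', ∀ j, b j ^ N j = f.hom (a j) := by
  -- All roots are adjoined at once, by base change along `X_j ↦ a_j` of the universal extension
  -- `X_j ↦ X_j^(N_j)`. That extension is free and nonzero, so its base change is faithfully flat
  -- over `A`.
  let := (MvPolynomial.aeval a : MvPolynomial J k →ₐ[k] A).toRingHom.toAlgebra
  have := rootRing_free (k := k) hN
  let T := TensorProduct (MvPolynomial J k) A (RootRing k N)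
  let ι : A →+* T := algebraMap A T
  let : Algebra k T := (ι.comp (algebraMap k A)).toAlgebra
  let f : A →ₐ[k] T := { ι with commutes' := fun _ => rfl }
  let X : J → RootRing k N := fun j => (MvPolynomial.X j : MvPolynomial J k)
  have hX : ∀ j, X j ^ N j = (MvPolynomial.X j : MvPolynomial J k) • (1 : RootRing k N) := by
    intro j
    rw [Algebra.smul_def, mul_one]
    exact (MvPolynomial.aeval_X (R := k)
      (fun j => (MvPolynomial.X j : MvPolynomial J k) ^ N j) j).symm
  refine ⟨CommAlgCat.of k T, CommAlgCat.ofHom f, ?_, fun j => (1 : A) ⊗ₜ[MvPolynomial J k] X j,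
    fun j => ?_⟩
  · have h : ι.FaithfullyFlat := (RingHom.faithfullyFlat_algebraMap_iff).2 inferInstance
    exact h
  · change ((1 : A) ⊗ₜ[MvPolynomial J k] X j : T) ^ N j = ι (a j)
    rw [Algebra.TensorProduct.tmul_pow (R := MvPolynomial J k) (1 : A) (X j) (N j), one_pow, hX, ← TensorProduct.smul_tmul, Algebra.smul_def,
      mul_one]
    have h2 : algebraMap (MvPolynomial J k) A (MvPolynomial.X j) = a j := MvPolynomial.aeval_X _ _
    rw [h2]
    rfl

end Roots

/-! ## The kernels -/

section Kernels

open IsLocalRing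

variable {O : Type u} [CommRing O] [IsDomain O] [IsDiscreteValuationRing O] {p h : ℕ}
  [Fact p.Prime] {π : O} (hπ : Irreducible π) (hk : Nat.card (ResidueField O) = p ^ h)

theorem natCast_p_eq_zero {k : Type*} [Field k] (hk : Nat.card k = p ^ h) (A : Type*) [CommRing A]
    [Algebra k A] : (p : A) = 0 := by
  have := charP_of_card hk
  rw [← map_natCast (algebraMap k A), CharP.cast_eq_zero, map_zero]

theorem wittDatum_uniformizer_eq_zero (A : Type*) [CommRing A] [Algebra (ResidueField O) A] :
    ((algebraMap (ResidueField O) A).comp WittVector.constantCoeff) (wittDatum hk).ϖ = 0 :=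
  (map_natCast _ p).trans (natCast_p_eq_zero hk A)

theorem drinfeldO₀_eq_zero_iff (A : CommAlgCat.{u} (ResidueField O)) (x : WittVector p A) :
    ((drinfeldO₀ hk).app A).hom x = 0 ↔ ∀ n, x.coeff n ^ p ^ (n * (h - 1)) = 0 := by
  constructor
  · intro h0 n
    rw [← coeff_drinfeldO₀ hk, h0]
    rfl
  · intro h0
    refine RamWitt.ext (funext fun n => ?_)
    exact (coeff_drinfeldO₀ hk A x n).trans (h0 n)

/-- The Witt components as coordinates on the kernel of the Drinfeld morphism. -/
noncomputable def coordsKerDrinfeld :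
    NilCoords (ker (drinfeldO₀ hk)) fun n : ℕ => p ^ (n * (h - 1)) where
  coord A x n := WittVector.coeff x.1 n
  coord_map _ _ _ := rfl
  injective A x y hxy := Subtype.ext (WittVector.ext fun n => congrFun hxy n)
  exists_iff A y := by
    constructor
    · rintro ⟨x, rfl⟩ n
      exact (drinfeldO₀_eq_zero_iff hk A x.1).1 x.2 n
    · intro hy
      exact ⟨⟨WittVector.mk p y, (drinfeldO₀_eq_zero_iff hk A _).2 hy⟩, rfl⟩

theorem isLevel_coordsKerDrinfeld : (coordsKerDrinfeld hk).IsLevel id := fun A N x y =>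
  wittVector_coeff_sub_eq_zero_iff (natCast_p_eq_zero hk A) x.1 y.1 N

theorem isProInfinitesimal_ker_drinfeldO₀ : IsProInfinitesimal (ker (drinfeldO₀ hk)) :=
  NilCoords.isProInfinitesimal (isLevel_coordsKerDrinfeld hk)
    (fun _ => pow_pos (Fact.out : p.Prime).pos _) fun N =>
    (Set.finite_lt_nat N).to_subtype

variable [IsAdicComplete (maximalIdeal O) O]

theorem r_app_apply (A : CommAlgCat.{u} (ResidueField O)) (x : (greenberg hπ hk).obj A) :
    ((uRam hπ hk).app A).hom (((toRamTensor hπ hk).app A).hom x) = ((r hπ hk).app A).hom x := by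
  rw [← toRamTensor_comp_uRam]
  rfl

variable [CharZero O] {e : ℕ}
  (he : IsDiscreteValuationRing.addVal O (p : O) = e)

theorem ramTensorCoord_symm_map {A A' : CommAlgCat.{u} (ResidueField O)} (f : A ⟶ A')
    (x : (ramTensor hπ hk).obj A) (i : Fin e) :
    (ramTensorCoord hπ hk he A').symm (((ramTensor hπ hk).map f).hom x) i
      = ((ramWittO₀ hk).map f).hom ((ramTensorCoord hπ hk he A).symm x i) := by
  obtain ⟨x, rfl⟩ := (ramTensorCoord hπ hk he A).surjective x
  rw [map_ramTensorCoord, AddEquiv.symm_apply_apply, AddEquiv.symm_apply_apply]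

theorem greenbergCoord_symm_map {A A' : CommAlgCat.{u} (ResidueField O)} (f : A ⟶ A')
    (x : (greenberg hπ hk).obj A) (i : Fin e) :
    (greenbergCoord hπ hk he A').symm (((greenberg hπ hk).map f).hom x) i
      = WittVector.map (f.hom : A →+* A') ((greenbergCoord hπ hk he A).symm x i) := by
  obtain ⟨x, rfl⟩ := (greenbergCoord hπ hk he A).surjective x
  rw [map_greenbergCoord, AddEquiv.symm_apply_apply, AddEquiv.symm_apply_apply]

/-- The components as coordinates on the kernel of `u^ra`. -/
noncomputable def coordsKerURam : NilCoords (ker (uRam hπ hk))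
    fun j : ℕ × Fin e => (p ^ h) ^ (j.1 * (e - 1) + (j.2 : ℕ)) where
  coord A x j := RamWitt.coeff ((ramTensorCoord hπ hk he A).symm x.1 j.2) j.1
  coord_map f x j := by
    have h1 := ramTensorCoord_symm_map hπ hk he f x.1 j.2
    exact congrArg (fun z => RamWitt.coeff z j.1) h1
  injective A x y hxy := Subtype.ext ((ramTensorCoord hπ hk he A).symm.injective
    (funext fun i => RamWitt.ext (funext fun n => congrFun hxy (n, i))))
  exists_iff A y := by
    constructor
    · rintro ⟨x, rfl⟩ j
      refine (uRam_ramTensorCoord_eq_zero_iff hπ hk he A _).1 ?_ j.1 j.2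
      rw [AddEquiv.apply_symm_apply]
      exact x.2
    · intro hy
      refine ⟨⟨ramTensorCoord hπ hk he A fun i => ⟨fun n => y (n, i)⟩,
        (uRam_ramTensorCoord_eq_zero_iff hπ hk he A _).2 fun n i => hy (n, i)⟩, ?_⟩
      funext j
      exact congrArg (fun z => RamWitt.coeff (z j.2) j.1)
        ((ramTensorCoord hπ hk he A).symm_apply_apply _)

/-- The level is the Witt index alone: each of the `e` coordinate vectors is truncated at length
`N`, leaving finitely many coordinates. -/
theorem isLevel_coordsKerURam : (coordsKerURam hπ hk he).IsLevel Prod.fst := fun A N x y => by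
  have h1 : ∀ i, (ramTensorCoord hπ hk he A).symm (x - y).1 i
      = (ramTensorCoord hπ hk he A).symm x.1 i - (ramTensorCoord hπ hk he A).symm y.1 i := fun i =>
    congrFun (map_sub (ramTensorCoord hπ hk he A).symm x.1 y.1) i
  have h2 := fun i => RamWitt.coeff_sub_eq_zero_iff (wittDatum_uniformizer_eq_zero hk A)
    ((ramTensorCoord hπ hk he A).symm x.1 i) ((ramTensorCoord hπ hk he A).symm y.1 i) N
  constructor
  · intro H j hj
    refine (h2 j.2).1 (fun n hn => ?_) j.1 hj
    exact (congrArg (fun z => RamWitt.coeff z n) (h1 j.2)).symm.trans (H (n, j.2) hn)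
  · intro H j hj
    have := (h2 j.2).2 (fun n hn => H (n, j.2) hn) j.1 hj
    exact (congrArg (fun z => RamWitt.coeff z j.1) (h1 j.2)).trans this

theorem isProInfinitesimal_ker_uRam {e : ℕ}
    (he : IsDiscreteValuationRing.addVal O (p : O) = e) : IsProInfinitesimal (ker (uRam hπ hk)) :=
  NilCoords.isProInfinitesimal (isLevel_coordsKerURam hπ hk he)
    (fun _ => pow_pos (pow_pos (Fact.out : p.Prime).pos _) _) fun N => by
    have : Finite {n : ℕ // n < N} := (Set.finite_lt_nat N).to_subtype
    exact Finite.of_injective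
      (fun j : {j : ℕ × Fin e // j.1 < N} => ((⟨j.1.1, j.2⟩, j.1.2) : {n : ℕ // n < N} × Fin e))
      fun j j' hj => Subtype.ext (Prod.ext (congrArg (fun z => z.1.1) hj)
        (congrArg (fun z => z.2) hj))

/-- The components as coordinates on the kernel of `r`. -/
noncomputable def coordsKerR : NilCoords (ker (r hπ hk))
    fun j : ℕ × Fin e => p ^ (j.1 * (h - 1)) * (p ^ h) ^ (j.1 * (e - 1) + (j.2 : ℕ)) where
  coord A x j := WittVector.coeff ((greenbergCoord hπ hk he A).symm x.1 j.2) j.1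
  coord_map f x j := by
    have h1 := greenbergCoord_symm_map hπ hk he f x.1 j.2
    exact congrArg (fun z => WittVector.coeff z j.1) h1
  injective A x y hxy := Subtype.ext ((greenbergCoord hπ hk he A).symm.injective
    (funext fun i => WittVector.ext fun n => congrFun hxy (n, i)))
  exists_iff A y := by
    constructor
    · rintro ⟨x, rfl⟩ j
      refine (r_greenbergCoord_eq_zero_iff hπ hk he A _).1 ?_ j.1 j.2
      rw [AddEquiv.apply_symm_apply]
      exact x.2
    · intro hy
      refine ⟨⟨greenbergCoord hπ hk he A fun i => WittVector.mk p fun n => y (n, i),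
        (r_greenbergCoord_eq_zero_iff hπ hk he A _).2 fun n i => hy (n, i)⟩, ?_⟩
      funext j
      exact congrArg (fun z => WittVector.coeff (z j.2) j.1)
        ((greenbergCoord hπ hk he A).symm_apply_apply _)

/-! ## The exact sequence -/

theorem toRamTensor_greenbergCoord_eq_zero_iff (A : CommAlgCat.{u} (ResidueField O))
    (x : Fin e → WittVector p A) :
    ((toRamTensor hπ hk).app A).hom (greenbergCoord hπ hk he A x) = 0 ↔
      ∀ i, ((drinfeldO₀ hk).app A).hom (x i) = 0 := by
  rw [toRamTensor_greenbergCoord]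
  exact (map_eq_zero_iff _ (ramTensorCoord hπ hk he A).injective).trans funext_iff

/-- The inclusion `∏ ker u → ker r`, `(x_i) ↦ ∑ x_i ⊗ π^i`. -/
noncomputable def kerInclusion : power e (ker (drinfeldO₀ hk)) ⟶ ker (r hπ hk) where
  app A := AddCommGrpCat.ofHom
    { toFun := fun x => ⟨greenbergCoord hπ hk he A fun i => (x i).1, by
        refine (r_app_apply hπ hk A _).symm.trans ?_
        rw [(toRamTensor_greenbergCoord_eq_zero_iff hπ hk he A _).2 fun i => (x i).2, map_zero]⟩
      map_zero' := Subtype.ext (map_zero (greenbergCoord hπ hk he A))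
      map_add' := fun x y => Subtype.ext (map_add (greenbergCoord hπ hk he A)
        (fun i => (x i).1) fun i => (y i).1) }
  naturality A A' f := by
    refine AddCommGrpCat.hom_ext (AddMonoidHom.ext fun x => Subtype.ext ?_)
    exact (map_greenbergCoord hπ hk he f fun i => (x i).1).symm

/-- The morphism `ker r → ker u^ra` induced by `u ⊗ O`. -/
noncomputable def kerProjection : ker (r hπ hk) ⟶ ker (uRam hπ hk) where
  app A := AddCommGrpCat.ofHom
    { toFun := fun x => ⟨((toRamTensor hπ hk).app A).hom x.1,
        (r_app_apply hπ hk A x.1).trans x.2⟩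
      map_zero' := Subtype.ext (map_zero ((toRamTensor hπ hk).app A).hom)
      map_add' := fun x y => Subtype.ext (map_add ((toRamTensor hπ hk).app A).hom x.1 y.1) }
  naturality A A' f := by
    refine AddCommGrpCat.hom_ext (AddMonoidHom.ext fun x => Subtype.ext ?_)
    exact ConcreteCategory.congr_hom ((toRamTensor hπ hk).naturality f) x.1

/-- In coordinates `u ⊗ O` is `u` applied to each of the `e` vectors. Its kernel is therefore `∏ ker
u`, contained in `ker r` by the factorization of `r`. Surjectivity onto `ker u^ra` amounts to
solving `b_{n,i}^(p^(n(h-1))) = x_{n,i}`, possible after a faithfully flat extension. -/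
theorem isExtension_ker : IsExtension (kerInclusion hπ hk he) (kerProjection hπ hk) where
  affine_left := ((coordsKerDrinfeld hk).power e).isAffineGroup
  affine_middle := (coordsKerR hπ hk he).isAffineGroup
  affine_right := (coordsKerURam hπ hk he).isAffineGroup
  injective A x y hxy := by
    have h1 := (greenbergCoord hπ hk he A).injective (congrArg Subtype.val hxy)
    exact funext fun i => Subtype.ext (congrFun h1 i)
  exact A g := by
    constructor
    · intro h0
      have h1 : ((toRamTensor hπ hk).app A).hom (greenbergCoord hπ hk he A
          ((greenbergCoord hπ hk he A).symm g.1)) = 0 := by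
        rw [AddEquiv.apply_symm_apply]
        exact congrArg Subtype.val h0
      exact ⟨fun i => ⟨(greenbergCoord hπ hk he A).symm g.1 i,
        (toRamTensor_greenbergCoord_eq_zero_iff hπ hk he A _).1 h1 i⟩,
        Subtype.ext ((greenbergCoord hπ hk he A).apply_symm_apply g.1)⟩
    · rintro ⟨x, rfl⟩
      exact Subtype.ext ((toRamTensor_greenbergCoord_eq_zero_iff hπ hk he A _).2 fun i => (x i).2)
  surjective A x := by
    obtain ⟨A', f, hf, b, hb⟩ := exists_faithfullyFlat_roots
      (N := fun j : ℕ × Fin e => p ^ (j.1 * (h - 1))) (fun _ => pow_pos (Fact.out : p.Prime).pos _) A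
      fun j => RamWitt.coeff ((ramTensorCoord hπ hk he A).symm x.1 j.2) j.1
    have h1 : ((toRamTensor hπ hk).app A').hom (greenbergCoord hπ hk he A'
        fun i => WittVector.mk p fun n => b (n, i)) = ((ramTensor hπ hk).map f).hom x.1 := by
      rw [toRamTensor_greenbergCoord, ← (ramTensorCoord hπ hk he A).apply_symm_apply x.1,
        map_ramTensorCoord]
      refine congrArg _ (funext fun i => RamWitt.ext (funext fun n => ?_))
      exact (coeff_drinfeldO₀ hk A' _ n).trans (hb (n, i))
    refine ⟨A', f, hf, ⟨greenbergCoord hπ hk he A' fun i => WittVector.mk p fun n => b (n, i), ?_⟩,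
      Subtype.ext h1⟩
    -- The preimage found lies in `ker r`: its image under `r` is `u^ra` of the base change of `x`,
    -- which is zero by naturality.
    refine (r_app_apply hπ hk A' _).symm.trans ?_
    rw [h1]
    refine (ConcreteCategory.congr_hom ((uRam hπ hk).naturality f) x.1).trans ?_
    have h2 : ((uRam hπ hk).app A).hom x.1 = 0 := x.2
    exact (congrArg ((ramWittO hπ hk).map f).hom h2).trans (map_zero _)

end Kernels

/-! ## The unramified and the totally ramified case -/

section SpecialCases

open IsLocalRing

variable {O : Type u} [CommRing O] [IsDomain O] [IsDiscreteValuationRing O] {p h : ℕ}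
  [Fact p.Prime] {π : O} (hπ : Irreducible π) (hk : Nat.card (ResidueField O) = p ^ h)

theorem isIso_of_bijective_app {k : Type u} [Field k] {F G : CommAlgCat.{u} k ⥤ CommRingCat.{u}}
    (τ : F ⟶ G) (hτ : ∀ A, Function.Bijective (τ.app A).hom) : IsIso τ := by
  have : ∀ A, IsIso (τ.app A) := fun A =>
    (RingEquiv.ofBijective (τ.app A).hom (hτ A)).toCommRingCatIso.isIso_hom
  exact NatIso.isIso_of_isIso_app τ

/-- `p` is irreducible in `W(k)`, hence in `O` under any ring isomorphism, so it is itself a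
uniformizing parameter. -/
theorem ramificationIndex_eq_one {e : ℕ} (he : IsDiscreteValuationRing.addVal O (p : O) = e)
    (hk : Nat.card (ResidueField O) = p ^ h)
    (ψ : O ≃+* WittVector p (ResidueField O)) : e = 1 := by
  have := charP_of_card hk
  have hfin : Finite (ResidueField O) := Nat.finite_of_card_ne_zero
    (by rw [hk]; exact pow_ne_zero _ (Fact.out : p.Prime).ne_zero)
  have h1 : Irreducible (p : O) := by
    rw [← MulEquiv.irreducible_iff ψ, map_natCast]
    exact WittVector.irreducible p
  rw [IsDiscreteValuationRing.addVal_uniformizer h1] at he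
  exact_mod_cast he.symm

theorem residueDegree_eq_one (hk : Nat.card (ResidueField O) = p ^ h)
    (ψ : ResidueField O ≃+* ZMod p) : h = 1 := by
  rw [Nat.card_congr ψ.toEquiv, Nat.card_zmod] at hk
  exact (Nat.pow_right_injective (Fact.out : p.Prime).two_le
    ((pow_one p).trans hk)).symm

theorem drinfeldO₀_eq_mk_coeff (hh : h = 1) (A : CommAlgCat.{u} (ResidueField O))
    (x : WittVector p A) : ((drinfeldO₀ hk).app A).hom x = ⟨x.coeff⟩ := by
  refine RamWitt.ext (funext fun n => (coeff_drinfeldO₀ hk A x n).trans ?_)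
  have h0 : h - 1 = 0 := by omega
  rw [h0, mul_zero, pow_zero, pow_one]

variable [IsAdicComplete (maximalIdeal O) O] [CharZero O]

theorem isIso_toGreenberg (he : IsDiscreteValuationRing.addVal O (p : O) = (1 : ℕ)) :
    IsIso (toGreenberg hπ hk) := by
  refine isIso_of_bijective_app _ fun A => ?_
  have h1 : ⇑((toGreenberg hπ hk).app A).hom
      = greenbergCoord hπ hk he A ∘ (Equiv.funUnique (Fin 1) (WittVector p A)).symm := by
    funext x
    have h2 : greenbergCoord hπ hk he A (fun _ => x) = TensorRing.tmul
        ((wittScalars p (ResidueField O)).hom A) (embO₀ hπ hk) x (π ^ ((0 : Fin 1) : ℕ)) :=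
      Fin.sum_univ_one fun i : Fin 1 => TensorRing.tmul
        ((wittScalars p (ResidueField O)).hom A) (embO₀ hπ hk) x (π ^ (i : ℕ))
    exact (congrArg (TensorRing.tmul ((wittScalars p (ResidueField O)).hom A) (embO₀ hπ hk) x)
      (pow_zero π).symm).trans h2.symm
  rw [h1]
  exact (greenbergCoord hπ hk he A).bijective.comp (Equiv.bijective _)

theorem isSpec_ker_r_unram (he : IsDiscreteValuationRing.addVal O (p : O) = (1 : ℕ)) :
    IsSpec (ker (r hπ hk)) (UnramRing (ResidueField O) p h) :=
  ((coordsKerR hπ hk he).reindex (m' := fun n => p ^ (n * (h - 1)))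
    (Equiv.prodUnique ℕ (Fin 1)).symm fun n => by simp).isSpec

/-- For `h = 1` the exponents `p^(n(h-1))` are all `1`: the morphism `u` is the identity on
components, and so is its base change in coordinates. -/
theorem isIso_toRamTensor (hh : h = 1) {e : ℕ}
    (he : IsDiscreteValuationRing.addVal O (p : O) = e) : IsIso (toRamTensor hπ hk) := by
  refine isIso_of_bijective_app _ fun A => ?_
  have hb : Function.Bijective ((drinfeldO₀ hk).app A).hom := by
    constructor
    · intro x y hxy
      have hxy' := (drinfeldO₀_eq_mk_coeff hk hh A x).symm.trans
        (hxy.trans (drinfeldO₀_eq_mk_coeff hk hh A y))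
      exact WittVector.ext fun n => congrFun (congrArg RamWitt.coeff hxy') n
    · intro y
      exact ⟨WittVector.mk p y.coeff, drinfeldO₀_eq_mk_coeff hk hh A _⟩
  have h1 : ⇑((toRamTensor hπ hk).app A).hom = ramTensorCoord hπ hk he A
      ∘ (fun x i => ((drinfeldO₀ hk).app A).hom (x i)) ∘ (greenbergCoord hπ hk he A).symm := by
    funext x
    obtain ⟨x, rfl⟩ := (greenbergCoord hπ hk he A).surjective x
    rw [toRamTensor_greenbergCoord, Function.comp_apply, Function.comp_apply,
      AddEquiv.symm_apply_apply]
  rw [h1]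
  refine (ramTensorCoord hπ hk he A).bijective.comp
    (Function.Bijective.comp ⟨fun x y hxy => ?_, fun y => ?_⟩ (AddEquiv.bijective _))
  · exact funext fun i => hb.1 (congrFun hxy i)
  · choose x hx using fun i => hb.2 (y i)
    exact ⟨x, funext hx⟩

theorem isSpec_ker_r_ram (hh : h = 1) {e : ℕ}
    (he : IsDiscreteValuationRing.addVal O (p : O) = e) :
    IsSpec (ker (r hπ hk)) (RamRing (ResidueField O) p e) := by
  have hm : ∀ j : ℕ × Fin e, p ^ (j.1 * (e - 1) + (j.2 : ℕ))
      = p ^ (j.1 * (h - 1)) * (p ^ h) ^ (j.1 * (e - 1) + (j.2 : ℕ)) := fun j => by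
    have h0 : h - 1 = 0 := by omega
    have h1 : p ^ h = p := (congrArg (p ^ ·) hh).trans (pow_one p)
    rw [h0, mul_zero, pow_zero, one_mul, h1]
  exact ((coordsKerR hπ hk he).reindex (Equiv.refl _) hm).isSpec

end SpecialCases

end RamifiedWitt

/-! ### The main theorem -/

theorem mainTheorem6 {O : Type u} [CommRing O] [IsDomain O] [IsDiscreteValuationRing O]
    [CharZero O] [IsAdicComplete (IsLocalRing.maximalIdeal O) O]
    {p h e : ℕ} [Fact p.Prime] {π : O} (hπ : Irreducible π)
    (hk : Nat.card (IsLocalRing.ResidueField O) = p ^ h)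
    (he : IsDiscreteValuationRing.addVal O (p : O) = e) :
    -- (a)
    (Nonempty (O ≃+* WittVector p (IsLocalRing.ResidueField O)) →
      IsIso (RamifiedWitt.toGreenberg hπ hk) ∧
      RamifiedWitt.toGreenberg hπ hk ≫ RamifiedWitt.r hπ hk = RamifiedWitt.drinfeldO hπ hk ∧
      RamifiedWitt.IsSpec (RamifiedWitt.ker (RamifiedWitt.r hπ hk))
        (RamifiedWitt.UnramRing (IsLocalRing.ResidueField O) p h)) ∧
    -- (b)
    (Nonempty (IsLocalRing.ResidueField O ≃+* ZMod p) →
      (∃ ε : RamifiedWitt.greenberg hπ hk ≅ RamifiedWitt.ramTensor hπ hk,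
        (∀ (A : CommAlgCat.{u} (IsLocalRing.ResidueField O)) (x : WittVector p A) (c : O),
          (ε.hom.app A).hom (RamifiedWitt.TensorRing.tmul
              ((RamifiedWitt.wittScalars p (IsLocalRing.ResidueField O)).hom A)
              (RamifiedWitt.embO₀ hπ hk) x c) =
            RamifiedWitt.TensorRing.tmul
              ((RamifiedWitt.ramWittScalars (RamifiedWitt.wittDatum hk)
                WittVector.constantCoeff).hom A)
              (RamifiedWitt.embO₀ hπ hk) ⟨x.coeff⟩ c) ∧
        ε.hom ≫ RamifiedWitt.uRam hπ hk = RamifiedWitt.r hπ hk) ∧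
      RamifiedWitt.IsSpec (RamifiedWitt.ker (RamifiedWitt.r hπ hk))
        (RamifiedWitt.RamRing (IsLocalRing.ResidueField O) p e)) ∧
    -- (c)
    (RamifiedWitt.IsSpec (RamifiedWitt.ker (RamifiedWitt.drinfeldO₀ hk))
        (RamifiedWitt.UnramRing (IsLocalRing.ResidueField O) p h) ∧
      RamifiedWitt.IsProInfinitesimal (RamifiedWitt.ker (RamifiedWitt.drinfeldO₀ hk)) ∧
      RamifiedWitt.IsSpec (RamifiedWitt.ker (RamifiedWitt.uRam hπ hk))
        (RamifiedWitt.RamRing (IsLocalRing.ResidueField O) (p ^ h) e) ∧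
      RamifiedWitt.IsProInfinitesimal (RamifiedWitt.ker (RamifiedWitt.uRam hπ hk)) ∧
      ∃ (i : RamifiedWitt.power e (RamifiedWitt.ker (RamifiedWitt.drinfeldO₀ hk)) ⟶
            RamifiedWitt.ker (RamifiedWitt.r hπ hk))
        (j : RamifiedWitt.ker (RamifiedWitt.r hπ hk) ⟶
            RamifiedWitt.ker (RamifiedWitt.uRam hπ hk)),
        RamifiedWitt.IsExtension i j) := by
  refine ⟨?_, ?_, ?_⟩
  · rintro ⟨ψ⟩
    -- The given isomorphism serves only to force `e = 1`; the isomorphism asserted in (a) comes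
    -- from the canonical embedding `embO₀`.
    obtain rfl := RamifiedWitt.ramificationIndex_eq_one he hk ψ
    exact ⟨RamifiedWitt.isIso_toGreenberg hπ hk he, RamifiedWitt.toGreenberg_comp_r hπ hk,
      RamifiedWitt.isSpec_ker_r_unram hπ hk he⟩
  · rintro ⟨ψ⟩
    have hh := RamifiedWitt.residueDegree_eq_one hk ψ
    have := RamifiedWitt.isIso_toRamTensor hπ hk hh he
    refine ⟨⟨asIso (RamifiedWitt.toRamTensor hπ hk), fun A x c => ?_,
      RamifiedWitt.toRamTensor_comp_uRam hπ hk⟩, RamifiedWitt.isSpec_ker_r_ram hπ hk hh he⟩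
    refine (RamifiedWitt.TensorRing.map_tmul _ (RamifiedWitt.drinfeldO₀_scalar hk A) x c).trans ?_
    rw [RamifiedWitt.drinfeldO₀_eq_mk_coeff hk hh]
  · exact ⟨(RamifiedWitt.coordsKerDrinfeld hk).isSpec,
      RamifiedWitt.isProInfinitesimal_ker_drinfeldO₀ hk,
      (RamifiedWitt.coordsKerURam hπ hk he).isSpec,
      RamifiedWitt.isProInfinitesimal_ker_uRam hπ hk he,
      RamifiedWitt.kerInclusion hπ hk he, RamifiedWitt.kerProjection hπ hk,
      RamifiedWitt.isExtension_ker hπ hk he⟩
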